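/- All composites are written in diagrammatic order. A linearly distributive category (LDC) $(\mathbb X,\otimes,\top,\oplus,\bot)$ is a category with two monoidal structures and natural linear distributors $\delta^L:A\otimes(B\oplus C)\to(A\otimes B)\oplus C$, $\delta^R:(B\oplus C)\otimes A\to B\oplus(C\otimes A)$ satisfying the standard (non-symmetric) coherences with unitors and associators. Its opposite $\mathbb X^{op}$ is an LDC with $\otimes$ and $\oplus$ exchanged. It is $*$-autonomous if every object has a chosen left linear dual $(\eta{*},\epsilon{*}):A^*\dashv A$ and a chosen right linear dual $({*}\eta,{*}\epsilon):A\dashv{}^*\!A$, where $(\eta,\epsilon):B\dashv A$ means $\eta:\top\to B\oplus A$, $\epsilon:A\otimes B\to\bot$ satisfying the two snake equations. A cyclor is a natural isomorphism $\psi_A:A^*\to{}^*\!A$ commuting with the canonical isomorphisms $\bot^*\cong\top\cong{}^*\bot$, $\top^*\cong\bot\cong{}^*\top$, $(A\otimes B)^*\cong B^*\oplus A^*$, ${}^*(A\otimes B)\cong{}^*\!B\oplus{}^*\!A$, $(A\oplus B)^*\cong B^*\otimes A^*$, ${}^*(A\oplus B)\cong{}^*\!B\otimes{}^*\!A$, and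 such that $A\cong({}^*\!A)^*\xrightarrow{(\psi_A)^*}A^{**}\xrightarrow{\psi_{A^*}}{}^*(A^*)$ is the canonical isomorphism. A conjugation on an LDC is a functor $\overline{(\_)}:\mathbb X\to\mathbb X$ with natural isomorphisms $\chi_\otimes:\bar A\otimes\bar B\to\overline{B\otimes A}$, $\chi_\oplus:\overline{A\oplus B}\to\bar B\oplus\bar A$, $\varepsilon_A:\bar{\bar A}\to A$ such that $\overline{\varepsilon_A}=\varepsilon_{\bar A}$, $\chi_\otimes$ and $\chi_\oplus^{-1}$ are compatible with the associators and with $\varepsilon$ (i.e. $\chi_\otimes\,\overline{\chi_\otimes}\,\varepsilon=\varepsilon\otimes\varepsilon$, and likewise for $\chi_\oplus^{-1}$), and $\chi_\otimes,\chi_\oplus$ are compatible with the linear distributors. There are then canonical isomorphisms $\chi^\circ_\top:\top\to\bar\top$ and $\chi^\circ_\bot:\bot\to\bar\bot$. The conjugation is compatible with the cyclor $\psi$ if for every $A$ the composite $\sigma_A:(\bar A)^*\xrightarrow{\psi_{\bar A}}{}^*(\bar A)\cong\overline{A^*}$ equals $(\bar A)^*\cong\overline{{}^*\!A}\xrightarrow{\overline{\psi_A^{-1}}}\overline{A^*}$.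 A dagger on an LDC $\mathbb X$ is a Frobenius linear functor $(\_)^\dagger:\mathbb X^{op}\to\mathbb X$ (a linear functor with equal tensor and par components, whose linear strengths are its laxor and colaxor) together with a linear adjunction $(\_)^\dagger\dashv((\_)^{\dagger})^{op}$ which is a linear equivalence (unit and counit are linear natural isomorphisms) and is involutive: the unit and the counit are the same map of $\mathbb X$. An LDC with a dagger is a $\dagger$-LDC; a $\dagger$-LDC with chosen left and right duals is a $\dagger$-$*$-autonomous category. **Theorem.** Let $\mathbb X$ be a $*$-autonomous category with a cyclor $\psi$ and a conjugation compatible with $\psi$. Then $\mathbb X$ is a $\dagger$-$*$-autonomous category, with dagger $A\mapsto A^\dagger:=\overline{A^*}$. In detail: 1. The maps $\sigma_A$ form a natural isomorphism $\overline{(\_)}^{\,*}\cong\overline{(\_)^*}$. 2. The functor $(\_)^\dagger=\overline{(\_)^*}:\mathbb X^{op}\to\mathbb X$, with the composite laxors and colaxors $A^\dagger\otimes B^\dagger\xrightarrow{\chi_\otimes}\overline{B^*\otimes A^*}\cong(A\oplus B)^\dagger$, $\ \top\xrightarrow{\chi^\circ_\top}\bar\top\cong\bot^\dagger$, $\ (A\otimes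 B)^\dagger\cong\overline{B^*\oplus A^*}\xrightarrow{\chi_\oplus}A^\dagger\oplus B^\dagger$, $\ \top^\dagger\cong\bar\bot\xrightarrow{(\chi^\circ_\bot)^{-1}}\bot$, is a dagger, for a suitable linear involutive equivalence $(\_)^\dagger\dashv((\_)^\dagger)^{op}$. The tensor component of the unit of this equivalence at $A$, as a map $A^{\dagger\dagger}\to A$ of $\mathbb X$, is $$\overline{(\overline{A^*})^*}\xrightarrow{\sigma^{-1}_{\overline{A^*}}}(\overline{\overline{A^*}})^*\xrightarrow{(\varepsilon_{A^*}^{-1})^*}A^{**}\xrightarrow{\psi_{A^*}}{}^*(A^*)\cong A,$$ the tensor component of its counit is $$\overline{(\overline{A^*})^*}\xrightarrow{\overline{(\sigma_A)^*}}\overline{(\bar A)^{**}}\xrightarrow{\overline{\psi_{(\bar A)^*}}}\overline{{}^*((\bar A)^*)}\cong\overline{\overline{A}}\xrightarrow{\varepsilon_A}A,$$ these two maps are equal, and their common inverse $\iota_A:A\to A^{\dagger\dagger}$ (the involutor) is the par component of both the unit and the counit. -/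

import Mathlib

open CategoryTheory Opposite

universe v u v' u'

/-! ## Linearly distributive categories -/

/-- A category with two monoidal structures: the tensor (with unit top) and the par (with unit
bottom). -/
class TwoMonoidal (C : Type u) [Category.{v} C] where
  /-- the tensor structure -/
  tens : MonoidalCategory C
  /-- the par structure -/
  par : MonoidalCategory C

section Notations

variable {C : Type u} [Category.{v} C] [TwoMonoidal C]

/-- The tensor of objects. -/
abbrev tObj (A B : C) : C := TwoMonoidal.tens.tensorObj A B

/-- The par of objects. -/
abbrev pObj (A B : C) : C := TwoMonoidal.par.tensorObj A B

infixr:70 " ⊠ " => tObj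
infixr:70 " ⅋ " => pObj

/-- The tensor of morphisms. -/
abbrev tHom {A B A' B' : C} (f : A ⟶ A') (g : B ⟶ B') : A ⊠ B ⟶ A' ⊠ B' :=
  TwoMonoidal.tens.tensorHom f g

/-- The par of morphisms. -/
abbrev pHom {A B A' B' : C} (f : A ⟶ A') (g : B ⟶ B') : A ⅋ B ⟶ A' ⅋ B' :=
  TwoMonoidal.par.tensorHom f g

infixr:70 " ⊠ₘ " => tHom
infixr:70 " ⅋ₘ " => pHom

variable (C) in
/-- The unit of the tensor. -/
abbrev tUnit : C := TwoMonoidal.tens.tensorUnit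

variable (C) in
/-- The unit of the par. -/
abbrev pUnit : C := TwoMonoidal.par.tensorUnit

/-- The associator of the tensor. -/
abbrev aT (A B D : C) : (A ⊠ B) ⊠ D ≅ A ⊠ (B ⊠ D) := TwoMonoidal.tens.associator A B D

/-- The left unitor of the tensor. -/
abbrev lT (A : C) : tUnit C ⊠ A ≅ A := TwoMonoidal.tens.leftUnitor A

/-- The right unitor of the tensor. -/
abbrev rT (A : C) : A ⊠ tUnit C ≅ A := TwoMonoidal.tens.rightUnitor A

/-- The associator of the par. -/
abbrev aP (A B D : C) : (A ⅋ B) ⅋ D ≅ A ⅋ (B ⅋ D) := TwoMonoidal.par.associator A B D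

/-- The left unitor of the par. -/
abbrev lP (A : C) : pUnit C ⅋ A ≅ A := TwoMonoidal.par.leftUnitor A

/-- The right unitor of the par. -/
abbrev rP (A : C) : A ⅋ pUnit C ≅ A := TwoMonoidal.par.rightUnitor A

end Notations

/-! ### Bifunctoriality, and cancellation under the two bifunctors -/

section Bifunctor

variable {C : Type u} [Category.{v} C] [TwoMonoidal C]

theorem tHom_comp {A B A' B' A'' B'' : C} (f : A ⟶ A') (g : B ⟶ B') (f' : A' ⟶ A'')
    (g' : B' ⟶ B'') : (f ⊠ₘ g) ≫ (f' ⊠ₘ g') = (f ≫ f') ⊠ₘ (g ≫ g') :=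
  TwoMonoidal.tens.tensorHom_comp_tensorHom f g f' g'

theorem pHom_comp {A B A' B' A'' B'' : C} (f : A ⟶ A') (g : B ⟶ B') (f' : A' ⟶ A'')
    (g' : B' ⟶ B'') : (f ⅋ₘ g) ≫ (f' ⅋ₘ g') = (f ≫ f') ⅋ₘ (g ≫ g') :=
  TwoMonoidal.par.tensorHom_comp_tensorHom f g f' g'

theorem tHom_id (A B : C) : 𝟙 A ⊠ₘ 𝟙 B = 𝟙 (A ⊠ B) := TwoMonoidal.tens.id_tensorHom_id A B

theorem pHom_id (A B : C) : 𝟙 A ⅋ₘ 𝟙 B = 𝟙 (A ⅋ B) := TwoMonoidal.par.id_tensorHom_id A B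

/-- The tensor of two isomorphisms. -/
abbrev tIso {A B A' B' : C} (f : A ≅ A') (g : B ≅ B') : A ⊠ B ≅ A' ⊠ B' where
  hom := f.hom ⊠ₘ g.hom
  inv := f.inv ⊠ₘ g.inv
  hom_inv_id := by rw [tHom_comp, f.hom_inv_id, g.hom_inv_id, tHom_id]
  inv_hom_id := by rw [tHom_comp, f.inv_hom_id, g.inv_hom_id, tHom_id]

/-- The par of two isomorphisms. -/
abbrev pIso {A B A' B' : C} (f : A ≅ A') (g : B ≅ B') : A ⅋ B ≅ A' ⅋ B' where
  hom := f.hom ⅋ₘ g.hom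
  inv := f.inv ⅋ₘ g.inv
  hom_inv_id := by rw [pHom_comp, f.hom_inv_id, g.hom_inv_id, pHom_id]
  inv_hom_id := by rw [pHom_comp, f.inv_hom_id, g.inv_hom_id, pHom_id]

end Bifunctor

/-- A (not necessarily symmetric) linearly distributive category: two monoidal structures with
natural linear distributors, coherent with the unitors and associators. -/
class LinDistCat (C : Type u) [Category.{v} C] extends TwoMonoidal C where
  /-- the left linear distributor -/
  δL (A B D : C) : A ⊠ (B ⅋ D) ⟶ (A ⊠ B) ⅋ D
  /-- the right linear distributor -/
  δR (A B D : C) : (A ⅋ B) ⊠ D ⟶ A ⅋ (B ⊠ D)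
  δL_natural {A A' B B' D D' : C} (f : A ⟶ A') (g : B ⟶ B') (h : D ⟶ D') :
    (f ⊠ₘ (g ⅋ₘ h)) ≫ δL A' B' D' = δL A B D ≫ ((f ⊠ₘ g) ⅋ₘ h)
  δR_natural {A A' B B' D D' : C} (f : A ⟶ A') (g : B ⟶ B') (h : D ⟶ D') :
    ((f ⅋ₘ g) ⊠ₘ h) ≫ δR A' B' D' = δR A B D ≫ (f ⅋ₘ (g ⊠ₘ h))
  δL_tUnit (B D : C) : δL (tUnit C) B D ≫ ((lT B).hom ⅋ₘ 𝟙 D) = (lT (B ⅋ D)).hom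
  δL_pUnit (A B : C) : δL A B (pUnit C) ≫ (rP (A ⊠ B)).hom = 𝟙 A ⊠ₘ (rP B).hom
  δR_tUnit (A B : C) : δR A B (tUnit C) ≫ (𝟙 A ⅋ₘ (rT B).hom) = (rT (A ⅋ B)).hom
  δR_pUnit (B D : C) : δR (pUnit C) B D ≫ (lP (B ⊠ D)).hom = (lP B).hom ⊠ₘ 𝟙 D
  δL_aT (A B D E : C) :
    δL (A ⊠ B) D E ≫ ((aT A B D).hom ⅋ₘ 𝟙 E)
      = (aT A B (D ⅋ E)).hom ≫ (𝟙 A ⊠ₘ δL B D E) ≫ δL A (B ⊠ D) E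
  δL_aP (A B D E : C) :
    (𝟙 A ⊠ₘ (aP B D E).hom) ≫ δL A B (D ⅋ E)
      = δL A (B ⅋ D) E ≫ (δL A B D ⅋ₘ 𝟙 E) ≫ (aP (A ⊠ B) D E).hom
  δR_aT (A B D E : C) :
    (aT (A ⅋ B) D E).hom ≫ δR A B (D ⊠ E)
      = (δR A B D ⊠ₘ 𝟙 E) ≫ δR A (B ⊠ D) E ≫ (𝟙 A ⅋ₘ (aT B D E).hom)
  δR_aP (A B D E : C) :
    δR (A ⅋ B) D E ≫ (aP A B (D ⊠ E)).hom
      = ((aP A B D).hom ⊠ₘ 𝟙 E) ≫ δR A (B ⅋ D) E ≫ (𝟙 A ⅋ₘ δR B D E)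
  δL_δR_aT (A B D E : C) :
    (δL A B D ⊠ₘ 𝟙 E) ≫ δR (A ⊠ B) D E
      = (aT A (B ⅋ D) E).hom ≫ (𝟙 A ⊠ₘ δR B D E) ≫ δL A B (D ⊠ E)
  δL_δR_aP (A B D E : C) :
    δL (A ⅋ B) D E ≫ (δR A B D ⅋ₘ 𝟙 E) ≫ (aP A (B ⊠ D) E).hom
      = δR A B (D ⅋ E) ≫ (𝟙 A ⅋ₘ δL B D E)

open LinDistCat

/-! ### The opposite of a linearly distributive category: tensor and par are exchanged -/

section OpLemmas

variable {C : Type u} [Category.{v} C] [LinDistCat C]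

theorem op_δL_tUnit (B D : C) : ((lP B).inv ⊠ₘ 𝟙 D) ≫ δR (pUnit C) B D = (lP (B ⊠ D)).inv := by
  have h : (tIso (lP B) (Iso.refl D)).inv ≫ δR (pUnit C) B D = (lP (B ⊠ D)).inv := by
    rw [Iso.inv_comp_eq, Iso.eq_comp_inv]; exact δR_pUnit B D
  exact h

theorem op_δL_pUnit (A B : C) : (rT (A ⅋ B)).inv ≫ δR A B (tUnit C) = 𝟙 A ⅋ₘ (rT B).inv := by
  have h : (rT (A ⅋ B)).inv ≫ δR A B (tUnit C) = (pIso (Iso.refl A) (rT B)).inv := by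
    rw [Iso.inv_comp_eq, Iso.eq_comp_inv]; exact δR_tUnit A B
  exact h

theorem op_δR_tUnit (A B : C) : (𝟙 A ⊠ₘ (rP B).inv) ≫ δL A B (pUnit C) = (rP (A ⊠ B)).inv := by
  have h : (tIso (Iso.refl A) (rP B)).inv ≫ δL A B (pUnit C) = (rP (A ⊠ B)).inv := by
    rw [Iso.inv_comp_eq, Iso.eq_comp_inv]; exact δL_pUnit A B
  exact h

theorem op_δR_pUnit (B D : C) : (lT (B ⅋ D)).inv ≫ δL (tUnit C) B D = (lT B).inv ⅋ₘ 𝟙 D := by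
  have h : (lT (B ⅋ D)).inv ≫ δL (tUnit C) B D = (pIso (lT B) (Iso.refl D)).inv := by
    rw [Iso.inv_comp_eq, Iso.eq_comp_inv]; exact δL_tUnit B D
  exact h

theorem op_δL_aT (A B D E : C) :
    ((aP A B D).inv ⊠ₘ 𝟙 E) ≫ δR (A ⅋ B) D E
      = (δR A (B ⅋ D) E ≫ (𝟙 A ⅋ₘ δR B D E)) ≫ (aP A B (D ⊠ E)).inv := by
  have h : (tIso (aP A B D) (Iso.refl E)).inv ≫ δR (A ⅋ B) D E
      = (δR A (B ⅋ D) E ≫ (𝟙 A ⅋ₘ δR B D E)) ≫ (aP A B (D ⊠ E)).inv := by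
    rw [Iso.inv_comp_eq, ← Category.assoc, Iso.eq_comp_inv]; exact δR_aP A B D E
  exact h

theorem op_δL_aP (A B D E : C) :
    δR A B (D ⊠ E) ≫ (𝟙 A ⅋ₘ (aT B D E).inv)
      = ((aT (A ⅋ B) D E).inv ≫ (δR A B D ⊠ₘ 𝟙 E)) ≫ δR A (B ⊠ D) E := by
  have h : δR A B (D ⊠ E) ≫ (pIso (Iso.refl A) (aT B D E)).inv
      = ((aT (A ⅋ B) D E).inv ≫ (δR A B D ⊠ₘ 𝟙 E)) ≫ δR A (B ⊠ D) E := by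
    rw [Iso.comp_inv_eq, Category.assoc, Category.assoc, Iso.eq_inv_comp]
    exact δR_aT A B D E
  exact h

theorem op_δR_aT (A B D E : C) :
    δL A B (D ⅋ E) ≫ (aP (A ⊠ B) D E).inv
      = ((𝟙 A ⊠ₘ (aP B D E).inv) ≫ δL A (B ⅋ D) E) ≫ (δL A B D ⅋ₘ 𝟙 E) := by
  have h : δL A B (D ⅋ E) ≫ (aP (A ⊠ B) D E).inv
      = ((tIso (Iso.refl A) (aP B D E)).inv ≫ δL A (B ⅋ D) E) ≫ (δL A B D ⅋ₘ 𝟙 E) := by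
    rw [Iso.comp_inv_eq, Category.assoc, Category.assoc, Iso.eq_inv_comp]
    exact δL_aP A B D E
  exact h

theorem op_δR_aP (A B D E : C) :
    (aT A B (D ⅋ E)).inv ≫ δL (A ⊠ B) D E
      = ((𝟙 A ⊠ₘ δL B D E) ≫ δL A (B ⊠ D) E) ≫ ((aT A B D).inv ⅋ₘ 𝟙 E) := by
  have h : (aT A B (D ⅋ E)).inv ≫ δL (A ⊠ B) D E
      = ((𝟙 A ⊠ₘ δL B D E) ≫ δL A (B ⊠ D) E) ≫ (pIso (aT A B D) (Iso.refl E)).inv := by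
    rw [Iso.inv_comp_eq, ← Category.assoc, Iso.eq_comp_inv]; exact δL_aT A B D E
  exact h

theorem op_δL_δR_aux (A B D E : C) :
    δR A B (D ⅋ E) ≫ (𝟙 A ⅋ₘ δL B D E)
      = (δL (A ⅋ B) D E ≫ (δR A B D ⅋ₘ 𝟙 E)) ≫ (aP A (B ⊠ D) E).hom := by
  rw [Category.assoc]; exact (δL_δR_aP A B D E).symm

theorem op_δL_δR_aT (A B D E : C) :
    (δR A B (D ⅋ E) ≫ (𝟙 A ⅋ₘ δL B D E)) ≫ (aP A (B ⊠ D) E).inv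
      = δL (A ⅋ B) D E ≫ (δR A B D ⅋ₘ 𝟙 E) := by
  rw [Iso.comp_inv_eq]; exact op_δL_δR_aux A B D E

theorem op_δL_δR_aP (A B D E : C) :
    ((aT A (B ⅋ D) E).inv ≫ (δL A B D ⊠ₘ 𝟙 E)) ≫ δR (A ⊠ B) D E
      = (𝟙 A ⊠ₘ δR B D E) ≫ δL A B (D ⊠ E) := by
  rw [Category.assoc, Iso.inv_comp_eq]; exact δL_δR_aT A B D E

end OpLemmas

section Op

variable {C : Type u} [Category.{v} C]

instance TwoMonoidal.opposite [TwoMonoidal C] : TwoMonoidal Cᵒᵖ where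
  tens := @monoidalCategoryOp C _ TwoMonoidal.par
  par := @monoidalCategoryOp C _ TwoMonoidal.tens

instance LinDistCat.opposite [LinDistCat C] : LinDistCat Cᵒᵖ where
  δL A B D := (δR A.unop B.unop D.unop).op
  δR A B D := (δL A.unop B.unop D.unop).op
  δL_natural f g h := Quiver.Hom.unop_inj (δR_natural f.unop g.unop h.unop).symm
  δR_natural f g h := Quiver.Hom.unop_inj (δL_natural f.unop g.unop h.unop).symm
  δL_tUnit B D := Quiver.Hom.unop_inj (op_δL_tUnit B.unop D.unop)
  δL_pUnit A B := Quiver.Hom.unop_inj (op_δL_pUnit A.unop B.unop)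
  δR_tUnit A B := Quiver.Hom.unop_inj (op_δR_tUnit A.unop B.unop)
  δR_pUnit B D := Quiver.Hom.unop_inj (op_δR_pUnit B.unop D.unop)
  δL_aT A B D E := Quiver.Hom.unop_inj (op_δL_aT A.unop B.unop D.unop E.unop)
  δL_aP A B D E := Quiver.Hom.unop_inj (op_δL_aP A.unop B.unop D.unop E.unop)
  δR_aT A B D E := Quiver.Hom.unop_inj (op_δR_aT A.unop B.unop D.unop E.unop)
  δR_aP A B D E := Quiver.Hom.unop_inj (op_δR_aP A.unop B.unop D.unop E.unop)
  δL_δR_aT A B D E := Quiver.Hom.unop_inj (op_δL_δR_aT A.unop B.unop D.unop E.unop).symm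
  δL_δR_aP A B D E := Quiver.Hom.unop_inj (op_δL_δR_aP A.unop B.unop D.unop E.unop)

end Op

/-! ## Linear duals and star-autonomous categories -/

section Duals

variable {C : Type u} [Category.{v} C] [LinDistCat C]

/-- `η : ⊤ ⟶ B ⅋ A` and `e : A ⊠ B ⟶ ⊥` exhibit `B` as a left linear dual of `A`
(equivalently `A` as a right linear dual of `B`). -/
structure IsLinearDual {B A : C} (η : tUnit C ⟶ B ⅋ A) (e : A ⊠ B ⟶ pUnit C) : Prop where
  snake_left : (lT B).inv ≫ (η ⊠ₘ 𝟙 B) ≫ δR B A B ≫ (𝟙 B ⅋ₘ e) ≫ (rP B).hom = 𝟙 B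
  snake_right : (rT A).inv ≫ (𝟙 A ⊠ₘ η) ≫ δL A B A ≫ (e ⅋ₘ 𝟙 A) ≫ (lP A).hom = 𝟙 A

variable (C) in
/-- A star-autonomous category: a linearly distributive category in which every object `A` has a
chosen left linear dual `ld A` (written `A^*`) and a chosen right linear dual `rd A`
(written `^*A`). -/
class StarAutonomous where
  /-- the left dual `A^*` -/
  ld : C → C
  /-- the unit of the left dual -/
  ηl (A : C) : tUnit C ⟶ ld A ⅋ A
  /-- the counit of the left dual -/
  εl (A : C) : A ⊠ ld A ⟶ pUnit C
  isLinearDual_left (A : C) : IsLinearDual (ηl A) (εl A)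
  /-- the right dual `^*A` -/
  rd : C → C
  /-- the unit of the right dual -/
  ηr (A : C) : tUnit C ⟶ A ⅋ rd A
  /-- the counit of the right dual -/
  εr (A : C) : rd A ⊠ A ⟶ pUnit C
  isLinearDual_right (A : C) : IsLinearDual (ηr A) (εr A)

open StarAutonomous

/-- Given `η : ⊤ ⟶ B ⅋ A`, bend a pairing `e : A ⊠ Y ⟶ ⊥` into a map `Y ⟶ B`. -/
def bendL {A B Y : C} (η : tUnit C ⟶ B ⅋ A) (e : A ⊠ Y ⟶ pUnit C) : Y ⟶ B :=
  (lT Y).inv ≫ (η ⊠ₘ 𝟙 Y) ≫ δR B A Y ≫ (𝟙 B ⅋ₘ e) ≫ (rP B).hom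

/-- Given `η : ⊤ ⟶ B ⅋ A`, bend a pairing `e : Y ⊠ B ⟶ ⊥` into a map `Y ⟶ A`. -/
def bendR {A B Y : C} (η : tUnit C ⟶ B ⅋ A) (e : Y ⊠ B ⟶ pUnit C) : Y ⟶ A :=
  (rT Y).inv ≫ (𝟙 Y ⊠ₘ η) ≫ δL Y B A ≫ (e ⅋ₘ 𝟙 A) ≫ (lP A).hom

theorem comp_bendL {A B Y Z : C} (h : Z ⟶ Y) (η : tUnit C ⟶ B ⅋ A) (e : A ⊠ Y ⟶ pUnit C) :
    h ≫ bendL η e = bendL η ((𝟙 A ⊠ₘ h) ≫ e) := by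
  unfold bendL
  have h1 : h ≫ (lT Y).inv = (lT Z).inv ≫ (𝟙 (tUnit C) ⊠ₘ h) := by
    rw [Iso.eq_inv_comp, ← Category.assoc, Iso.comp_inv_eq]
    have := TwoMonoidal.tens.leftUnitor_naturality h
    have h2 : 𝟙 (tUnit C) ⊠ₘ h = TwoMonoidal.tens.whiskerLeft (tUnit C) h :=
      TwoMonoidal.tens.id_tensorHom _ h
    rw [h2]; exact this.symm
  have h3 := δR_natural (𝟙 B) (𝟙 A) h
  rw [pHom_id] at h3
  have h4 : (𝟙 (tUnit C) ⊠ₘ h) ≫ (η ⊠ₘ 𝟙 Y) = (η ⊠ₘ 𝟙 Z) ≫ (𝟙 (B ⅋ A) ⊠ₘ h) := by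
    rw [tHom_comp, tHom_comp]; simp only [Category.comp_id, Category.id_comp]
  have h5 : (𝟙 B ⅋ₘ ((𝟙 A ⊠ₘ h) ≫ e)) = (𝟙 B ⅋ₘ (𝟙 A ⊠ₘ h)) ≫ (𝟙 B ⅋ₘ e) := by
    rw [pHom_comp, Category.comp_id]
  rw [reassoc_of% h1, reassoc_of% h4, reassoc_of% h3, h5]
  simp only [Category.assoc]

theorem IsLinearDual.bendL_comp {B A Y : C} {η : tUnit C ⟶ B ⅋ A} {ev : A ⊠ B ⟶ pUnit C}
    (h : IsLinearDual η ev) (e : A ⊠ Y ⟶ pUnit C) : (𝟙 A ⊠ₘ bendL η e) ≫ ev = e := by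
  have expand : 𝟙 A ⊠ₘ bendL η e = (𝟙 A ⊠ₘ (lT Y).inv) ≫ (𝟙 A ⊠ₘ (η ⊠ₘ 𝟙 Y)) ≫
      (𝟙 A ⊠ₘ δR B A Y) ≫ (𝟙 A ⊠ₘ (𝟙 B ⅋ₘ e)) ≫ (𝟙 A ⊠ₘ (rP B).hom) := by
    simp only [tHom_comp, Category.comp_id]
    rfl
  have nat := δL_natural (𝟙 A) (𝟙 B) e
  rw [tHom_id] at nat
  have mid : (𝟙 A ⊠ₘ δR B A Y) ≫ δL A B (A ⊠ Y)
      = (aT A (B ⅋ A) Y).inv ≫ (δL A B A ⊠ₘ 𝟙 Y) ≫ δR (A ⊠ B) A Y := by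
    rw [Iso.eq_inv_comp]; exact (δL_δR_aT A B A Y).symm
  have assoc : (𝟙 A ⊠ₘ (η ⊠ₘ 𝟙 Y)) ≫ (aT A (B ⅋ A) Y).inv
      = (aT A (tUnit C) Y).inv ≫ ((𝟙 A ⊠ₘ η) ⊠ₘ 𝟙 Y) := by
    rw [Iso.eq_inv_comp, ← Category.assoc, Iso.comp_inv_eq]
    exact (TwoMonoidal.tens.associator_naturality (𝟙 A) η (𝟙 Y)).symm
  have tri : (𝟙 A ⊠ₘ (lT Y).inv) ≫ (aT A (tUnit C) Y).inv = (rT A).inv ⊠ₘ 𝟙 Y := by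
    have h1 : (tIso (Iso.refl A) (lT Y)).inv ≫ (aT A (tUnit C) Y).inv
        = (tIso (rT A) (Iso.refl Y)).inv := by
      rw [Iso.inv_comp_eq, Iso.eq_comp_inv, Iso.inv_comp_eq]
      have h2 := TwoMonoidal.tens.triangle A Y
      rw [← TwoMonoidal.tens.id_tensorHom, ← TwoMonoidal.tens.tensorHom_id] at h2
      exact h2.symm
    exact h1
  have natρ : (rP (A ⊠ B)).hom ≫ ev = (ev ⅋ₘ 𝟙 (pUnit C)) ≫ (rP (pUnit C)).hom := by
    have h1 := TwoMonoidal.par.rightUnitor_naturality ev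
    rw [← TwoMonoidal.par.tensorHom_id] at h1
    exact h1.symm
  have natl : (𝟙 (pUnit C) ⅋ₘ e) ≫ (rP (pUnit C)).hom = (lP (A ⊠ Y)).hom ≫ e := by
    have h1 := TwoMonoidal.par.leftUnitor_naturality e
    rw [← TwoMonoidal.par.id_tensorHom] at h1
    have h2 : (rP (pUnit C)).hom = (lP (pUnit C)).hom :=
      (@MonoidalCategory.unitors_equal C _ TwoMonoidal.par).symm
    rw [h2]; exact h1
  have swap : (𝟙 (A ⊠ B) ⅋ₘ e) ≫ (ev ⅋ₘ 𝟙 (pUnit C))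
      = (ev ⅋ₘ (𝟙 A ⊠ₘ 𝟙 Y)) ≫ (𝟙 (pUnit C) ⅋ₘ e) := by
    rw [tHom_id, pHom_comp, pHom_comp]; simp only [Category.comp_id, Category.id_comp]
  have natR := δR_natural ev (𝟙 A) (𝟙 Y)
  rw [expand, ← δL_pUnit]
  simp only [Category.assoc]
  rw [reassoc_of% nat, reassoc_of% mid, reassoc_of% assoc, reassoc_of% tri, natρ,
    reassoc_of% swap, natl, ← reassoc_of% natR, reassoc_of% (δR_pUnit A Y)]
  simp only [← Category.assoc, tHom_comp, Category.comp_id]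
  have sn := h.snake_right
  simp only [← Category.assoc] at sn
  rw [sn, tHom_id, Category.id_comp]

variable [StarAutonomous C]

/-- The dual `f^* : B^* ⟶ A^*` of a map. -/
def ldMap {A B : C} (f : A ⟶ B) : ld B ⟶ ld A := bendL (ηl A) ((f ⊠ₘ 𝟙 (ld B)) ≫ εl B)

/-- The dual `^*f : ^*B ⟶ ^*A` of a map. -/
def rdMap {A B : C} (f : A ⟶ B) : rd B ⟶ rd A := bendR (ηr A) ((𝟙 (rd B) ⊠ₘ f) ≫ εr B)

theorem ldMap_id (A : C) : ldMap (𝟙 A) = 𝟙 (ld A) := by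
  unfold ldMap bendL
  rw [tHom_id, Category.id_comp]
  exact (isLinearDual_left A).snake_left

theorem ldMap_comp {A B D : C} (f : A ⟶ B) (g : B ⟶ D) : ldMap (f ≫ g) = ldMap g ≫ ldMap f := by
  conv_rhs => rw [ldMap.eq_def f, comp_bendL]
  rw [ldMap.eq_def (f ≫ g)]
  congr 1
  have h1 : (𝟙 A ⊠ₘ ldMap g) ≫ (f ⊠ₘ 𝟙 (ld B)) = (f ⊠ₘ 𝟙 (ld D)) ≫ (𝟙 B ⊠ₘ ldMap g) := by
    rw [tHom_comp, tHom_comp]; simp only [Category.comp_id, Category.id_comp]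
  have h2 : (𝟙 B ⊠ₘ ldMap g) ≫ εl B = (g ⊠ₘ 𝟙 (ld D)) ≫ εl D :=
    (isLinearDual_left B).bendL_comp _
  rw [reassoc_of% h1, h2, ← Category.assoc, tHom_comp, Category.comp_id]

variable (C) in
/-- The contravariant functor `A ↦ A^*`. -/
def ldFunctor : Cᵒᵖ ⥤ C where
  obj A := ld A.unop
  map f := ldMap f.unop
  map_id A := ldMap_id A.unop
  map_comp f g := ldMap_comp g.unop f.unop

end Duals

/-! ### Canonical comparison maps of duals -/

section Canonical

variable {C : Type u} [Category.{v} C] [LinDistCat C] [StarAutonomous C]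

open StarAutonomous

/-- `A^* ⊠ B^* ⟶ (B ⅋ A)^*` -/
def ldTens (A B : C) : ld A ⊠ ld B ⟶ ld (B ⅋ A) :=
  bendL (ηl (B ⅋ A)) ((aT (B ⅋ A) (ld A) (ld B)).inv ≫ (δR B A (ld A) ⊠ₘ 𝟙 (ld B)) ≫
    ((𝟙 B ⅋ₘ εl A) ⊠ₘ 𝟙 (ld B)) ≫ ((rP B).hom ⊠ₘ 𝟙 (ld B)) ≫ εl B)

/-- `(A ⊠ B)^* ⟶ B^* ⅋ A^*` -/
def ldPar (A B : C) : ld (A ⊠ B) ⟶ ld B ⅋ ld A :=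
  bendL (ηl B ≫ (𝟙 (ld B) ⅋ₘ (lT B).inv) ≫ (𝟙 (ld B) ⅋ₘ (ηl A ⊠ₘ 𝟙 B)) ≫
    (𝟙 (ld B) ⅋ₘ δR (ld A) A B) ≫ (aP (ld B) (ld A) (A ⊠ B)).inv) (εl (A ⊠ B))

variable (C) in
/-- `⊤ ⟶ ⊥^*` -/
def ldTop : tUnit C ⟶ ld (pUnit C) := bendL (ηl (pUnit C)) (rT (pUnit C)).hom

variable (C) in
/-- `⊤^* ⟶ ⊥` -/
def ldBot : ld (tUnit C) ⟶ pUnit C := bendL (lP (tUnit C)).inv (εl (tUnit C))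

/-- `^*A ⊠ ^*B ⟶ ^*(B ⅋ A)` -/
def rdTens (A B : C) : rd A ⊠ rd B ⟶ rd (B ⅋ A) :=
  bendR (ηr (B ⅋ A)) ((aT (rd A) (rd B) (B ⅋ A)).hom ≫ (𝟙 (rd A) ⊠ₘ δL (rd B) B A) ≫
    (𝟙 (rd A) ⊠ₘ (εr B ⅋ₘ 𝟙 A)) ≫ (𝟙 (rd A) ⊠ₘ (lP A).hom) ≫ εr A)

/-- `^*(A ⊠ B) ⟶ ^*B ⅋ ^*A` -/
def rdPar (A B : C) : rd (A ⊠ B) ⟶ rd B ⅋ rd A :=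
  bendR (ηr A ≫ ((rT A).inv ⅋ₘ 𝟙 (rd A)) ≫ ((𝟙 A ⊠ₘ ηr B) ⅋ₘ 𝟙 (rd A)) ≫
    (δL A B (rd B) ⅋ₘ 𝟙 (rd A)) ≫ (aP (A ⊠ B) (rd B) (rd A)).hom) (εr (A ⊠ B))

variable (C) in
/-- `⊤ ⟶ ^*⊥` -/
def rdTop : tUnit C ⟶ rd (pUnit C) := bendR (ηr (pUnit C)) (lT (pUnit C)).hom

variable (C) in
/-- `^*⊤ ⟶ ⊥` -/
def rdBot : rd (tUnit C) ⟶ pUnit C := bendR (rP (tUnit C)).inv (εr (tUnit C))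

/-- `A ⟶ (^*A)^*` -/
def toLdRd (A : C) : A ⟶ ld (rd A) := bendL (ηl (rd A)) (εr A)

/-- `A ⟶ ^*(A^*)` -/
def toRdLd (A : C) : A ⟶ rd (ld A) := bendR (ηr (ld A)) (εl A)

/-- `^*(A^*) ⟶ A` -/
def fromRdLd (A : C) : rd (ld A) ⟶ A := bendR (ηl A) (εr (ld A))

end Canonical

open StarAutonomous

/-- A cyclor on a star-autonomous category: a natural isomorphism `A^* ≅ ^*A`, compatible with
the units, with the tensor and par, and with double dualization. -/
structure Cyclor (C : Type u) [Category.{v} C] [LinDistCat C] [StarAutonomous C] where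
  /-- the isomorphism `A^* ≅ ^*A` -/
  ψ (A : C) : ld A ≅ rd A
  natural {A B : C} (f : A ⟶ B) : ldMap f ≫ (ψ A).hom = (ψ B).hom ≫ rdMap f
  pUnit_comp : ldTop C ≫ (ψ (pUnit C)).hom = rdTop C
  double_dual (A : C) : toLdRd A ≫ ldMap (ψ A).hom ≫ (ψ (ld A)).hom = toRdLd A
  tUnit_comp : (ψ (tUnit C)).hom ≫ rdBot C = ldBot C
  tens_comp (A B : C) :
    (ψ (A ⊠ B)).hom ≫ rdPar A B = ldPar A B ≫ ((ψ B).hom ⅋ₘ (ψ A).hom)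
  par_comp (A B : C) :
    ldTens B A ≫ (ψ (A ⅋ B)).hom = ((ψ B).hom ⊠ₘ (ψ A).hom) ≫ rdTens B A

/-! ## Conjugation -/

section MonoidalConjugation

open MonoidalCategory

variable {C : Type u} [Category.{v} C] [MonoidalCategory C]

/-- A conjugation on a monoidal category: a tensor-reversing functor `K` with conjugating laxor
`χ` and conjugator `ε`. -/
structure IsConjugation (K : C ⥤ C) (χ : ∀ A B : C, K.obj A ⊗ K.obj B ≅ K.obj (B ⊗ A))
    (ε : K ⋙ K ≅ 𝟭 C) : Prop where
  χ_natural {A A' B B' : C} (f : A ⟶ A') (g : B ⟶ B') :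
    (K.map f ⊗ₘ K.map g) ≫ (χ A' B').hom = (χ A B).hom ≫ K.map (g ⊗ₘ f)
  map_ε (A : C) : K.map (ε.hom.app A) = ε.hom.app (K.obj A)
  χ_assoc (A B D : C) :
    (α_ (K.obj A) (K.obj B) (K.obj D)).hom ≫ (𝟙 (K.obj A) ⊗ₘ (χ B D).hom) ≫ (χ A (D ⊗ B)).hom
      = ((χ A B).hom ⊗ₘ 𝟙 (K.obj D)) ≫ (χ (B ⊗ A) D).hom ≫ K.map (α_ D B A).inv
  χ_ε (A B : C) :
    (χ (K.obj A) (K.obj B)).hom ≫ K.map (χ B A).hom ≫ ε.hom.app (A ⊗ B)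
      = ε.hom.app A ⊗ₘ ε.hom.app B

/-- The canonical isomorphism from the unit to its conjugate: it is the unique isomorphism which
is compatible with the laxor and the unitors. -/
def conjUnit (K : C ⥤ C) (χ : ∀ A B : C, K.obj A ⊗ K.obj B ≅ K.obj (B ⊗ A))
    (ε : K ⋙ K ≅ 𝟭 C) : 𝟙_ C ≅ K.obj (𝟙_ C) :=
  (ε.app (𝟙_ C)).symm ≪≫ K.mapIso (ρ_ (K.obj (𝟙_ C))).symm ≪≫
    (χ (𝟙_ C) (K.obj (𝟙_ C))).symm ≪≫ whiskerLeftIso (K.obj (𝟙_ C)) (ε.app (𝟙_ C)) ≪≫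
    ρ_ (K.obj (𝟙_ C))

end MonoidalConjugation

/-- A conjugation on a linearly distributive category. -/
structure Conjugation (C : Type u) [Category.{v} C] [LinDistCat C] where
  /-- the conjugation functor -/
  K : C ⥤ C
  /-- the conjugating laxor of the tensor -/
  χT (A B : C) : K.obj A ⊠ K.obj B ≅ K.obj (B ⊠ A)
  /-- the conjugating laxor of the par -/
  χP (A B : C) : K.obj (A ⅋ B) ≅ K.obj B ⅋ K.obj A
  /-- the conjugator -/
  ε : K ⋙ K ≅ 𝟭 C
  isConjugation_tens : @IsConjugation C _ TwoMonoidal.tens K χT ε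
  isConjugation_par : @IsConjugation C _ TwoMonoidal.par K (fun A B => (χP B A).symm) ε
  χ_δL (A B D : C) :
    ((χP B D).hom ⊠ₘ 𝟙 (K.obj A)) ≫ δR (K.obj D) (K.obj B) (K.obj A) ≫
        (𝟙 (K.obj D) ⅋ₘ (χT B A).hom)
      = (χT (B ⅋ D) A).hom ≫ K.map (δL A B D) ≫ (χP (A ⊠ B) D).hom
  χ_δR (A B D : C) :
    (𝟙 (K.obj A) ⊠ₘ (χP D B).hom) ≫ δL (K.obj A) (K.obj B) (K.obj D) ≫
        ((χT A B).hom ⅋ₘ 𝟙 (K.obj D))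
      = (χT A (D ⅋ B)).hom ≫ K.map (δR D B A) ≫ (χP D (B ⊠ A)).hom

namespace Conjugation

variable {C : Type u} [Category.{v} C] [LinDistCat C] (J : Conjugation C)

/-- The canonical isomorphism from the tensor unit to its conjugate. -/
def unitT : tUnit C ≅ J.K.obj (tUnit C) := @conjUnit C _ TwoMonoidal.tens J.K J.χT J.ε

/-- The canonical isomorphism from the par unit to its conjugate. -/
def unitP : pUnit C ≅ J.K.obj (pUnit C) :=
  @conjUnit C _ TwoMonoidal.par J.K (fun A B => (J.χP B A).symm) J.ε

/-- The conjugate of the unit of a linear dual. -/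
def conjη {B A : C} (η : tUnit C ⟶ B ⅋ A) : tUnit C ⟶ J.K.obj A ⅋ J.K.obj B :=
  J.unitT.hom ≫ J.K.map η ≫ (J.χP B A).hom

variable [StarAutonomous C] (c : Cyclor C)

/-- The map from the dual of the conjugate to the conjugate of the dual: the cyclor followed by
the canonical map from the right dual of `K A` to `K (A^*)`. -/
def σ (A : C) : ld (J.K.obj A) ⟶ J.K.obj (ld A) :=
  (c.ψ (J.K.obj A)).hom ≫ bendR (J.conjη (ηl A)) (εr (J.K.obj A))

/-- Compatibility of a conjugation with a cyclor: `σ` is also the composite of the canonical map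
from `(K A)^*` to `K (^*A)` and the conjugate of the inverse cyclor. -/
def IsCyclic : Prop :=
  ∀ A : C, J.σ c A = bendL (J.conjη (ηr A)) (εl (J.K.obj A)) ≫ J.K.map (c.ψ A).inv

end Conjugation

/-! ## Linear functors, linear transformations and linear adjunctions -/

/-- The data of a linear functor: a tensor component `Ft` with lax structure, a par component
`Fp` with colax structure, and four linear strengths. -/
structure LinearData (C : Type u) [Category.{v} C] [LinDistCat C]
    (D : Type u') [Category.{v'} D] [LinDistCat D] where
  /-- the tensor component -/
  Ft : C ⥤ D
  /-- the par component -/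
  Fp : C ⥤ D
  /-- the laxor of the tensor component -/
  mT (A B : C) : Ft.obj A ⊠ Ft.obj B ⟶ Ft.obj (A ⊠ B)
  /-- the unit laxor of the tensor component -/
  mU : tUnit D ⟶ Ft.obj (tUnit C)
  /-- the colaxor of the par component -/
  nP (A B : C) : Fp.obj (A ⅋ B) ⟶ Fp.obj A ⅋ Fp.obj B
  /-- the unit colaxor of the par component -/
  nU : Fp.obj (pUnit C) ⟶ pUnit D
  /-- the right strength of the tensor component -/
  νtR (A B : C) : Ft.obj (A ⅋ B) ⟶ Fp.obj A ⅋ Ft.obj B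
  /-- the left strength of the tensor component -/
  νtL (A B : C) : Ft.obj (A ⅋ B) ⟶ Ft.obj A ⅋ Fp.obj B
  /-- the right strength of the par component -/
  νpR (A B : C) : Ft.obj A ⊠ Fp.obj B ⟶ Fp.obj (A ⊠ B)
  /-- the left strength of the par component -/
  νpL (A B : C) : Fp.obj A ⊠ Ft.obj B ⟶ Fp.obj (A ⊠ B)

/-- The axioms of a linear functor. -/
structure LinearData.IsLinear {C : Type u} [Category.{v} C] [LinDistCat C]
    {D : Type u'} [Category.{v'} D] [LinDistCat D] (F : LinearData C D) : Prop where
  -- naturality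
  mT_natural {A A' B B' : C} (f : A ⟶ A') (g : B ⟶ B') :
    (F.Ft.map f ⊠ₘ F.Ft.map g) ≫ F.mT A' B' = F.mT A B ≫ F.Ft.map (f ⊠ₘ g)
  nP_natural {A A' B B' : C} (f : A ⟶ A') (g : B ⟶ B') :
    F.Fp.map (f ⅋ₘ g) ≫ F.nP A' B' = F.nP A B ≫ (F.Fp.map f ⅋ₘ F.Fp.map g)
  νtR_natural {A A' B B' : C} (f : A ⟶ A') (g : B ⟶ B') :
    F.Ft.map (f ⅋ₘ g) ≫ F.νtR A' B' = F.νtR A B ≫ (F.Fp.map f ⅋ₘ F.Ft.map g)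
  νtL_natural {A A' B B' : C} (f : A ⟶ A') (g : B ⟶ B') :
    F.Ft.map (f ⅋ₘ g) ≫ F.νtL A' B' = F.νtL A B ≫ (F.Ft.map f ⅋ₘ F.Fp.map g)
  νpR_natural {A A' B B' : C} (f : A ⟶ A') (g : B ⟶ B') :
    (F.Ft.map f ⊠ₘ F.Fp.map g) ≫ F.νpR A' B' = F.νpR A B ≫ F.Fp.map (f ⊠ₘ g)
  νpL_natural {A A' B B' : C} (f : A ⟶ A') (g : B ⟶ B') :
    (F.Fp.map f ⊠ₘ F.Ft.map g) ≫ F.νpL A' B' = F.νpL A B ≫ F.Fp.map (f ⊠ₘ g)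
  -- the tensor component is monoidal
  mT_assoc (A B E : C) :
    (F.mT A B ⊠ₘ 𝟙 (F.Ft.obj E)) ≫ F.mT (A ⊠ B) E ≫ F.Ft.map (aT A B E).hom
      = (aT (F.Ft.obj A) (F.Ft.obj B) (F.Ft.obj E)).hom ≫ (𝟙 (F.Ft.obj A) ⊠ₘ F.mT B E) ≫
        F.mT A (B ⊠ E)
  mT_left_unit (A : C) :
    (F.mU ⊠ₘ 𝟙 (F.Ft.obj A)) ≫ F.mT (tUnit C) A ≫ F.Ft.map (lT A).hom = (lT (F.Ft.obj A)).hom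
  mT_right_unit (A : C) :
    (𝟙 (F.Ft.obj A) ⊠ₘ F.mU) ≫ F.mT A (tUnit C) ≫ F.Ft.map (rT A).hom = (rT (F.Ft.obj A)).hom
  -- the par component is comonoidal
  nP_assoc (A B E : C) :
    F.nP (A ⅋ B) E ≫ (F.nP A B ⅋ₘ 𝟙 (F.Fp.obj E)) ≫
        (aP (F.Fp.obj A) (F.Fp.obj B) (F.Fp.obj E)).hom
      = F.Fp.map (aP A B E).hom ≫ F.nP A (B ⅋ E) ≫ (𝟙 (F.Fp.obj A) ⅋ₘ F.nP B E)
  nP_left_unit (A : C) :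
    F.nP (pUnit C) A ≫ (F.nU ⅋ₘ 𝟙 (F.Fp.obj A)) ≫ (lP (F.Fp.obj A)).hom = F.Fp.map (lP A).hom
  nP_right_unit (A : C) :
    F.nP A (pUnit C) ≫ (𝟙 (F.Fp.obj A) ⅋ₘ F.nU) ≫ (rP (F.Fp.obj A)).hom = F.Fp.map (rP A).hom
  -- strengths and unitors
  νtR_unit (A : C) :
    F.νtR (pUnit C) A ≫ (F.nU ⅋ₘ 𝟙 (F.Ft.obj A)) ≫ (lP (F.Ft.obj A)).hom = F.Ft.map (lP A).hom
  νtL_unit (A : C) :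
    F.νtL A (pUnit C) ≫ (𝟙 (F.Ft.obj A) ⅋ₘ F.nU) ≫ (rP (F.Ft.obj A)).hom = F.Ft.map (rP A).hom
  νpR_unit (A : C) :
    (lT (F.Fp.obj A)).inv ≫ (F.mU ⊠ₘ 𝟙 (F.Fp.obj A)) ≫ F.νpR (tUnit C) A = F.Fp.map (lT A).inv
  νpL_unit (A : C) :
    (rT (F.Fp.obj A)).inv ≫ (𝟙 (F.Fp.obj A) ⊠ₘ F.mU) ≫ F.νpL A (tUnit C) = F.Fp.map (rT A).inv
  -- strengths and associators
  νtR_assoc (A B E : C) :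
    F.Ft.map (aP A B E).hom ≫ F.νtR A (B ⅋ E) ≫ (𝟙 (F.Fp.obj A) ⅋ₘ F.νtR B E)
      = F.νtR (A ⅋ B) E ≫ (F.nP A B ⅋ₘ 𝟙 (F.Ft.obj E)) ≫
        (aP (F.Fp.obj A) (F.Fp.obj B) (F.Ft.obj E)).hom
  νtL_assoc (A B E : C) :
    F.Ft.map (aP A B E).hom ≫ F.νtL A (B ⅋ E) ≫ (𝟙 (F.Ft.obj A) ⅋ₘ F.nP B E)
      = F.νtL (A ⅋ B) E ≫ (F.νtL A B ⅋ₘ 𝟙 (F.Fp.obj E)) ≫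
        (aP (F.Ft.obj A) (F.Fp.obj B) (F.Fp.obj E)).hom
  νpR_assoc (A B E : C) :
    (F.mT A B ⊠ₘ 𝟙 (F.Fp.obj E)) ≫ F.νpR (A ⊠ B) E ≫ F.Fp.map (aT A B E).hom
      = (aT (F.Ft.obj A) (F.Ft.obj B) (F.Fp.obj E)).hom ≫ (𝟙 (F.Ft.obj A) ⊠ₘ F.νpR B E) ≫
        F.νpR A (B ⊠ E)
  νpL_assoc (A B E : C) :
    (F.νpL A B ⊠ₘ 𝟙 (F.Ft.obj E)) ≫ F.νpL (A ⊠ B) E ≫ F.Fp.map (aT A B E).hom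
      = (aT (F.Fp.obj A) (F.Ft.obj B) (F.Ft.obj E)).hom ≫ (𝟙 (F.Fp.obj A) ⊠ₘ F.mT B E) ≫
        F.νpL A (B ⊠ E)
  νtR_νtL (A B E : C) :
    F.Ft.map (aP A B E).hom ≫ F.νtR A (B ⅋ E) ≫ (𝟙 (F.Fp.obj A) ⅋ₘ F.νtL B E)
      = F.νtL (A ⅋ B) E ≫ (F.νtR A B ⅋ₘ 𝟙 (F.Fp.obj E)) ≫
        (aP (F.Fp.obj A) (F.Ft.obj B) (F.Fp.obj E)).hom
  νpR_νpL (A B E : C) :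
    (F.νpR A B ⊠ₘ 𝟙 (F.Ft.obj E)) ≫ F.νpL (A ⊠ B) E ≫ F.Fp.map (aT A B E).hom
      = (aT (F.Ft.obj A) (F.Fp.obj B) (F.Ft.obj E)).hom ≫ (𝟙 (F.Ft.obj A) ⊠ₘ F.νpL B E) ≫
        F.νpR A (B ⊠ E)
  -- strengths and linear distributors
  δL_νtR (A B E : C) :
    (𝟙 (F.Ft.obj A) ⊠ₘ F.νtR B E) ≫ δL (F.Ft.obj A) (F.Fp.obj B) (F.Ft.obj E) ≫
        (F.νpR A B ⅋ₘ 𝟙 (F.Ft.obj E))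
      = F.mT A (B ⅋ E) ≫ F.Ft.map (δL A B E) ≫ F.νtR (A ⊠ B) E
  δR_νtL (A B E : C) :
    (F.νtL B E ⊠ₘ 𝟙 (F.Ft.obj A)) ≫ δR (F.Ft.obj B) (F.Fp.obj E) (F.Ft.obj A) ≫
        (𝟙 (F.Ft.obj B) ⅋ₘ F.νpL E A)
      = F.mT (B ⅋ E) A ≫ F.Ft.map (δR B E A) ≫ F.νtL B (E ⊠ A)
  δL_νpL (A B E : C) :
    (𝟙 (F.Fp.obj A) ⊠ₘ F.νtL B E) ≫ δL (F.Fp.obj A) (F.Ft.obj B) (F.Fp.obj E) ≫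
        (F.νpL A B ⅋ₘ 𝟙 (F.Fp.obj E))
      = F.νpL A (B ⅋ E) ≫ F.Fp.map (δL A B E) ≫ F.nP (A ⊠ B) E
  δR_νpR (A B E : C) :
    (F.νtR B E ⊠ₘ 𝟙 (F.Fp.obj A)) ≫ δR (F.Fp.obj B) (F.Ft.obj E) (F.Fp.obj A) ≫
        (𝟙 (F.Fp.obj B) ⅋ₘ F.νpR E A)
      = F.νpR (B ⅋ E) A ≫ F.Fp.map (δR B E A) ≫ F.nP B (E ⊠ A)
  δL_νtL (A B E : C) :
    (𝟙 (F.Ft.obj A) ⊠ₘ F.νtL B E) ≫ δL (F.Ft.obj A) (F.Ft.obj B) (F.Fp.obj E) ≫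
        (F.mT A B ⅋ₘ 𝟙 (F.Fp.obj E))
      = F.mT A (B ⅋ E) ≫ F.Ft.map (δL A B E) ≫ F.νtL (A ⊠ B) E
  δR_νtR (A B E : C) :
    (F.νtR B E ⊠ₘ 𝟙 (F.Ft.obj A)) ≫ δR (F.Fp.obj B) (F.Ft.obj E) (F.Ft.obj A) ≫
        (𝟙 (F.Fp.obj B) ⅋ₘ F.mT E A)
      = F.mT (B ⅋ E) A ≫ F.Ft.map (δR B E A) ≫ F.νtR B (E ⊠ A)
  δL_νpR (A B E : C) :
    (𝟙 (F.Ft.obj A) ⊠ₘ F.nP B E) ≫ δL (F.Ft.obj A) (F.Fp.obj B) (F.Fp.obj E) ≫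
        (F.νpR A B ⅋ₘ 𝟙 (F.Fp.obj E))
      = F.νpR A (B ⅋ E) ≫ F.Fp.map (δL A B E) ≫ F.nP (A ⊠ B) E
  δR_νpL (A B E : C) :
    (F.nP B E ⊠ₘ 𝟙 (F.Ft.obj A)) ≫ δR (F.Fp.obj B) (F.Fp.obj E) (F.Ft.obj A) ≫
        (𝟙 (F.Fp.obj B) ⅋ₘ F.νpL E A)
      = F.νpL (B ⅋ E) A ≫ F.Fp.map (δR B E A) ≫ F.nP B (E ⊠ A)

/-- The data of a Frobenius linear functor: the two components are the same functor `F`, the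
strengths of the par component are the laxor, those of the tensor component the colaxor. -/
structure FrobeniusData (C : Type u) [Category.{v} C] [LinDistCat C]
    (D : Type u') [Category.{v'} D] [LinDistCat D] where
  /-- the underlying functor -/
  F : C ⥤ D
  /-- the laxor for the tensor -/
  mT (A B : C) : F.obj A ⊠ F.obj B ⟶ F.obj (A ⊠ B)
  /-- the unit laxor -/
  mU : tUnit D ⟶ F.obj (tUnit C)
  /-- the colaxor for the par -/
  nP (A B : C) : F.obj (A ⅋ B) ⟶ F.obj A ⅋ F.obj B
  /-- the unit colaxor -/
  nU : F.obj (pUnit C) ⟶ pUnit D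

section Functors

variable {C : Type u} [Category.{v} C] [LinDistCat C] {D : Type u'} [Category.{v'} D] [LinDistCat D]

/-- A Frobenius linear functor, seen as a linear functor. -/
@[simps] def FrobeniusData.toLinear (F : FrobeniusData C D) : LinearData C D where
  Ft := F.F
  Fp := F.F
  mT := F.mT
  mU := F.mU
  nP := F.nP
  nU := F.nU
  νtR := F.nP
  νtL := F.nP
  νpR := F.mT
  νpL := F.mT

namespace LinearData

variable (C) in
/-- The identity linear functor. -/
@[simps] def id : LinearData C C where
  Ft := 𝟭 C
  Fp := 𝟭 C
  mT A B := 𝟙 (A ⊠ B)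
  mU := 𝟙 (tUnit C)
  nP A B := 𝟙 (A ⅋ B)
  nU := 𝟙 (pUnit C)
  νtR A B := 𝟙 (A ⅋ B)
  νtL A B := 𝟙 (A ⅋ B)
  νpR A B := 𝟙 (A ⊠ B)
  νpL A B := 𝟙 (A ⊠ B)

/-- The composite of linear functors. -/
@[simps] def comp {E : Type*} [Category* E] [LinDistCat E] (F : LinearData C D)
    (G : LinearData D E) : LinearData C E where
  Ft := F.Ft ⋙ G.Ft
  Fp := F.Fp ⋙ G.Fp
  mT A B := G.mT (F.Ft.obj A) (F.Ft.obj B) ≫ G.Ft.map (F.mT A B)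
  mU := G.mU ≫ G.Ft.map F.mU
  nP A B := G.Fp.map (F.nP A B) ≫ G.nP (F.Fp.obj A) (F.Fp.obj B)
  nU := G.Fp.map F.nU ≫ G.nU
  νtR A B := G.Ft.map (F.νtR A B) ≫ G.νtR (F.Fp.obj A) (F.Ft.obj B)
  νtL A B := G.Ft.map (F.νtL A B) ≫ G.νtL (F.Ft.obj A) (F.Fp.obj B)
  νpR A B := G.νpR (F.Ft.obj A) (F.Fp.obj B) ≫ G.Fp.map (F.νpR A B)
  νpL A B := G.νpL (F.Fp.obj A) (F.Ft.obj B) ≫ G.Fp.map (F.νpL A B)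

/-- The opposite `C ⥤ Dᵒᵖ` of a contravariant linear functor `Cᵒᵖ ⥤ D`: the two components, the
laxors and colaxors, and the two kinds of strengths are exchanged. -/
@[simps] def rightOp (F : LinearData Cᵒᵖ D) : LinearData C Dᵒᵖ where
  Ft := F.Fp.rightOp
  Fp := F.Ft.rightOp
  mT A B := (F.nP (op A) (op B)).op
  mU := F.nU.op
  nP A B := (F.mT (op A) (op B)).op
  nU := F.mU.op
  νtR A B := (F.νpR (op A) (op B)).op
  νtL A B := (F.νpL (op A) (op B)).op
  νpR A B := (F.νtR (op A) (op B)).op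
  νpL A B := (F.νtL (op A) (op B)).op

/-- A linear transformation `F ⟶ G`: a monoidal transformation of the tensor components and a
comonoidal transformation, in the other direction, of the par components. -/
structure IsLinearTrans (F G : LinearData C D) (αt : F.Ft ⟶ G.Ft) (αp : G.Fp ⟶ F.Fp) :
    Prop where
  tens (A B : C) : F.mT A B ≫ αt.app (A ⊠ B) = (αt.app A ⊠ₘ αt.app B) ≫ G.mT A B
  tens_unit : F.mU ≫ αt.app (tUnit C) = G.mU
  par (A B : C) : αp.app (A ⅋ B) ≫ F.nP A B = G.nP A B ≫ (αp.app A ⅋ₘ αp.app B)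
  par_unit : αp.app (pUnit C) ≫ F.nU = G.nU
  νtR (A B : C) :
    αt.app (A ⅋ B) ≫ G.νtR A B ≫ (αp.app A ⅋ₘ 𝟙 (G.Ft.obj B))
      = F.νtR A B ≫ (𝟙 (F.Fp.obj A) ⅋ₘ αt.app B)
  νtL (A B : C) :
    αt.app (A ⅋ B) ≫ G.νtL A B ≫ (𝟙 (G.Ft.obj A) ⅋ₘ αp.app B)
      = F.νtL A B ≫ (αt.app A ⅋ₘ 𝟙 (F.Fp.obj B))
  νpL (A B : C) :
    (𝟙 (G.Fp.obj A) ⊠ₘ αt.app B) ≫ G.νpL A B ≫ αp.app (A ⊠ B)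
      = (αp.app A ⊠ₘ 𝟙 (F.Ft.obj B)) ≫ F.νpL A B
  νpR (A B : C) :
    (αt.app A ⊠ₘ 𝟙 (G.Fp.obj B)) ≫ G.νpR A B ≫ αp.app (A ⊠ B)
      = (𝟙 (F.Ft.obj A) ⊠ₘ αp.app B) ≫ F.νpR A B

end LinearData

/-- An adjunction `F ⊣ G` of linear functors: its unit and counit are linear transformations. The
triangle identities are those of the two adjunctions of the components. -/
structure LinearAdjunction (F : LinearData C D) (G : LinearData D C) where
  left_linear : F.IsLinear
  right_linear : G.IsLinear
  /-- the adjunction of the tensor components -/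
  adjT : F.Ft ⊣ G.Ft
  /-- the adjunction of the par components -/
  adjP : G.Fp ⊣ F.Fp
  unit_linear : (LinearData.id C).IsLinearTrans (F.comp G) adjT.unit adjP.counit
  counit_linear : (G.comp F).IsLinearTrans (LinearData.id D) adjT.counit adjP.unit

/-- A linear adjunction is a linear equivalence if its unit and counit are isomorphisms. -/
structure LinearAdjunction.IsEquivalence {F : LinearData C D} {G : LinearData D C}
    (a : LinearAdjunction F G) : Prop where
  unit_tens : IsIso a.adjT.unit
  unit_par : IsIso a.adjP.counit
  counit_tens : IsIso a.adjT.counit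
  counit_par : IsIso a.adjP.unit

/-- A dagger: a contravariant Frobenius linear functor `F` which is a linear involutive
equivalence, that is, it comes with a linear equivalence `F ⊣ Fᵒᵖ` whose unit and counit are the
same map. -/
structure Dagger (F : FrobeniusData Cᵒᵖ C) where
  /-- the linear adjunction between `F` and its opposite -/
  adj : LinearAdjunction F.toLinear F.toLinear.rightOp
  isEquivalence : adj.IsEquivalence
  unit_eq_counit_tens (A : C) :
    (adj.adjT.unit.app (op A)).unop = adj.adjT.counit.app A
  unit_eq_counit_par (A : C) :
    (adj.adjP.counit.app (op A)).unop = adj.adjP.unit.app A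

/-- The involutor `ι : A ⟶ (A^†)^†`: the par component of the (co)unit. -/
def Dagger.ι {F : FrobeniusData Cᵒᵖ C} (d : Dagger F) (A : C) :
    A ⟶ F.F.obj (op (F.F.obj (op A))) :=
  d.adj.adjP.unit.app A

/-- The tensor component `(A^†)^† ⟶ A` of the unit. -/
def Dagger.unitMap {F : FrobeniusData Cᵒᵖ C} (d : Dagger F) (A : C) :
    F.F.obj (op (F.F.obj (op A))) ⟶ A :=
  (d.adj.adjT.unit.app (op A)).unop

/-- The tensor component `(A^†)^† ⟶ A` of the counit. -/
def Dagger.counitMap {F : FrobeniusData Cᵒᵖ C} (d : Dagger F) (A : C) :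
    F.F.obj (op (F.F.obj (op A))) ⟶ A :=
  d.adj.adjT.counit.app A

end Functors

/-- The composite of the (contravariant, tensor-reversing) Frobenius linear functor `A ↦ A^*` and
the (tensor-reversing) Frobenius linear functor `K`, with its composite laxors and colaxors:
`A ↦ K (A^*)`. In `Cᵒᵖ` the tensor is the par of `C`, and the par is the tensor of `C`. -/
def Conjugation.daggerData {C : Type u} [Category.{v} C] [LinDistCat C] [StarAutonomous C]
    (J : Conjugation C) : FrobeniusData Cᵒᵖ C where
  F := ldFunctor C ⋙ J.K
  mT A B := (J.χT (ld A.unop) (ld B.unop)).hom ≫ J.K.map (ldTens B.unop A.unop)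
  mU := J.unitT.hom ≫ J.K.map (ldTop C)
  nP A B := J.K.map (ldPar A.unop B.unop) ≫ (J.χP (ld B.unop) (ld A.unop)).hom
  nU := J.K.map (ldBot C) ≫ J.unitP.inv

/-! A linear dual turns maps into pairings. A map into `A^*` is determined by its pairing with `A`
(`IsLinearDual.hom_ext_left`), and a map into `B^* ⅋ A^*` by its pairing with `A ⊠ B`
(`IsSeparating.pairQ`). Equations between comparison maps of duals thus become equations between the
induced pairings: `pairP` for a par against a tensor, `pairQ` for a tensor against a par. The
associativity, unit and distributor laws of these pairings (`pairP_assoc`, `pairP_rT_left`,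
`pairQ_pairP` and their mirror images) make `A ↦ A^*` a contravariant Frobenius functor which
reverses both products.

A conjugation reverses both products as well. It sends a dual pair to a dual pair with the roles
exchanged (`IsLinearDual.conj`), it exchanges `pairP` and `pairQ` (`pairP_conjε`, `pairQ_conjε`),
and applied twice it returns the original pairing up to `ε` (`conjε_conjε`). In the composite `A ↦ K
(A^*)` the two reversals cancel, and it is Frobenius (`isFrobenius_daggerData`).

For the involutor, `(K (A^*))^*` and `K A` are both left duals of `K (A^*)`, hence canonically
isomorphic (`ldConj`). Applying `K` and then `ε` gives `κ`, from the double dagger of `A` to `A`.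
Pairings show that `κ` respects both products and both units and satisfies the triangle identity
(`κ_tens`, `κ_par`, `κ_tUnit`, `κ_pUnit`, `κ_triangle`). So `κ` and its inverse supply the units and
counits of both component adjunctions, and unit and counit agree by construction.

The cyclor enters through `σ`, which is `ψ` followed by the comparison `rdConj` of two right duals
of `K A`, and through the two formulas for `κ`. The unit formula comes from naturality of `ψ`
(`κ_eq_unitMap`), the counit formula from its compatibility with double dualization
(`κ_eq_counitMap`). -/

/-! ### The reverse of a linearly distributive category -/

section Reverse

open MonoidalCategory

/-- The reversed monoidal structure on the same category. -/
@[reducible] def revMonoidal {C : Type u} [Category.{v} C] (M : MonoidalCategory C) :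
    MonoidalCategory C where
  tensorObj A B := B ⊗ A
  whiskerLeft X _ _ f := f ▷ X
  whiskerRight f X := X ◁ f
  tensorHom f g := g ⊗ₘ f
  tensorUnit := 𝟙_ C
  associator A B D := (α_ D B A).symm
  leftUnitor A := ρ_ A
  rightUnitor A := λ_ A
  tensorHom_def f g := tensorHom_def' g f
  id_tensorHom_id A B := id_tensorHom_id B A
  tensorHom_comp_tensorHom f g f' g' := tensorHom_comp_tensorHom g f g' f'
  whiskerLeft_id X Y := id_whiskerRight Y X
  id_whiskerRight X Y := whiskerLeft_id Y X
  associator_naturality f g h := associator_inv_naturality h g f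
  leftUnitor_naturality f := rightUnitor_naturality f
  rightUnitor_naturality f := leftUnitor_naturality f
  pentagon _ _ _ _ := pentagon_inv
  triangle X Y := triangle_assoc_comp_right Y X

end Reverse

/-- The reverse of a linearly distributive category: both monoidal structures are reversed. -/
@[reducible] def LinDistCat.rev {C : Type u} [Category.{v} C] [LinDistCat C] :
    LinDistCat C where
  tens := revMonoidal TwoMonoidal.tens
  par := revMonoidal TwoMonoidal.par
  δL A B D := δR D B A
  δR A B D := δL D B A
  δL_natural f g h := δR_natural h g f
  δR_natural f g h := δL_natural h g f
  δL_tUnit B D := δR_tUnit D B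
  δL_pUnit A B := δR_pUnit B A
  δR_tUnit A B := δL_tUnit B A
  δR_pUnit B D := δL_pUnit D B
  δL_aT A B D E := (op_δL_aP E D B A).trans (Category.assoc _ _ _)
  δL_aP A B D E := (op_δL_aT E D B A).trans (Category.assoc _ _ _)
  δR_aT A B D E := (op_δR_aP E D B A).trans (Category.assoc _ _ _)
  δR_aP A B D E := (op_δR_aT E D B A).trans (Category.assoc _ _ _)
  δL_δR_aT A B D E := (op_δL_δR_aP E D B A).symm.trans (Category.assoc _ _ _)
  δL_δR_aP A B D E := (Category.assoc _ _ _).symm.trans (op_δL_δR_aT E D B A)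

/-! ### Naturality and coherence of the two monoidal structures -/

section Basics

variable {C : Type u} [Category.{v} C] [TwoMonoidal C]

theorem tHom_swap {A B A' B' : C} (f : A ⟶ A') (g : B ⟶ B') :
    (𝟙 A ⊠ₘ g) ≫ (f ⊠ₘ 𝟙 B') = (f ⊠ₘ 𝟙 B) ≫ (𝟙 A' ⊠ₘ g) := by
  simp only [tHom_comp, Category.id_comp, Category.comp_id]

theorem tHom_right_left {A B A' B' : C} (f : A ⟶ A') (g : B ⟶ B') :
    (𝟙 A ⊠ₘ g) ≫ (f ⊠ₘ 𝟙 B') = f ⊠ₘ g := by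
  simp only [tHom_comp, Category.id_comp, Category.comp_id]

theorem tHom_comp_id {A A' A'' : C} (B : C) (f : A ⟶ A') (f' : A' ⟶ A'') :
    (f ≫ f') ⊠ₘ 𝟙 B = (f ⊠ₘ 𝟙 B) ≫ (f' ⊠ₘ 𝟙 B) := by
  simp only [tHom_comp, Category.comp_id]

theorem id_tHom_comp {A A' A'' : C} (B : C) (f : A ⟶ A') (f' : A' ⟶ A'') :
    𝟙 B ⊠ₘ (f ≫ f') = (𝟙 B ⊠ₘ f) ≫ (𝟙 B ⊠ₘ f') := by
  simp only [tHom_comp, Category.comp_id]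

theorem pHom_swap {A B A' B' : C} (f : A ⟶ A') (g : B ⟶ B') :
    (𝟙 A ⅋ₘ g) ≫ (f ⅋ₘ 𝟙 B') = (f ⅋ₘ 𝟙 B) ≫ (𝟙 A' ⅋ₘ g) := by
  simp only [pHom_comp, Category.id_comp, Category.comp_id]

theorem pHom_comp_id {A A' A'' : C} (B : C) (f : A ⟶ A') (f' : A' ⟶ A'') :
    (f ≫ f') ⅋ₘ 𝟙 B = (f ⅋ₘ 𝟙 B) ≫ (f' ⅋ₘ 𝟙 B) := by
  simp only [pHom_comp, Category.comp_id]

theorem id_pHom_comp {A A' A'' : C} (B : C) (f : A ⟶ A') (f' : A' ⟶ A'') :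
    𝟙 B ⅋ₘ (f ≫ f') = (𝟙 B ⅋ₘ f) ≫ (𝟙 B ⅋ₘ f') := by
  simp only [pHom_comp, Category.comp_id]

theorem aT_natural {A B D A' B' D' : C} (f : A ⟶ A') (g : B ⟶ B') (h : D ⟶ D') :
    ((f ⊠ₘ g) ⊠ₘ h) ≫ (aT A' B' D').hom = (aT A B D).hom ≫ (f ⊠ₘ (g ⊠ₘ h)) :=
  TwoMonoidal.tens.associator_naturality f g h

theorem aT_inv_natural {A B D A' B' D' : C} (f : A ⟶ A') (g : B ⟶ B') (h : D ⟶ D') :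
    (f ⊠ₘ (g ⊠ₘ h)) ≫ (aT A' B' D').inv = (aT A B D).inv ≫ ((f ⊠ₘ g) ⊠ₘ h) := by
  rw [Iso.eq_inv_comp, ← Category.assoc, Iso.comp_inv_eq, aT_natural]

theorem aP_natural {A B D A' B' D' : C} (f : A ⟶ A') (g : B ⟶ B') (h : D ⟶ D') :
    ((f ⅋ₘ g) ⅋ₘ h) ≫ (aP A' B' D').hom = (aP A B D).hom ≫ (f ⅋ₘ (g ⅋ₘ h)) :=
  TwoMonoidal.par.associator_naturality f g h

theorem lT_natural {A B : C} (f : A ⟶ B) : (𝟙 _ ⊠ₘ f) ≫ (lT B).hom = (lT A).hom ≫ f :=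
  (congrArg (· ≫ (lT B).hom) (TwoMonoidal.tens.id_tensorHom _ f)).trans
    (TwoMonoidal.tens.leftUnitor_naturality f)

theorem rT_natural {A B : C} (f : A ⟶ B) : (f ⊠ₘ 𝟙 _) ≫ (rT B).hom = (rT A).hom ≫ f :=
  (congrArg (· ≫ (rT B).hom) (TwoMonoidal.tens.tensorHom_id f _)).trans
    (TwoMonoidal.tens.rightUnitor_naturality f)

theorem lP_natural {A B : C} (f : A ⟶ B) : (𝟙 _ ⅋ₘ f) ≫ (lP B).hom = (lP A).hom ≫ f :=
  (congrArg (· ≫ (lP B).hom) (TwoMonoidal.par.id_tensorHom _ f)).trans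
    (TwoMonoidal.par.leftUnitor_naturality f)

theorem rP_natural {A B : C} (f : A ⟶ B) : (f ⅋ₘ 𝟙 _) ≫ (rP B).hom = (rP A).hom ≫ f :=
  (congrArg (· ≫ (rP B).hom) (TwoMonoidal.par.tensorHom_id f _)).trans
    (TwoMonoidal.par.rightUnitor_naturality f)

theorem lT_inv_natural {A B : C} (f : A ⟶ B) : f ≫ (lT B).inv = (lT A).inv ≫ (𝟙 _ ⊠ₘ f) := by
  rw [Iso.eq_inv_comp, ← Category.assoc, Iso.comp_inv_eq, lT_natural]

theorem aT_lT (A B : C) : (aT A (tUnit C) B).hom ≫ (𝟙 A ⊠ₘ (lT B).hom) = (rT A).hom ⊠ₘ 𝟙 B :=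
  (congrArg ((aT A (tUnit C) B).hom ≫ ·) (TwoMonoidal.tens.id_tensorHom _ _)).trans
    ((TwoMonoidal.tens.triangle A B).trans (TwoMonoidal.tens.tensorHom_id _ _).symm)

theorem aP_lP (A B : C) : (aP A (pUnit C) B).hom ≫ (𝟙 A ⅋ₘ (lP B).hom) = (rP A).hom ⅋ₘ 𝟙 B :=
  (congrArg ((aP A (pUnit C) B).hom ≫ ·) (TwoMonoidal.par.id_tensorHom _ _)).trans
    ((TwoMonoidal.par.triangle A B).trans (TwoMonoidal.par.tensorHom_id _ _).symm)

theorem aT_rT (A B : C) : (aT A B (tUnit C)).hom ≫ (𝟙 A ⊠ₘ (rT B).hom) = (rT (A ⊠ B)).hom :=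
  (congrArg ((aT A B (tUnit C)).hom ≫ ·) (TwoMonoidal.tens.id_tensorHom _ _)).trans
    (@MonoidalCategory.rightUnitor_tensor_hom C _ TwoMonoidal.tens A B).symm

theorem aP_rP (A B : C) : (aP A B (pUnit C)).hom ≫ (𝟙 A ⅋ₘ (rP B).hom) = (rP (A ⅋ B)).hom :=
  (congrArg ((aP A B (pUnit C)).hom ≫ ·) (TwoMonoidal.par.id_tensorHom _ _)).trans
    (@MonoidalCategory.rightUnitor_tensor_hom C _ TwoMonoidal.par A B).symm

theorem aT_lT_id (A B : C) : (aT (tUnit C) A B).hom ≫ (lT (A ⊠ B)).hom = (lT A).hom ⊠ₘ 𝟙 B := by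
  have h := @MonoidalCategory.leftUnitor_tensor_hom C _ TwoMonoidal.tens A B
  rw [← TwoMonoidal.tens.tensorHom_id] at h
  exact (congrArg ((aT (tUnit C) A B).hom ≫ ·) h).trans (Iso.hom_inv_id_assoc _ _)

theorem rP_pUnit : (rP (pUnit C)).hom = (lP (pUnit C)).hom :=
  (@MonoidalCategory.unitors_equal C _ TwoMonoidal.par).symm

theorem aT_pentagon (A B D E : C) :
    ((aT A B D).hom ⊠ₘ 𝟙 E) ≫ (aT A (B ⊠ D) E).hom ≫ (𝟙 A ⊠ₘ (aT B D E).hom)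
      = (aT (A ⊠ B) D E).hom ≫ (aT A B (D ⊠ E)).hom := by
  have h := TwoMonoidal.tens.pentagon A B D E
  rw [← TwoMonoidal.tens.tensorHom_id, ← TwoMonoidal.tens.id_tensorHom] at h
  exact h

theorem aT_inv_pentagon (A B D E : C) :
    (𝟙 A ⊠ₘ (aT B D E).hom) ≫ (aT A B (D ⊠ E)).inv ≫ (aT (A ⊠ B) D E).inv
      = (aT A (B ⊠ D) E).inv ≫ ((aT A B D).inv ⊠ₘ 𝟙 E) := by
  have h : (tIso (aT A B D) (Iso.refl E)).hom ≫ (aT A (B ⊠ D) E).hom ≫ (𝟙 A ⊠ₘ (aT B D E).hom)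
      = (aT (A ⊠ B) D E).hom ≫ (aT A B (D ⊠ E)).hom := aT_pentagon A B D E
  have h' : (aT A (B ⊠ D) E).hom ≫ (𝟙 A ⊠ₘ (aT B D E).hom) ≫ (aT A B (D ⊠ E)).inv ≫
      (aT (A ⊠ B) D E).inv = (tIso (aT A B D) (Iso.refl E)).inv := by
    rw [← cancel_epi (tIso (aT A B D) (Iso.refl E)).hom, Iso.hom_inv_id, reassoc_of% h,
      Iso.hom_inv_id_assoc, Iso.hom_inv_id]
  exact (Iso.eq_inv_comp _).2 h'

theorem aT_hom_pentagon (A B D E : C) :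
    (aT A B (D ⊠ E)).hom ≫ (𝟙 A ⊠ₘ (aT B D E).inv) ≫ (aT A (B ⊠ D) E).inv
      = (aT (A ⊠ B) D E).inv ≫ ((aT A B D).hom ⊠ₘ 𝟙 E) := by
  have h : (aT A B (D ⊠ E)).hom ≫ (tIso (Iso.refl A) (aT B D E)).inv ≫ (aT A (B ⊠ D) E).inv
      = (aT (A ⊠ B) D E).inv ≫ ((aT A B D).hom ⊠ₘ 𝟙 E) := by
    rw [Iso.eq_inv_comp, ← Category.assoc, ← Category.assoc, Iso.comp_inv_eq, Iso.comp_inv_eq,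
      Category.assoc]
    exact (aT_pentagon A B D E).symm
  exact h

end Basics

/-! ### Contraction with a pairing -/

section Contraction

variable {C : Type u} [Category.{v} C] [LinDistCat C]

/-- Contract the right factor of a par with a pairing. -/
def capR (D : C) {A X : C} (e : A ⊠ X ⟶ pUnit C) : (D ⅋ A) ⊠ X ⟶ D :=
  δR D A X ≫ (𝟙 D ⅋ₘ e) ≫ (rP D).hom

/-- Contract the left factor of a par with a pairing. -/
def capL (D : C) {B Y : C} (e : B ⊠ Y ⟶ pUnit C) : B ⊠ (Y ⅋ D) ⟶ D :=
  δL B Y D ≫ (e ⅋ₘ 𝟙 D) ≫ (lP D).hom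

/-- The pairing of `B ⅋ A` with `X ⊠ Y` induced by pairings of `A` with `X` and `B` with `Y`. -/
def pairP {A X B Y : C} (e : A ⊠ X ⟶ pUnit C) (e' : B ⊠ Y ⟶ pUnit C) :
    (B ⅋ A) ⊠ (X ⊠ Y) ⟶ pUnit C :=
  (aT (B ⅋ A) X Y).inv ≫ (capR B e ⊠ₘ 𝟙 Y) ≫ e'

/-- The pairing of `A ⊠ B` with `Y ⅋ X` induced by pairings of `A` with `X` and `B` with `Y`. -/
def pairQ {A X B Y : C} (e : A ⊠ X ⟶ pUnit C) (e' : B ⊠ Y ⟶ pUnit C) :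
    (A ⊠ B) ⊠ (Y ⅋ X) ⟶ pUnit C :=
  (aT A B (Y ⅋ X)).hom ≫ (𝟙 A ⊠ₘ capL X e') ≫ e

theorem capR_natural {A X D A' X' D' : C} (h : D ⟶ D') (f : A ⟶ A') (g : X ⟶ X')
    (e : A' ⊠ X' ⟶ pUnit C) :
    ((h ⅋ₘ f) ⊠ₘ g) ≫ capR D' e = capR D ((f ⊠ₘ g) ≫ e) ≫ h := by
  unfold capR
  rw [reassoc_of% (δR_natural h f g)]
  simp only [Category.assoc, ← rP_natural]
  rw [← Category.assoc (h ⅋ₘ _), ← Category.assoc (𝟙 D ⅋ₘ _), pHom_comp, pHom_comp]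
  simp only [Category.comp_id, Category.id_comp]

/-- By `δR_aP` and the coherence of the right unitor, contracting the last factor of a triple par
does not depend on the bracketing. -/
theorem capR_aP {A X : C} (D B : C) (e : A ⊠ X ⟶ pUnit C) :
    ((aP D B A).hom ⊠ₘ 𝟙 X) ≫ δR D (B ⅋ A) X ≫ (𝟙 D ⅋ₘ capR B e) = capR (D ⅋ B) e := by
  unfold capR
  simp only [id_pHom_comp]
  rw [← reassoc_of% (δR_aP D B A X), ← reassoc_of% (aP_natural (𝟙 D) (𝟙 B) e), aP_rP, pHom_id]

theorem capR_aT {A X Y : C} (D : C) (e : A ⊠ (X ⊠ Y) ⟶ pUnit C) :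
    (aT (D ⅋ A) X Y).hom ≫ capR D e = (δR D A X ⊠ₘ 𝟙 Y) ≫ capR D ((aT A X Y).hom ≫ e) := by
  unfold capR
  rw [reassoc_of% (δR_aT D A X Y), id_pHom_comp, Category.assoc]

theorem capR_aT_inv {A X Y : C} (D : C) (e : A ⊠ (X ⊠ Y) ⟶ pUnit C) :
    capR D e = (aT (D ⅋ A) X Y).inv ≫ (δR D A X ⊠ₘ 𝟙 Y) ≫ capR D ((aT A X Y).hom ≫ e) := by
  rw [Iso.eq_inv_comp, capR_aT]

/-- Contracting with an induced pairing amounts to two successive contractions, inner factor first.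
This is the engine of `pairP_assoc`. -/
theorem capR_pairP {A X B Y : C} (D : C) (e : A ⊠ X ⟶ pUnit C) (e' : B ⊠ Y ⟶ pUnit C) :
    ((aP D B A).hom ⊠ₘ 𝟙 (X ⊠ Y)) ≫ capR D (pairP e e')
      = (aT ((D ⅋ B) ⅋ A) X Y).inv ≫ (capR (D ⅋ B) e ⊠ₘ 𝟙 Y) ≫ capR D e' := by
  have h := capR_natural (𝟙 D) (capR B e) (𝟙 Y) e'
  rw [Category.comp_id] at h
  rw [capR_aT_inv, pairP, Iso.hom_inv_id_assoc, ← h, ← tHom_id,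
    reassoc_of% (aT_inv_natural (aP D B A).hom (𝟙 X) (𝟙 Y)), ← capR_aP]
  simp only [tHom_comp_id, Category.assoc]

/-- Contraction with a pairing commutes with the right distributor. -/
theorem capL_δR {E Z : C} (Y X : C) (e : E ⊠ Z ⟶ pUnit C) :
    (𝟙 E ⊠ₘ δR Z Y X) ≫ capL (Y ⊠ X) e = (aT E (Z ⅋ Y) X).inv ≫ (capL Y e ⊠ₘ 𝟙 X) := by
  unfold capL
  have h := δR_natural e (𝟙 Y) (𝟙 X)
  rw [tHom_id] at h
  -- The coherence between the two distributors lets `δL` act first, with `X` as a spectator.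
  rw [Iso.eq_inv_comp, ← reassoc_of% (δL_δR_aT E Z Y X), ← reassoc_of% h, δR_pUnit]
  simp only [tHom_comp_id]

/-! ### The induced pairings -/

theorem pairP_natural {A X B Y A' X' B' Y' : C} (f : A ⟶ A') (g : X ⟶ X') (f' : B ⟶ B')
    (g' : Y ⟶ Y') (e : A' ⊠ X' ⟶ pUnit C) (e' : B' ⊠ Y' ⟶ pUnit C) :
    ((f' ⅋ₘ f) ⊠ₘ (g ⊠ₘ g')) ≫ pairP e e' = pairP ((f ⊠ₘ g) ≫ e) ((f' ⊠ₘ g') ≫ e') := by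
  unfold pairP
  rw [reassoc_of% (aT_inv_natural (f' ⅋ₘ f) g g'), ← Category.assoc (_ ⊠ₘ g'), tHom_comp,
    capR_natural, ← Category.assoc (_ ⊠ₘ 𝟙 Y), tHom_comp]
  simp only [Category.comp_id, Category.id_comp]

/-- In the reversed category `capR` unfolds to `capL` and `pairP` to `pairQ`, so each law of `pairP`
has a definitional mirror image for `pairQ`. -/
theorem pairQ_natural {A X B Y A' X' B' Y' : C} (f : A ⟶ A') (g : X ⟶ X') (f' : B ⟶ B')
    (g' : Y ⟶ Y') (e : A' ⊠ X' ⟶ pUnit C) (e' : B' ⊠ Y' ⟶ pUnit C) :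
    ((f ⊠ₘ f') ⊠ₘ (g' ⅋ₘ g)) ≫ pairQ e e' = pairQ ((f ⊠ₘ g) ≫ e) ((f' ⊠ₘ g') ≫ e') :=
  @pairP_natural C _ LinDistCat.rev _ _ _ _ _ _ _ _ g' f' g f e' e

/-- Both sides apply `e₁`, then `e₂`, then `e₃`; once `capR_pairP` has split the nested contraction,
only the pentagon is left. -/
theorem pairP_assoc {A X B Y D Z : C} (e₁ : A ⊠ X ⟶ pUnit C) (e₂ : B ⊠ Y ⟶ pUnit C)
    (e₃ : D ⊠ Z ⟶ pUnit C) :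
    ((aP D B A).hom ⊠ₘ 𝟙 _) ≫ pairP (pairP e₁ e₂) e₃
      = (𝟙 _ ⊠ₘ (aT X Y Z).hom) ≫ pairP e₁ (pairP e₂ e₃) := by
  rw [pairP, ← tHom_id, reassoc_of% (aT_inv_natural (aP D B A).hom (𝟙 (X ⊠ Y)) (𝟙 Z)),
    ← reassoc_of% tHom_comp_id, capR_pairP]
  simp only [pairP, tHom_comp_id, Category.assoc]
  have h := aT_inv_natural (capR (D ⅋ B) e₁) (𝟙 Y) (𝟙 Z)
  rw [tHom_id] at h
  rw [reassoc_of% h, reassoc_of% (aT_inv_pentagon ((D ⅋ B) ⅋ A) X Y Z)]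

theorem pairQ_assoc {A X B Y D Z : C} (e₁ : X ⊠ A ⟶ pUnit C) (e₂ : Y ⊠ B ⟶ pUnit C)
    (e₃ : Z ⊠ D ⟶ pUnit C) :
    (𝟙 _ ⊠ₘ (aP A B D).inv) ≫ pairQ e₃ (pairQ e₂ e₁)
      = ((aT Z Y X).inv ⊠ₘ 𝟙 _) ≫ pairQ (pairQ e₃ e₂) e₁ :=
  @pairP_assoc C _ LinDistCat.rev _ _ _ _ _ _ e₁ e₂ e₃

/-- The unitor `⊥ ⊠ ⊤ ⟶ ⊥` is the canonical pairing of the two units; this is the unit law for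
`pairP` with respect to it. -/
theorem pairP_rT_left {B Y : C} (e : B ⊠ Y ⟶ pUnit C) :
    pairP (rT (pUnit C)).hom e = ((rP B).hom ⊠ₘ (lT Y).hom) ≫ e := by
  rw [pairP, capR, reassoc_of% (δR_tUnit B (pUnit C)), Iso.inv_comp_eq, tHom_comp_id,
    Category.assoc, ← aT_lT]
  rw [Category.assoc, reassoc_of% (tHom_right_left (rP B).hom (lT Y).hom)]

theorem pairP_rT_right {A X : C} (e : A ⊠ X ⟶ pUnit C) :
    pairP e (rT (pUnit C)).hom = ((lP A).hom ⊠ₘ (rT X).hom) ≫ e := by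
  have h : capR (pUnit C) e = ((lP A).hom ⊠ₘ 𝟙 X) ≫ e := by
    rw [capR, rP_pUnit, lP_natural, reassoc_of% (δR_pUnit A X)]
  rw [pairP, h, Iso.inv_comp_eq, rT_natural, ← tHom_right_left (lP A).hom (rT X).hom,
    Category.assoc, reassoc_of% (aT_rT (pUnit C ⅋ A) X)]

theorem pairQ_lT_right {B Y : C} (e : Y ⊠ B ⟶ pUnit C) :
    pairQ e (lT (pUnit C)).hom = ((rT Y).hom ⊠ₘ (lP B).hom) ≫ e :=
  @pairP_rT_left C _ LinDistCat.rev _ _ e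

theorem pairQ_lT_left {A X : C} (e : X ⊠ A ⟶ pUnit C) :
    pairQ (lT (pUnit C)).hom e = ((lT X).hom ⊠ₘ (rP A).hom) ≫ e :=
  @pairP_rT_right C _ LinDistCat.rev _ _ e

/-- The transpose of a right distributor is a right distributor: both sides contract `E` with `Z`,
then `B` with `Y`, then `A` with `X`. It becomes the Frobenius law of the left dual in
`ldPar_δR_ldTens`. -/
theorem pairQ_pairP {A X B Y E Z : C} (eA : A ⊠ X ⟶ pUnit C) (eB : B ⊠ Y ⟶ pUnit C)
    (eE : E ⊠ Z ⟶ pUnit C) :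
    (𝟙 _ ⊠ₘ δR Z Y X) ≫ pairQ (pairP eB eA) eE
      = (δR A B E ⊠ₘ 𝟙 _) ≫ pairP (pairQ eB eE) eA := by
  have h₁ : (δR A B E ⊠ₘ 𝟙 (Z ⅋ Y)) ≫ capR A (pairQ eB eE)
      = (aT (A ⅋ B) E (Z ⅋ Y)).hom ≫ (𝟙 (A ⅋ B) ⊠ₘ capL Y eE) ≫ capR A eB := by
    have h := capR_natural (𝟙 A) (𝟙 B) (capL Y eE) eB
    rw [Category.comp_id, pHom_id] at h
    rw [pairQ, ← capR_aT, h]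
  have h₂ := aT_natural (𝟙 (A ⅋ B)) (𝟙 E) (δR Z Y X)
  have h₃ := aT_inv_natural (δR A B E) (𝟙 (Z ⅋ Y)) (𝟙 X)
  have h₄ := aT_inv_natural (𝟙 (A ⅋ B)) (capL Y eE) (𝟙 X)
  have h₅ := aT_hom_pentagon (A ⅋ B) E (Z ⅋ Y) X
  rw [tHom_id] at h₂ h₃
  rw [pairQ, pairP, pairP, reassoc_of% h₃, ← reassoc_of% tHom_comp_id, h₁, reassoc_of% h₂,
    ← reassoc_of% id_tHom_comp, capL_δR]
  simp only [tHom_comp_id, id_tHom_comp, Category.assoc]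
  rw [reassoc_of% h₄, reassoc_of% h₅]

theorem pairP_pairQ {A X B Y E Z : C} (eA : X ⊠ A ⟶ pUnit C) (eB : Y ⊠ B ⟶ pUnit C)
    (eE : Z ⊠ E ⟶ pUnit C) :
    (δL X Y Z ⊠ₘ 𝟙 _) ≫ pairP eE (pairQ eA eB)
      = (𝟙 _ ⊠ₘ δL E B A) ≫ pairQ eA (pairP eE eB) :=
  @pairQ_pairP C _ LinDistCat.rev _ _ _ _ _ _ eA eB eE

end Contraction

/-! ### Currying along a linear dual -/

section Currying

variable {C : Type u} [Category.{v} C] [LinDistCat C]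

/-- Given `η : ⊤ ⟶ B ⅋ A`, transpose a map `A ⊠ Y ⟶ X` to a map `Y ⟶ B ⅋ X`. -/
def curryL {A B X Y : C} (η : tUnit C ⟶ B ⅋ A) (g : A ⊠ Y ⟶ X) : Y ⟶ B ⅋ X :=
  (lT Y).inv ≫ (η ⊠ₘ 𝟙 Y) ≫ δR B A Y ≫ (𝟙 B ⅋ₘ g)

/-- Reversal swaps the two snake equations; results about right duals are obtained from those about
left duals in this way. -/
theorem IsLinearDual.rev {A B : C} {η : tUnit C ⟶ B ⅋ A} {ev : A ⊠ B ⟶ pUnit C}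
    (h : IsLinearDual η ev) : @IsLinearDual C _ LinDistCat.rev A B η ev :=
  @IsLinearDual.mk C _ LinDistCat.rev A B η ev h.snake_right h.snake_left

/-- Together with `capL_curryL` this is the adjunction between `A ⊠ _` and `B ⅋ _`. Each half
reduces to one snake equation through one of the two laws that relate `δL` and `δR`. -/
theorem IsLinearDual.curryL_capL {A B X Y : C} {η : tUnit C ⟶ B ⅋ A} {ev : A ⊠ B ⟶ pUnit C}
    (h : IsLinearDual η ev) (g : A ⊠ Y ⟶ X) : (𝟙 A ⊠ₘ curryL η g) ≫ capL X ev = g := by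
  have nat := δL_natural (𝟙 A) (𝟙 B) g
  rw [tHom_id] at nat
  -- Gathers the snake on `A` in the left factor, with `Y` as a spectator.
  have mid : (𝟙 A ⊠ₘ δR B A Y) ≫ δL A B (A ⊠ Y)
      = (aT A (B ⅋ A) Y).inv ≫ (δL A B A ⊠ₘ 𝟙 Y) ≫ δR (A ⊠ B) A Y := by
    rw [Iso.eq_inv_comp]; exact (δL_δR_aT A B A Y).symm
  have tri : (𝟙 A ⊠ₘ (lT Y).inv) ≫ (aT A (tUnit C) Y).inv = (rT A).inv ⊠ₘ 𝟙 Y := by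
    have h1 : (tIso (Iso.refl A) (lT Y)).inv ≫ (aT A (tUnit C) Y).inv
        = (tIso (rT A) (Iso.refl Y)).inv := by
      rw [Iso.inv_comp_eq, Iso.eq_comp_inv, Iso.inv_comp_eq]
      exact (aT_lT A Y).symm
    exact h1
  have natR := δR_natural ev (𝟙 A) (𝟙 Y)
  rw [tHom_id] at natR
  simp only [curryL, capL, id_tHom_comp, Category.assoc]
  rw [reassoc_of% nat, reassoc_of% mid, reassoc_of% (aT_inv_natural (𝟙 A) η (𝟙 Y)),
    reassoc_of% tri, reassoc_of% (pHom_swap ev g), lP_natural, ← reassoc_of% natR,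
    reassoc_of% (δR_pUnit A Y)]
  simp only [← reassoc_of% tHom_comp_id]
  rw [h.snake_right, tHom_id, Category.id_comp]

theorem IsLinearDual.capL_curryL {A B X Y : C} {η : tUnit C ⟶ B ⅋ A} {ev : A ⊠ B ⟶ pUnit C}
    (h : IsLinearDual η ev) (f : Y ⟶ B ⅋ X) : curryL η ((𝟙 A ⊠ₘ f) ≫ capL X ev) = f := by
  have nat := δR_natural (𝟙 B) (𝟙 A) f
  rw [pHom_id] at nat
  have natL := δL_natural η (𝟙 B) (𝟙 X)
  rw [pHom_id] at natL
  simp only [curryL, capL, id_pHom_comp]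
  rw [← reassoc_of% nat, ← reassoc_of% (tHom_swap η f), ← reassoc_of% (lT_inv_natural f),
    ← reassoc_of% (δL_δR_aP B A B X), reassoc_of% natL, reassoc_of% (op_δR_pUnit B X),
    ← reassoc_of% (aP_natural (𝟙 B) ev (𝟙 X)), aP_lP]
  simp only [← pHom_comp_id]
  rw [h.snake_left, pHom_id, Category.comp_id]

variable {A B : C} {η : tUnit C ⟶ B ⅋ A} {ev : A ⊠ B ⟶ pUnit C}

/-- Maps into the left dual are determined by their pairing. -/
theorem IsLinearDual.hom_ext_left (h : IsLinearDual η ev) {Y : C} {f g : Y ⟶ B}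
    (w : (𝟙 A ⊠ₘ f) ≫ ev = (𝟙 A ⊠ₘ g) ≫ ev) : f = g := by
  -- Bending is natural in `Y`, and bending `ev` itself is the first snake equation.
  have key (k : Y ⟶ B) : bendL η ((𝟙 A ⊠ₘ k) ≫ ev) = k := by
    have h1 : bendL η ev = 𝟙 B := h.snake_left
    rw [← comp_bendL, h1, Category.comp_id]
  rw [← key f, ← key g, w]

theorem IsLinearDual.hom_ext_right (h : IsLinearDual η ev) {Y : C} {f g : Y ⟶ A}
    (w : (f ⊠ₘ 𝟙 B) ≫ ev = (g ⊠ₘ 𝟙 B) ≫ ev) : f = g :=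
  @IsLinearDual.hom_ext_left C _ LinDistCat.rev _ _ _ _ h.rev Y f g w

theorem IsLinearDual.bendR_comp (h : IsLinearDual η ev) {Y : C} (e : Y ⊠ B ⟶ pUnit C) :
    (bendR η e ⊠ₘ 𝟙 B) ≫ ev = e :=
  @IsLinearDual.bendL_comp C _ LinDistCat.rev _ _ Y _ _ h.rev e

theorem IsLinearDual.curryL_ext (h : IsLinearDual η ev) {X Y : C} {f g : Y ⟶ B ⅋ X}
    (w : (𝟙 A ⊠ₘ f) ≫ capL X ev = (𝟙 A ⊠ₘ g) ≫ capL X ev) : f = g := by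
  rw [← h.capL_curryL f, ← h.capL_curryL g, w]

/-- Two left duals of the same object are isomorphic. -/
def IsLinearDual.isoLeft {B' : C} {η' : tUnit C ⟶ B' ⅋ A} {ev' : A ⊠ B' ⟶ pUnit C}
    (h : IsLinearDual η ev) (h' : IsLinearDual η' ev') : B ≅ B' where
  hom := bendL η' ev
  inv := bendL η ev'
  hom_inv_id := h.hom_ext_left (by
    rw [id_tHom_comp, Category.assoc, h.bendL_comp, h'.bendL_comp, tHom_id, Category.id_comp])
  inv_hom_id := h'.hom_ext_left (by
    rw [id_tHom_comp, Category.assoc, h'.bendL_comp, h.bendL_comp, tHom_id, Category.id_comp])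

/-- Two right duals of the same object are isomorphic. -/
def IsLinearDual.isoRight {A' : C} {η' : tUnit C ⟶ B ⅋ A'} {ev' : A' ⊠ B ⟶ pUnit C}
    (h : IsLinearDual η ev) (h' : IsLinearDual η' ev') : A ≅ A' where
  hom := bendR η' ev
  inv := bendR η ev'
  hom_inv_id := h.hom_ext_right (by
    rw [tHom_comp_id, Category.assoc, h.bendR_comp, h'.bendR_comp, tHom_id, Category.id_comp])
  inv_hom_id := h'.hom_ext_right (by
    rw [tHom_comp_id, Category.assoc, h'.bendR_comp, h.bendR_comp, tHom_id, Category.id_comp])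

/-- A pairing `A ⊠ B ⟶ ⊥` such that maps into `B` are determined by their pairing with `A`. -/
def IsSeparating {A B : C} (e : A ⊠ B ⟶ pUnit C) : Prop :=
  ∀ ⦃Y : C⦄ ⦃f g : Y ⟶ B⦄, (𝟙 A ⊠ₘ f) ≫ e = (𝟙 A ⊠ₘ g) ≫ e → f = g

theorem IsLinearDual.isSeparating (h : IsLinearDual η ev) : IsSeparating ev :=
  fun _ _ _ w => h.hom_ext_left w

/-- Transposing `A'` across reduces the claim to maps into `B`, which `e` separates. Only the second
pairing needs a unit, so the result can be iterated, as in `ldPar_assoc`. -/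
theorem IsSeparating.pairQ {A B A' B' : C} {e : A ⊠ B ⟶ pUnit C} (h : IsSeparating e)
    {η' : tUnit C ⟶ B' ⅋ A'} {e' : A' ⊠ B' ⟶ pUnit C} (h' : IsLinearDual η' e') :
    IsSeparating (pairQ e e') := by
  intro W f g w
  apply h'.curryL_ext
  apply h
  rw [← cancel_epi (aT A A' W).hom]
  have key (k : W ⟶ B' ⅋ B) : (aT A A' W).hom ≫ (𝟙 A ⊠ₘ ((𝟙 A' ⊠ₘ k) ≫ capL B e')) ≫ e
      = (𝟙 _ ⊠ₘ k) ≫ _root_.pairQ e e' := by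
    have n := aT_natural (𝟙 A) (𝟙 A') k
    rw [tHom_id] at n
    rw [_root_.pairQ, reassoc_of% n, id_tHom_comp, Category.assoc]
  rw [key, key, w]

variable {A' B' : C} {η' : tUnit C ⟶ B' ⅋ A'} {ev' : A' ⊠ B' ⟶ pUnit C}

/-- The transpose of a pairing `(A ⊠ A') ⊠ W ⟶ ⊥`. -/
theorem IsLinearDual.curryL_pairQ (h : IsLinearDual η ev) (h' : IsLinearDual η' ev') {W : C}
    (e : (A ⊠ A') ⊠ W ⟶ pUnit C) :
    (𝟙 _ ⊠ₘ curryL η' (bendL η ((aT A A' W).inv ≫ e))) ≫ pairQ ev ev' = e := by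
  have n := aT_natural (𝟙 A) (𝟙 A') (curryL η' (bendL η ((aT A A' W).inv ≫ e)))
  rw [tHom_id] at n
  rw [pairQ, reassoc_of% n, ← reassoc_of% id_tHom_comp, h'.curryL_capL, h.bendL_comp,
    Iso.hom_inv_id_assoc]

/-- The unit of the par of two duals, as a transposition. -/
theorem bendL_pairing (η : tUnit C ⟶ B ⅋ A) (η' : tUnit C ⟶ B' ⅋ A') {W : C}
    (e : (A ⊠ A') ⊠ W ⟶ pUnit C) :
    bendL (η' ≫ (𝟙 B' ⅋ₘ (lT A').inv) ≫ (𝟙 B' ⅋ₘ (η ⊠ₘ 𝟙 A')) ≫ (𝟙 B' ⅋ₘ δR B A A') ≫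
        (aP B' B (A ⊠ A')).inv) e
      = curryL η' (bendL η ((aT A A' W).inv ≫ e)) := by
  have h₁ := op_δL_aT B' B (A ⊠ A') W
  have h₂ : (aP B' B ((A ⊠ A') ⊠ W)).inv ≫ (𝟙 (B' ⅋ B) ⅋ₘ e) ≫ (rP (B' ⅋ B)).hom
      = (𝟙 B' ⅋ₘ ((𝟙 B ⅋ₘ e) ≫ (rP B).hom)) := by
    rw [Iso.inv_comp_eq, ← aP_rP, ← pHom_id, reassoc_of% (aP_natural (𝟙 B') (𝟙 B) e),
      id_pHom_comp]
  have h₃ (X Y : C) (k : X ⟶ Y) := δR_natural (𝟙 B') k (𝟙 W)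
  have h₅ : ((lT A').inv ⊠ₘ 𝟙 W) = (lT (A' ⊠ W)).inv ≫ (aT (tUnit C) A' W).inv := by
    have : (tIso (lT A') (Iso.refl W)).inv = (lT (A' ⊠ W)).inv ≫ (aT (tUnit C) A' W).inv := by
      rw [← cancel_epi (tIso (lT A') (Iso.refl W)).hom, Iso.hom_inv_id]
      have := aT_lT_id A' W
      change 𝟙 _ = ((lT A').hom ⊠ₘ 𝟙 W) ≫ _
      rw [← this, Category.assoc, Iso.hom_inv_id_assoc, Iso.hom_inv_id]
    exact this
  have h₆ := op_δL_aP B A A' W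
  have h₇ := aT_inv_natural η (𝟙 A') (𝟙 W)
  rw [tHom_id] at h₇
  have h₈ : (𝟙 B ⅋ₘ (aT A A' W).inv) ≫ (𝟙 B ⅋ₘ e) = 𝟙 B ⅋ₘ ((aT A A' W).inv ≫ e) := by
    rw [id_pHom_comp]
  simp only [bendL, curryL, tHom_comp_id, Category.assoc]
  rw [reassoc_of% h₁, h₂, reassoc_of% h₃, reassoc_of% h₃, reassoc_of% h₃]
  -- Everything after the outer distributor now has the form `𝟙 B' ⅋ₘ _`; what remains is the inner
  -- transposition along `η`.
  simp only [← id_pHom_comp]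
  congr 4
  rw [reassoc_of% h₅, ← h₈, ← reassoc_of% h₇, Category.assoc, reassoc_of% h₆]

end Currying

/-! ### The canonical comparison maps, through their pairings -/

section Comparison

variable {C : Type u} [Category.{v} C] [LinDistCat C] [StarAutonomous C]

theorem ldMap_pairing {A B : C} (f : A ⟶ B) :
    (𝟙 A ⊠ₘ ldMap f) ≫ εl A = (f ⊠ₘ 𝟙 (ld B)) ≫ εl B :=
  (isLinearDual_left A).bendL_comp _

theorem rdMap_pairing {A B : C} (f : A ⟶ B) :
    (rdMap f ⊠ₘ 𝟙 A) ≫ εr A = (𝟙 (rd B) ⊠ₘ f) ≫ εr B :=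
  (isLinearDual_right A).bendR_comp _

theorem ldTens_pairing (A B : C) :
    (𝟙 (B ⅋ A) ⊠ₘ ldTens A B) ≫ εl (B ⅋ A) = pairP (εl A) (εl B) := by
  rw [ldTens, (isLinearDual_left (B ⅋ A)).bendL_comp]
  simp only [pairP, capR, tHom_comp_id, Category.assoc]

/-- The unit used to define `ldPar` is that of the par of two duals, so bending along it is a double
transposition (`bendL_pairing`), which `pairQ` undoes. -/
theorem ldPar_pairing (A B : C) :
    (𝟙 (A ⊠ B) ⊠ₘ ldPar A B) ≫ pairQ (εl A) (εl B) = εl (A ⊠ B) := by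
  rw [ldPar, bendL_pairing, (isLinearDual_left A).curryL_pairQ (isLinearDual_left B)]

theorem ldTop_pairing : (𝟙 (pUnit C) ⊠ₘ ldTop C) ≫ εl (pUnit C) = (rT (pUnit C)).hom :=
  (isLinearDual_left (pUnit C)).bendL_comp _

/-- The unit `⊤ ⟶ ⊥ ⅋ ⊤` bent along here is an inverse unitor, so the bending collapses by
coherence. -/
theorem ldBot_eq : ldBot C = (lT (ld (tUnit C))).inv ≫ εl (tUnit C) := by
  rw [ldBot, bendL, rP_pUnit, lP_natural, reassoc_of% (op_δL_tUnit (tUnit C) (ld (tUnit C))),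
    Iso.inv_hom_id_assoc]

theorem ldBot_pairing : (𝟙 (tUnit C) ⊠ₘ ldBot C) ≫ (lT (pUnit C)).hom = εl (tUnit C) := by
  rw [lT_natural, ldBot_eq, Iso.hom_inv_id_assoc]

theorem fromRdLd_pairing (A : C) : (fromRdLd A ⊠ₘ 𝟙 (ld A)) ≫ εl A = εr (ld A) :=
  (isLinearDual_left A).bendR_comp _

theorem toRdLd_pairing (A : C) : (toRdLd A ⊠ₘ 𝟙 (ld A)) ≫ εr (ld A) = εl A :=
  (isLinearDual_right (ld A)).bendR_comp _

theorem toLdRd_pairing (A : C) : (𝟙 (rd A) ⊠ₘ toLdRd A) ≫ εl (rd A) = εr A :=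
  (isLinearDual_left (rd A)).bendL_comp _

end Comparison

/-! ### One-sided naturality of the induced pairings -/

section PairingNaturality

variable {C : Type u} [Category.{v} C] [LinDistCat C]

theorem pairP_left {A X B Y A' B' : C} (f : A ⟶ A') (f' : B ⟶ B') (e : A' ⊠ X ⟶ pUnit C)
    (e' : B' ⊠ Y ⟶ pUnit C) :
    ((f' ⅋ₘ f) ⊠ₘ 𝟙 (X ⊠ Y)) ≫ pairP e e'
      = pairP ((f ⊠ₘ 𝟙 X) ≫ e) ((f' ⊠ₘ 𝟙 Y) ≫ e') := by
  rw [← pairP_natural, tHom_id]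

theorem pairP_right {A X B Y X' Y' : C} (g : X ⟶ X') (g' : Y ⟶ Y') (e : A ⊠ X' ⟶ pUnit C)
    (e' : B ⊠ Y' ⟶ pUnit C) :
    (𝟙 (B ⅋ A) ⊠ₘ (g ⊠ₘ g')) ≫ pairP e e'
      = pairP ((𝟙 A ⊠ₘ g) ≫ e) ((𝟙 B ⊠ₘ g') ≫ e') := by
  rw [← pairP_natural, pHom_id]

theorem pairQ_left {A X B Y A' B' : C} (f : A ⟶ A') (f' : B ⟶ B') (e : A' ⊠ X ⟶ pUnit C)
    (e' : B' ⊠ Y ⟶ pUnit C) :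
    ((f ⊠ₘ f') ⊠ₘ 𝟙 (Y ⅋ X)) ≫ pairQ e e'
      = pairQ ((f ⊠ₘ 𝟙 X) ≫ e) ((f' ⊠ₘ 𝟙 Y) ≫ e') := by
  rw [← pairQ_natural, pHom_id]

theorem pairQ_right {A X B Y X' Y' : C} (g : X ⟶ X') (g' : Y ⟶ Y') (e : A ⊠ X' ⟶ pUnit C)
    (e' : B ⊠ Y' ⟶ pUnit C) :
    (𝟙 (A ⊠ B) ⊠ₘ (g' ⅋ₘ g)) ≫ pairQ e e'
      = pairQ ((𝟙 A ⊠ₘ g) ≫ e) ((𝟙 B ⊠ₘ g') ≫ e') := by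
  rw [← pairQ_natural, tHom_id]

end PairingNaturality

/-! ### The left dual is a contravariant, tensor-reversing Frobenius functor -/

section LeftDual

variable {C : Type u} [Category.{v} C] [LinDistCat C] [StarAutonomous C]

theorem ld_hom_ext {A Y : C} {f g : Y ⟶ ld A}
    (w : (𝟙 A ⊠ₘ f) ≫ εl A = (𝟙 A ⊠ₘ g) ≫ εl A) : f = g :=
  (isLinearDual_left A).hom_ext_left w

theorem ldPar_hom_ext {A B Y : C} {f g : Y ⟶ ld B ⅋ ld A}
    (w : (𝟙 (A ⊠ B) ⊠ₘ f) ≫ pairQ (εl A) (εl B) = (𝟙 (A ⊠ B) ⊠ₘ g) ≫ pairQ (εl A) (εl B)) :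
    f = g :=
  (isLinearDual_left A).isSeparating.pairQ (isLinearDual_left B) w

/-- The pattern for this section: after pairing, `ldMap` moves a map to the other argument, `ldTens`
becomes `pairP` and `ldPar` is absorbed by `pairQ`, which leaves a law of pairings. -/
theorem ldTens_natural {A B A' B' : C} (f : A ⟶ A') (g : B ⟶ B') :
    (ldMap f ⊠ₘ ldMap g) ≫ ldTens A B = ldTens A' B' ≫ ldMap (g ⅋ₘ f) := by
  apply ld_hom_ext
  simp only [id_tHom_comp, Category.assoc]
  rw [ldTens_pairing, ldMap_pairing, reassoc_of% (tHom_swap (g ⅋ₘ f) (ldTens A' B')),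
    ldTens_pairing, pairP_right, pairP_left, ldMap_pairing, ldMap_pairing]

theorem ldPar_natural {A B A' B' : C} (f : A ⟶ A') (g : B ⟶ B') :
    ldMap (f ⊠ₘ g) ≫ ldPar A B = ldPar A' B' ≫ (ldMap g ⅋ₘ ldMap f) := by
  apply ldPar_hom_ext
  simp only [id_tHom_comp, Category.assoc]
  rw [ldPar_pairing, ldMap_pairing, pairQ_right, ldMap_pairing, ldMap_pairing, ← pairQ_left,
    reassoc_of% (tHom_swap (f ⊠ₘ g) (ldPar A' B')), ldPar_pairing]

theorem ldTens_assoc (A B D : C) :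
    (ldTens A B ⊠ₘ 𝟙 (ld D)) ≫ ldTens (B ⅋ A) D
      = (aT (ld A) (ld B) (ld D)).hom ≫ (𝟙 (ld A) ⊠ₘ ldTens B D) ≫ ldTens A (D ⅋ B) ≫
        ldMap (aP D B A).inv := by
  apply ld_hom_ext
  simp only [id_tHom_comp, Category.assoc]
  rw [ldTens_pairing, ldMap_pairing, reassoc_of% (tHom_swap (aP D B A).inv (ldTens A (D ⅋ B))),
    ldTens_pairing, reassoc_of% (tHom_swap (aP D B A).inv (𝟙 (ld A) ⊠ₘ ldTens B D)),
    pairP_right, pairP_right, ldTens_pairing, ldTens_pairing, tHom_id, tHom_id,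
    Category.id_comp, Category.id_comp,
    reassoc_of% (tHom_swap (aP D B A).inv (aT (ld A) (ld B) (ld D)).hom), ← pairP_assoc,
    ← reassoc_of% tHom_comp_id, Iso.inv_hom_id, tHom_id, Category.id_comp]

theorem ldPar_assoc (A B D : C) :
    ldPar (A ⊠ B) D ≫ (𝟙 (ld D) ⅋ₘ ldPar A B)
      = ldMap (aT A B D).inv ≫ ldPar A (B ⊠ D) ≫ (ldPar B D ⅋ₘ 𝟙 (ld A)) ≫
        (aP (ld D) (ld B) (ld A)).hom := by
  have h := pairQ_assoc (εl D) (εl B) (εl A)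
  -- `pairQ_assoc` with both associators moved to the opposite side.
  have h' : (𝟙 _ ⊠ₘ (aP (ld D) (ld B) (ld A)).hom) ≫ pairQ (pairQ (εl A) (εl B)) (εl D)
      = ((aT A B D).hom ⊠ₘ 𝟙 _) ≫ pairQ (εl A) (pairQ (εl B) (εl D)) := by
    have h₁ := tHom_swap (aT A B D).hom (aP (ld D) (ld B) (ld A)).inv
    rw [← cancel_epi (𝟙 ((A ⊠ B) ⊠ D) ⊠ₘ (aP (ld D) (ld B) (ld A)).inv), reassoc_of% h₁, h,
      ← reassoc_of% id_tHom_comp, ← reassoc_of% tHom_comp_id, Iso.inv_hom_id, Iso.hom_inv_id,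
      tHom_id]
  apply (((isLinearDual_left A).isSeparating.pairQ (isLinearDual_left B)).pairQ
    (isLinearDual_left D))
  simp only [id_tHom_comp, Category.assoc]
  rw [h', pairQ_right, ldPar_pairing, tHom_id, Category.id_comp, ldPar_pairing,
    reassoc_of% (tHom_swap (aT A B D).hom (ldPar B D ⅋ₘ 𝟙 (ld A))), pairQ_right,
    ldPar_pairing, tHom_id, Category.id_comp,
    reassoc_of% (tHom_swap (aT A B D).hom (ldPar A (B ⊠ D))), ldPar_pairing,
    reassoc_of% (tHom_swap (aT A B D).hom (ldMap (aT A B D).inv)), ldMap_pairing,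
    ← reassoc_of% tHom_comp_id, Iso.hom_inv_id, tHom_id, Category.id_comp]

theorem ldTens_pUnit_right (A : C) :
    (𝟙 (ld A) ⊠ₘ ldTop C) ≫ ldTens A (pUnit C) ≫ ldMap (lP A).inv = (rT (ld A)).hom := by
  apply ld_hom_ext
  simp only [id_tHom_comp, Category.assoc]
  rw [ldMap_pairing, reassoc_of% (tHom_swap (lP A).inv (ldTens A (pUnit C))), ldTens_pairing,
    reassoc_of% (tHom_swap (lP A).inv (𝟙 (ld A) ⊠ₘ ldTop C)), pairP_right, ldTop_pairing,
    tHom_id, Category.id_comp, pairP_rT_right, ← Category.assoc, tHom_comp, Iso.inv_hom_id,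
    Category.id_comp]

theorem ldTens_pUnit_left (A : C) :
    (ldTop C ⊠ₘ 𝟙 (ld A)) ≫ ldTens (pUnit C) A ≫ ldMap (rP A).inv = (lT (ld A)).hom := by
  apply ld_hom_ext
  simp only [id_tHom_comp, Category.assoc]
  rw [ldMap_pairing, reassoc_of% (tHom_swap (rP A).inv (ldTens (pUnit C) A)), ldTens_pairing,
    reassoc_of% (tHom_swap (rP A).inv (ldTop C ⊠ₘ 𝟙 (ld A))), pairP_right, ldTop_pairing,
    tHom_id, Category.id_comp, pairP_rT_left, ← Category.assoc, tHom_comp, Iso.inv_hom_id,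
    Category.id_comp]

theorem ldPar_tUnit_left (A : C) :
    ldPar (tUnit C) A ≫ (𝟙 (ld A) ⅋ₘ ldBot C) ≫ (rP (ld A)).hom = ldMap (lT A).inv := by
  apply ld_hom_ext
  have h := pairQ_lT_left (εl A)
  rw [← tHom_right_left, Category.assoc] at h
  have h' : (𝟙 A ⊠ₘ (rP (ld A)).hom) ≫ εl A
      = ((lT A).inv ⊠ₘ 𝟙 _) ≫ pairQ (lT (pUnit C)).hom (εl A) := by
    rw [h, ← reassoc_of% (tHom_swap (lT A).inv (rP (ld A)).hom), ← reassoc_of% tHom_comp_id,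
      Iso.inv_hom_id, tHom_id, Category.id_comp]
  simp only [id_tHom_comp, Category.assoc]
  rw [h', reassoc_of% (tHom_swap (lT A).inv (𝟙 (ld A) ⅋ₘ ldBot C)), pairQ_right,
    ldBot_pairing, tHom_id, Category.id_comp,
    reassoc_of% (tHom_swap (lT A).inv (ldPar (tUnit C) A)), ldPar_pairing, ldMap_pairing]

theorem ldPar_tUnit_right (A : C) :
    ldPar A (tUnit C) ≫ (ldBot C ⅋ₘ 𝟙 (ld A)) ≫ (lP (ld A)).hom = ldMap (rT A).inv := by
  apply ld_hom_ext
  have h := pairQ_lT_right (εl A)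
  rw [← tHom_right_left, Category.assoc] at h
  have h' : (𝟙 A ⊠ₘ (lP (ld A)).hom) ≫ εl A
      = ((rT A).inv ⊠ₘ 𝟙 _) ≫ pairQ (εl A) (lT (pUnit C)).hom := by
    rw [h, ← reassoc_of% (tHom_swap (rT A).inv (lP (ld A)).hom), ← reassoc_of% tHom_comp_id,
      Iso.inv_hom_id, tHom_id, Category.id_comp]
  simp only [id_tHom_comp, Category.assoc]
  rw [h', reassoc_of% (tHom_swap (rT A).inv (ldBot C ⅋ₘ 𝟙 (ld A))), pairQ_right,
    ldBot_pairing, tHom_id, Category.id_comp,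
    reassoc_of% (tHom_swap (rT A).inv (ldPar A (tUnit C))), ldPar_pairing, ldMap_pairing]

theorem ldPar_δR_ldTens (A B E : C) :
    (ldPar B E ⊠ₘ 𝟙 (ld A)) ≫ δR (ld E) (ld B) (ld A) ≫ (𝟙 (ld E) ⅋ₘ ldTens B A)
      = ldTens (B ⊠ E) A ≫ ldMap (δR A B E) ≫ ldPar (A ⅋ B) E := by
  apply ldPar_hom_ext
  simp only [id_tHom_comp, Category.assoc]
  rw [pairQ_right, ldTens_pairing, tHom_id, Category.id_comp, pairQ_pairP,
    reassoc_of% (tHom_swap (δR A B E) (ldPar B E ⊠ₘ 𝟙 (ld A))), pairP_right, ldPar_pairing,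
    tHom_id, Category.id_comp, ldPar_pairing, ldMap_pairing,
    reassoc_of% (tHom_swap (δR A B E) (ldTens (B ⊠ E) A)), ldTens_pairing]

theorem ldPar_δL_ldTens (A B E : C) :
    (𝟙 (ld E) ⊠ₘ ldPar A B) ≫ δL (ld E) (ld B) (ld A) ≫ (ldTens E B ⅋ₘ 𝟙 (ld A))
      = ldTens E (A ⊠ B) ≫ ldMap (δL A B E) ≫ ldPar A (B ⅋ E) := by
  apply ldPar_hom_ext
  simp only [id_tHom_comp, Category.assoc]
  rw [pairQ_right, ldTens_pairing, tHom_id, Category.id_comp, ← pairP_pairQ,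
    reassoc_of% (tHom_swap (δL A B E) (𝟙 (ld E) ⊠ₘ ldPar A B)), pairP_right, ldPar_pairing,
    tHom_id, Category.id_comp, ldPar_pairing, ldMap_pairing,
    reassoc_of% (tHom_swap (δL A B E) (ldTens E (A ⊠ B))), ldTens_pairing]

end LeftDual

/-! ### The unit of a conjugation on a monoidal category -/

section ConjugationUnit

open MonoidalCategory

variable {C : Type u} [Category.{v} C] [MonoidalCategory C] {K : C ⥤ C}
  {χ : ∀ A B : C, K.obj A ⊗ K.obj B ≅ K.obj (B ⊗ A)} {ε : K ⋙ K ≅ 𝟭 C}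

namespace IsConjugation

/-- `K` is full because it is its own quasi-inverse. The preimage is `K g` conjugated by `ε`, and `K
ε = ε K` is what makes `K` send it back to `g`. -/
theorem exists_map_eq (h : IsConjugation K χ ε) {A B : C} (g : K.obj A ⟶ K.obj B) :
    ∃ w : A ⟶ B, K.map w = g := by
  refine ⟨ε.inv.app A ≫ K.map g ≫ ε.hom.app B, ?_⟩
  have h₁ : K.map (ε.inv.app A) = ε.inv.app (K.obj A) := by
    have e₁ : K.map (ε.inv.app A) ≫ K.map (ε.hom.app A) = 𝟙 _ := by
      rw [← K.map_comp, Iso.inv_hom_id_app]; exact K.map_id _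
    have e₂ : ε.inv.app (K.obj A) ≫ ε.hom.app (K.obj A) = 𝟙 _ := Iso.inv_hom_id_app ε _
    rw [← cancel_mono (K.map (ε.hom.app A)), e₁, h.map_ε]; exact e₂.symm
  have h₂ : K.map (K.map g) ≫ ε.hom.app (K.obj B) = ε.hom.app (K.obj A) ≫ g :=
    ε.hom.naturality g
  have e₂ : ε.inv.app (K.obj A) ≫ ε.hom.app (K.obj A) = 𝟙 _ := Iso.inv_hom_id_app ε _
  rw [K.map_comp, K.map_comp, h₁, h.map_ε, h₂, reassoc_of% e₂]

theorem χ_natural_left (h : IsConjugation K χ ε) {A A' : C} (B : C) (f : A ⟶ A') :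
    K.map f ▷ K.obj B ≫ (χ A' B).hom = (χ A B).hom ≫ K.map (B ◁ f) := by
  have := h.χ_natural f (𝟙 B)
  simpa using this

theorem χ_natural_right (h : IsConjugation K χ ε) {B B' : C} (A : C) (f : B ⟶ B') :
    K.obj A ◁ K.map f ≫ (χ A B').hom = (χ A B).hom ≫ K.map (f ▷ A) := by
  have := h.χ_natural (𝟙 A) f
  simpa using this

theorem χ_assoc_whisker (h : IsConjugation K χ ε) (A B D : C) :
    (α_ (K.obj A) (K.obj B) (K.obj D)).hom ≫ K.obj A ◁ (χ B D).hom ≫ (χ A (D ⊗ B)).hom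
      = (χ A B).hom ▷ K.obj D ≫ (χ (B ⊗ A) D).hom ≫ K.map (α_ D B A).inv := by
  have := h.χ_assoc A B D
  simpa using this

/-- The unit is built from `χ`, `ε` and unitors alone, so its left unit law has to be extracted from
the associativity of `χ`. -/
theorem conjUnit_left (h : IsConjugation K χ ε) (A : C) :
    (conjUnit K χ ε).hom ▷ K.obj A ≫ (χ (𝟙_ C) A).hom ≫ K.map (ρ_ A).hom
      = (λ_ (K.obj A)).hom := by
  -- Transported along `χ` and `ε`, the left unitor of `K A` is of the form `K w`, so the naturality
  -- of `χ` and of the right unitor applies to it.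
  obtain ⟨w, hw⟩ := h.exists_map_eq
    ((χ (K.obj (𝟙_ C)) A).inv ≫ (ε.hom.app (𝟙_ C) ▷ K.obj A) ≫ (λ_ (K.obj A)).hom)
  have hw' : (χ (K.obj (𝟙_ C)) A).hom ≫ K.map w
      = (ε.hom.app (𝟙_ C) ▷ K.obj A) ≫ (λ_ (K.obj A)).hom := by
    rw [hw, Iso.hom_inv_id_assoc]
  have n : K.obj (𝟙_ C) ◁ K.map w ≫ (χ (𝟙_ C) A).hom ≫ K.map (ρ_ A).hom
      = (χ (𝟙_ C) (A ⊗ K.obj (𝟙_ C))).hom ≫ K.map (ρ_ (A ⊗ K.obj (𝟙_ C))).hom ≫ K.map w := by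
    rw [reassoc_of% h.χ_natural_right (𝟙_ C) w, ← K.map_comp, ← K.map_comp,
      rightUnitor_naturality]
  have a : (χ (𝟙_ C) (K.obj (𝟙_ C))).hom ▷ K.obj A ≫ K.map (ρ_ (K.obj (𝟙_ C))).hom ▷ K.obj A ≫
        (χ (K.obj (𝟙_ C)) A).hom
      = (α_ _ _ _).hom ≫ K.obj (𝟙_ C) ◁ (χ (K.obj (𝟙_ C)) A).hom ≫
        (χ (𝟙_ C) (A ⊗ K.obj (𝟙_ C))).hom ≫ K.map (ρ_ (A ⊗ K.obj (𝟙_ C))).hom := by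
    rw [reassoc_of% h.χ_assoc_whisker, ← K.map_comp, h.χ_natural_left, rightUnitor_tensor_hom,
      Iso.inv_hom_id_assoc]
  have key : (K.obj (𝟙_ C) ◁ ε.hom.app (𝟙_ C)) ▷ K.obj A ≫ (ρ_ (K.obj (𝟙_ C))).hom ▷ K.obj A ≫
        (χ (𝟙_ C) A).hom ≫ K.map (ρ_ A).hom
      = (χ (𝟙_ C) (K.obj (𝟙_ C))).hom ▷ K.obj A ≫ K.map (ρ_ (K.obj (𝟙_ C))).hom ▷ K.obj A ≫
        (ε.hom.app (𝟙_ C) ▷ K.obj A) ≫ (λ_ (K.obj A)).hom := by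
    rw [← hw', reassoc_of% a, ← n, ← whiskerLeft_comp_assoc, hw', whiskerLeft_comp_assoc,
      ← triangle_assoc, ← associator_naturality_middle_assoc]
    rfl
  have e : ε.inv.app (𝟙_ C) ▷ K.obj A ≫ ε.hom.app (𝟙_ C) ▷ K.obj A = 𝟙 _ := by
    rw [← comp_whiskerRight, Iso.inv_hom_id_app]
    exact id_whiskerRight _ _
  simp only [conjUnit, Iso.trans_hom, Iso.symm_hom, Functor.mapIso_hom, Iso.app_inv,
    whiskerLeftIso_hom, Iso.app_hom, comp_whiskerRight, Category.assoc, key]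
  have e' : K.map (ρ_ (K.obj (𝟙_ C))).inv ▷ K.obj A ≫ K.map (ρ_ (K.obj (𝟙_ C))).hom ▷ K.obj A
      = 𝟙 _ := by
    rw [← comp_whiskerRight, ← K.map_comp, Iso.inv_hom_id, K.map_id, id_whiskerRight]
  rw [inv_hom_whiskerRight_assoc, reassoc_of% e', reassoc_of% e]

/-- Tensoring with an object isomorphic to the unit is faithful. The double conjugate of the unit is
taken because the unit laws control tensoring with objects in the image of `K`. -/
theorem whiskerRight_injective (ε : K ⋙ K ≅ 𝟭 C) {X Y : C} {f g : X ⟶ Y}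
    (w : f ▷ K.obj (K.obj (𝟙_ C)) = g ▷ K.obj (K.obj (𝟙_ C))) : f = g := by
  have e (k : X ⟶ Y) : k ▷ K.obj (K.obj (𝟙_ C)) ≫ Y ◁ ε.hom.app (𝟙_ C) ≫ (ρ_ Y).hom
      = X ◁ ε.hom.app (𝟙_ C) ≫ (ρ_ X).hom ≫ k := by
    rw [← whisker_exchange_assoc]
    exact congrArg (X ◁ ε.hom.app (𝟙_ C) ≫ ·) (rightUnitor_naturality k)
  have := e f
  rw [w, e g, cancel_epi, cancel_epi] at this
  exact this.symm

/-- The classical argument that one unit law implies the other: after tensoring with `K X`,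
associativity and the triangle reduce it to `conjUnit_left`. -/
theorem conjUnit_right (h : IsConjugation K χ ε) (A : C) :
    K.obj A ◁ (conjUnit K χ ε).hom ≫ (χ A (𝟙_ C)).hom ≫ K.map (λ_ A).hom
      = (ρ_ (K.obj A)).hom := by
  suffices H : ∀ X : C, (K.obj A ◁ (conjUnit K χ ε).hom ≫ (χ A (𝟙_ C)).hom ≫
      K.map (λ_ A).hom) ▷ K.obj X = (ρ_ (K.obj A)).hom ▷ K.obj X from
    whiskerRight_injective ε (H _)
  intro X
  have a : (χ A (𝟙_ C)).hom ▷ K.obj X ≫ (χ (𝟙_ C ⊗ A) X).hom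
      = (α_ _ _ _).hom ≫ K.obj A ◁ (χ (𝟙_ C) X).hom ≫ (χ A (X ⊗ 𝟙_ C)).hom ≫
        K.map (α_ X (𝟙_ C) A).hom := by
    rw [reassoc_of% h.χ_assoc_whisker, ← K.map_comp, Iso.inv_hom_id, K.map_id, Category.comp_id]
  rw [← cancel_mono (χ A X).hom]
  simp only [comp_whiskerRight, Category.assoc]
  rw [h.χ_natural_left, reassoc_of% a, ← K.map_comp, triangle, ← h.χ_natural_right,
    associator_naturality_middle_assoc, ← whiskerLeft_comp_assoc, ← whiskerLeft_comp_assoc,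
    Category.assoc, h.conjUnit_left, triangle_assoc]

/-- The nullary form of `χ_ε`. It follows from `χ_ε` at two units, with the conjugated right unit
law and then the left unit law collapsing the two laxors. -/
theorem conjUnit_comp_map (h : IsConjugation K χ ε) :
    (conjUnit K χ ε).hom ≫ K.map (conjUnit K χ ε).hom ≫ ε.hom.app (𝟙_ C) = 𝟙 (𝟙_ C) := by
  apply whiskerRight_injective ε
  have hε := h.χ_ε (𝟙_ C) (𝟙_ C)
  have nε : K.map (K.map (λ_ (𝟙_ C)).hom) ≫ ε.hom.app (𝟙_ C)
      = ε.hom.app (𝟙_ C ⊗ 𝟙_ C) ≫ (λ_ (𝟙_ C)).hom := ε.hom.naturality _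
  have nl : 𝟙_ C ◁ ε.hom.app (𝟙_ C) ≫ (λ_ (𝟙_ C)).hom = (λ_ _).hom ≫ ε.hom.app (𝟙_ C) :=
    leftUnitor_naturality _
  have key : (ε.hom.app (𝟙_ C) ⊗ₘ ε.hom.app (𝟙_ C)) ≫ (λ_ (𝟙_ C)).hom
      = ε.hom.app (𝟙_ C) ▷ _ ≫ 𝟙_ C ◁ ε.hom.app (𝟙_ C) ≫ (λ_ (𝟙_ C)).hom := by
    rw [MonoidalCategory.tensorHom_def, Category.assoc]
    rfl
  rw [← cancel_mono (𝟙_ C ◁ ε.hom.app (𝟙_ C) ≫ (λ_ (𝟙_ C)).hom)]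
  simp only [comp_whiskerRight, Category.assoc, id_whiskerRight]
  have r := congrArg (fun k => K.map k) (h.conjUnit_right (𝟙_ C))
  simp only [K.map_comp] at r
  have step : K.map (conjUnit K χ ε).hom ▷ K.obj (K.obj (𝟙_ C)) ≫
      (ε.hom.app (𝟙_ C) ⊗ₘ ε.hom.app (𝟙_ C)) ≫ (λ_ (𝟙_ C)).hom
      = (χ (𝟙_ C) (K.obj (𝟙_ C))).hom ≫ K.map (ρ_ (K.obj (𝟙_ C))).hom ≫ ε.hom.app (𝟙_ C) := by
    rw [← hε]
    simp only [Category.assoc]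
    rw [← nε, reassoc_of% h.χ_natural_left, reassoc_of% r]
  erw [← key, step]
  rw [reassoc_of% h.conjUnit_left]
  erw [Category.id_comp, nl]
  rfl

end IsConjugation

end ConjugationUnit

/-! ### Conjugation of pairings -/

namespace Conjugation

/-! ### Laws of a conjugation for tensor and par -/

section Coherence

variable {C : Type u} [Category.{v} C] [LinDistCat C] (J : Conjugation C)

theorem χT_natural {A A' B B' : C} (f : A ⟶ A') (g : B ⟶ B') :
    (J.K.map f ⊠ₘ J.K.map g) ≫ (J.χT A' B').hom = (J.χT A B).hom ≫ J.K.map (g ⊠ₘ f) :=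
  @IsConjugation.χ_natural C _ TwoMonoidal.tens _ _ _ J.isConjugation_tens _ _ _ _ f g

theorem χT_natural_left {A A' : C} (B : C) (f : A ⟶ A') :
    (J.K.map f ⊠ₘ 𝟙 (J.K.obj B)) ≫ (J.χT A' B).hom = (J.χT A B).hom ≫ J.K.map (𝟙 B ⊠ₘ f) := by
  rw [← J.χT_natural, J.K.map_id]

theorem χT_natural_right {B B' : C} (A : C) (g : B ⟶ B') :
    (𝟙 (J.K.obj A) ⊠ₘ J.K.map g) ≫ (J.χT A B').hom = (J.χT A B).hom ≫ J.K.map (g ⊠ₘ 𝟙 A) := by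
  rw [← J.χT_natural, J.K.map_id]

/-- The conjugation axioms concern the laxor `χP⁻¹`; inverting them gives the colaxor form used
below. -/
theorem χP_natural {A A' B B' : C} (f : A ⟶ A') (g : B ⟶ B') :
    J.K.map (f ⅋ₘ g) ≫ (J.χP A' B').hom = (J.χP A B).hom ≫ (J.K.map g ⅋ₘ J.K.map f) := by
  have h : (J.K.map g ⅋ₘ J.K.map f) ≫ (J.χP A' B').inv = (J.χP A B).inv ≫ J.K.map (f ⅋ₘ g) :=
    @IsConjugation.χ_natural C _ TwoMonoidal.par _ _ _ J.isConjugation_par _ _ _ _ g f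
  rw [Iso.eq_inv_comp, ← Category.assoc, Iso.comp_inv_eq] at h
  exact h.symm

theorem χP_natural_left {A A' : C} (B : C) (f : A ⟶ A') :
    J.K.map (f ⅋ₘ 𝟙 B) ≫ (J.χP A' B).hom = (J.χP A B).hom ≫ (𝟙 (J.K.obj B) ⅋ₘ J.K.map f) := by
  rw [J.χP_natural, J.K.map_id]

theorem χP_natural_right {B B' : C} (A : C) (g : B ⟶ B') :
    J.K.map (𝟙 A ⅋ₘ g) ≫ (J.χP A B').hom = (J.χP A B).hom ≫ (J.K.map g ⅋ₘ 𝟙 (J.K.obj A)) := by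
  rw [J.χP_natural, J.K.map_id]

theorem χT_assoc (A B D : C) :
    (aT (J.K.obj A) (J.K.obj B) (J.K.obj D)).hom ≫ (𝟙 (J.K.obj A) ⊠ₘ (J.χT B D).hom) ≫
        (J.χT A (D ⊠ B)).hom
      = ((J.χT A B).hom ⊠ₘ 𝟙 (J.K.obj D)) ≫ (J.χT (B ⊠ A) D).hom ≫ J.K.map (aT D B A).inv :=
  @IsConjugation.χ_assoc C _ TwoMonoidal.tens _ _ _ J.isConjugation_tens A B D

theorem χP_assoc (A B D : C) :
    (J.χP D (B ⅋ A)).hom ≫ ((J.χP B A).hom ⅋ₘ 𝟙 (J.K.obj D)) ≫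
        (aP (J.K.obj A) (J.K.obj B) (J.K.obj D)).hom
      = J.K.map (aP D B A).inv ≫ (J.χP (D ⅋ B) A).hom ≫ (𝟙 (J.K.obj A) ⅋ₘ (J.χP D B).hom) := by
  have h : (aP (J.K.obj A) (J.K.obj B) (J.K.obj D)).hom ≫
        (pIso (Iso.refl (J.K.obj A)) (J.χP D B)).inv ≫ (J.χP (D ⅋ B) A).inv
      = (pIso (J.χP B A) (Iso.refl (J.K.obj D))).inv ≫ (J.χP D (B ⅋ A)).inv ≫
          J.K.map (aP D B A).inv :=
    @IsConjugation.χ_assoc C _ TwoMonoidal.par _ _ _ J.isConjugation_par A B D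
  rw [Iso.eq_inv_comp, Iso.eq_inv_comp, ← Category.assoc, ← Category.assoc, ← Category.assoc,
    Iso.comp_inv_eq, Iso.comp_inv_eq] at h
  simpa only [Category.assoc, Iso.refl_hom] using h

theorem unitT_left (A : C) :
    (J.unitT.hom ⊠ₘ 𝟙 (J.K.obj A)) ≫ (J.χT (tUnit C) A).hom ≫ J.K.map (rT A).hom
      = (lT (J.K.obj A)).hom :=
  (congrArg (· ≫ (J.χT (tUnit C) A).hom ≫ J.K.map (rT A).hom)
    (TwoMonoidal.tens.tensorHom_id _ _)).trans
    (@IsConjugation.conjUnit_left C _ TwoMonoidal.tens _ _ _ J.isConjugation_tens A)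

theorem unitT_right (A : C) :
    (𝟙 (J.K.obj A) ⊠ₘ J.unitT.hom) ≫ (J.χT A (tUnit C)).hom ≫ J.K.map (lT A).hom
      = (rT (J.K.obj A)).hom :=
  (congrArg (· ≫ (J.χT A (tUnit C)).hom ≫ J.K.map (lT A).hom)
    (TwoMonoidal.tens.id_tensorHom _ _)).trans
    (@IsConjugation.conjUnit_right C _ TwoMonoidal.tens _ _ _ J.isConjugation_tens A)

theorem unitT_comp_map : J.unitT.hom ≫ J.K.map J.unitT.hom ≫ J.ε.hom.app (tUnit C) = 𝟙 _ :=
  @IsConjugation.conjUnit_comp_map C _ TwoMonoidal.tens _ _ _ J.isConjugation_tens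

theorem unitP_comp_map : J.unitP.hom ≫ J.K.map J.unitP.hom ≫ J.ε.hom.app (pUnit C) = 𝟙 _ :=
  @IsConjugation.conjUnit_comp_map C _ TwoMonoidal.par _ _ _ J.isConjugation_par

theorem unitP_left (A : C) :
    (J.χP A (pUnit C)).hom ≫ (J.unitP.inv ⅋ₘ 𝟙 (J.K.obj A)) ≫ (lP (J.K.obj A)).hom
      = J.K.map (rP A).hom := by
  have h : (pIso J.unitP (Iso.refl (J.K.obj A))).hom ≫ (J.χP A (pUnit C)).inv ≫ J.K.map (rP A).hom
      = (lP (J.K.obj A)).hom :=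
    (congrArg (· ≫ (J.χP A (pUnit C)).inv ≫ J.K.map (rP A).hom)
      (TwoMonoidal.par.tensorHom_id _ _)).trans
      (@IsConjugation.conjUnit_left C _ TwoMonoidal.par _ _ _ J.isConjugation_par A)
  rw [← Iso.eq_inv_comp, Iso.inv_comp_eq] at h
  exact h.symm

theorem unitP_right (A : C) :
    (J.χP (pUnit C) A).hom ≫ (𝟙 (J.K.obj A) ⅋ₘ J.unitP.inv) ≫ (rP (J.K.obj A)).hom
      = J.K.map (lP A).hom := by
  have h : (pIso (Iso.refl (J.K.obj A)) J.unitP).hom ≫ (J.χP (pUnit C) A).inv ≫ J.K.map (lP A).hom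
      = (rP (J.K.obj A)).hom :=
    (congrArg (· ≫ (J.χP (pUnit C) A).inv ≫ J.K.map (lP A).hom)
      (TwoMonoidal.par.id_tensorHom _ _)).trans
      (@IsConjugation.conjUnit_right C _ TwoMonoidal.par _ _ _ J.isConjugation_par A)
  rw [← Iso.eq_inv_comp, Iso.inv_comp_eq] at h
  exact h.symm

theorem χT_ε (A B : C) :
    (J.χT (J.K.obj A) (J.K.obj B)).hom ≫ J.K.map (J.χT B A).hom ≫ J.ε.hom.app (A ⊠ B)
      = J.ε.hom.app A ⊠ₘ J.ε.hom.app B :=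
  @IsConjugation.χ_ε C _ TwoMonoidal.tens _ _ _ J.isConjugation_tens A B

theorem χP_ε (A B : C) :
    J.K.map (J.χP A B).hom ≫ (J.χP (J.K.obj B) (J.K.obj A)).hom ≫
        (J.ε.hom.app A ⅋ₘ J.ε.hom.app B) = J.ε.hom.app (A ⅋ B) := by
  have h : (J.χP (J.K.obj B) (J.K.obj A)).inv ≫ (J.K.mapIso (J.χP A B)).inv ≫ J.ε.hom.app (A ⅋ B)
      = J.ε.hom.app A ⅋ₘ J.ε.hom.app B :=
    @IsConjugation.χ_ε C _ TwoMonoidal.par _ _ _ J.isConjugation_par A B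
  rw [Iso.inv_comp_eq, Iso.inv_comp_eq] at h
  exact h.symm

theorem ε_natural {A B : C} (f : A ⟶ B) :
    J.K.map (J.K.map f) ≫ J.ε.hom.app B = J.ε.hom.app A ≫ f := J.ε.hom.naturality f

theorem map_ε (A : C) : J.K.map (J.ε.hom.app A) = J.ε.hom.app (J.K.obj A) :=
  @IsConjugation.map_ε C _ TwoMonoidal.tens _ _ _ J.isConjugation_tens A

end Coherence

/-! ### Conjugate pairings -/

section Pairings

variable {C : Type u} [Category.{v} C] [LinDistCat C] (J : Conjugation C)

/-- The conjugate of the counit of a linear dual. -/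
def conjε {A X : C} (e : A ⊠ X ⟶ pUnit C) : J.K.obj X ⊠ J.K.obj A ⟶ pUnit C :=
  (J.χT X A).hom ≫ J.K.map e ≫ J.unitP.inv

theorem conjε_natural {A X A' X' : C} (f : A ⟶ A') (g : X ⟶ X') (e : A' ⊠ X' ⟶ pUnit C) :
    (J.K.map g ⊠ₘ J.K.map f) ≫ J.conjε e = J.conjε ((f ⊠ₘ g) ≫ e) := by
  simp only [conjε, reassoc_of% J.χT_natural, J.K.map_comp, Category.assoc]

theorem conjε_conjε {A X : C} (e : A ⊠ X ⟶ pUnit C) :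
    J.conjε (J.conjε e) = (J.ε.hom.app A ⊠ₘ J.ε.hom.app X) ≫ e := by
  -- A rearrangement of `unitP_comp_map`: the two unit isomorphisms introduced by conjugating twice
  -- amount to `ε` at `⊥`.
  have u : J.K.map J.unitP.inv ≫ J.unitP.inv = J.ε.hom.app (pUnit C) := by
    have h := J.unitP_comp_map
    rw [← Iso.eq_inv_comp, Category.comp_id] at h
    have h' : J.K.map J.unitP.inv ≫ J.K.map J.unitP.hom = 𝟙 _ := by
      rw [← J.K.map_comp, Iso.inv_hom_id, J.K.map_id]
    exact (congrArg (J.K.map J.unitP.inv ≫ ·) h.symm).trans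
      ((Category.assoc _ _ _).symm.trans ((congrArg (· ≫ J.ε.hom.app (pUnit C)) h').trans
        (Category.id_comp _)))
  rw [← χT_ε]
  simp only [Category.assoc]
  rw [← J.ε_natural e, conjε, conjε]
  simp only [J.K.map_comp, Category.assoc]
  rw [u]

/-- Conjugation exchanges the two distributors (`χ_δL`), hence also left and right contraction. -/
theorem χP_capR {B Y : C} (X : C) (e : B ⊠ Y ⟶ pUnit C) :
    ((J.χP Y X).hom ⊠ₘ 𝟙 (J.K.obj B)) ≫ capR (J.K.obj X) (J.conjε e)
      = (J.χT (Y ⅋ X) B).hom ≫ J.K.map (capL X e) := by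
  simp only [capR, capL, conjε, id_pHom_comp, J.K.map_comp, Category.assoc]
  rw [reassoc_of% (J.χ_δL B Y X), ← reassoc_of% J.χP_natural_left, unitP_right]

theorem χP_capL {A X : C} (B : C) (e : A ⊠ X ⟶ pUnit C) :
    (𝟙 (J.K.obj X) ⊠ₘ (J.χP B A).hom) ≫ capL (J.K.obj B) (J.conjε e)
      = (J.χT X (B ⅋ A)).hom ≫ J.K.map (capR B e) := by
  simp only [capR, capL, conjε, pHom_comp_id, J.K.map_comp, Category.assoc]
  rw [reassoc_of% (J.χ_δR X A B), ← reassoc_of% J.χP_natural_right, unitP_left]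

theorem pairP_conjε {A X B Y : C} (e : A ⊠ X ⟶ pUnit C) (e' : B ⊠ Y ⟶ pUnit C) :
    ((J.χP Y X).hom ⊠ₘ 𝟙 _) ≫ pairP (J.conjε e') (J.conjε e)
      = (𝟙 _ ⊠ₘ (J.χT B A).hom) ≫ J.conjε (pairQ e e') := by
  have n := aT_inv_natural (J.χP Y X).hom (𝟙 (J.K.obj B)) (𝟙 (J.K.obj A))
  rw [tHom_id] at n
  have a := J.χT_assoc (Y ⅋ X) B A
  rw [← Iso.eq_inv_comp] at a
  rw [pairP, reassoc_of% n, ← reassoc_of% tHom_comp_id, χP_capR, tHom_comp_id]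
  simp only [conjε, pairQ, J.K.map_comp, Category.assoc]
  rw [reassoc_of% J.χT_natural_left, reassoc_of% a, ← J.K.map_comp_assoc (aT _ _ _).inv,
    Iso.inv_hom_id, J.K.map_id, Category.id_comp]

theorem pairQ_conjε {A X B Y : C} (e : A ⊠ X ⟶ pUnit C) (e' : B ⊠ Y ⟶ pUnit C) :
    (𝟙 _ ⊠ₘ (J.χP B A).hom) ≫ pairQ (J.conjε e') (J.conjε e)
      = ((J.χT Y X).hom ⊠ₘ 𝟙 _) ≫ J.conjε (pairP e e') := by
  have n := aT_natural (𝟙 (J.K.obj Y)) (𝟙 (J.K.obj X)) (J.χP B A).hom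
  rw [tHom_id] at n
  rw [pairQ, reassoc_of% n, ← reassoc_of% id_tHom_comp, χP_capL, id_tHom_comp]
  simp only [conjε, pairP, J.K.map_comp, Category.assoc]
  rw [reassoc_of% J.χT_natural_right, reassoc_of% (J.χT_assoc Y X (B ⅋ A))]

end Pairings

end Conjugation

/-! ### Conjugation preserves dual pairs -/

section

variable {C : Type u} [Category.{v} C] [LinDistCat C]

/-- As `K` reverses both products, each snake equation of the conjugate pair is `K` applied to the
other snake equation of the original pair. -/
theorem IsLinearDual.conj {A B : C} {η : tUnit C ⟶ B ⅋ A} {e : A ⊠ B ⟶ pUnit C}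
    (h : IsLinearDual η e) (J : Conjugation C) : IsLinearDual (J.conjη η) (J.conjε e) where
  snake_left := by
    have s : J.K.map (rT A).inv ≫ J.K.map (𝟙 A ⊠ₘ η) ≫ J.K.map (capL A e) = 𝟙 _ := by
      rw [← J.K.map_comp, ← J.K.map_comp, capL, h.snake_right, J.K.map_id]
    have c : (lT (J.K.obj A)).inv ≫ (J.unitT.hom ⊠ₘ 𝟙 (J.K.obj A)) ≫ (J.χT (tUnit C) A).hom
        = J.K.map (rT A).inv := by
      rw [Iso.inv_comp_eq, ← J.unitT_left]
      simp only [Category.assoc]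
      rw [← J.K.map_comp, Iso.hom_inv_id, J.K.map_id, Category.comp_id]
    change (lT _).inv ≫ (J.conjη η ⊠ₘ 𝟙 _) ≫ capR (J.K.obj A) (J.conjε e) = 𝟙 _
    simp only [Conjugation.conjη, tHom_comp_id, Category.assoc]
    rw [J.χP_capR, reassoc_of% J.χT_natural_left, reassoc_of% c, s]
  snake_right := by
    have s : J.K.map (lT B).inv ≫ J.K.map (η ⊠ₘ 𝟙 B) ≫ J.K.map (capR B e) = 𝟙 _ := by
      rw [← J.K.map_comp, ← J.K.map_comp, capR, h.snake_left, J.K.map_id]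
    have c : (rT (J.K.obj B)).inv ≫ (𝟙 (J.K.obj B) ⊠ₘ J.unitT.hom) ≫ (J.χT B (tUnit C)).hom
        = J.K.map (lT B).inv := by
      rw [Iso.inv_comp_eq, ← J.unitT_right]
      simp only [Category.assoc]
      rw [← J.K.map_comp, Iso.hom_inv_id, J.K.map_id, Category.comp_id]
    change (rT _).inv ≫ (𝟙 _ ⊠ₘ J.conjη η) ≫ capL (J.K.obj B) (J.conjε e) = 𝟙 _
    simp only [Conjugation.conjη, id_tHom_comp, Category.assoc]
    rw [J.χP_capL, reassoc_of% J.χT_natural_right, reassoc_of% c, s]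

end

/-! ### Frobenius linear functors -/

namespace FrobeniusData

/-- The axioms of a Frobenius linear functor. -/
structure IsFrobenius {C : Type u} [Category.{v} C] [LinDistCat C]
    {D : Type u'} [Category.{v'} D] [LinDistCat D] (F : FrobeniusData C D) : Prop where
  mT_natural {A A' B B' : C} (f : A ⟶ A') (g : B ⟶ B') :
    (F.F.map f ⊠ₘ F.F.map g) ≫ F.mT A' B' = F.mT A B ≫ F.F.map (f ⊠ₘ g)
  nP_natural {A A' B B' : C} (f : A ⟶ A') (g : B ⟶ B') :
    F.F.map (f ⅋ₘ g) ≫ F.nP A' B' = F.nP A B ≫ (F.F.map f ⅋ₘ F.F.map g)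
  mT_assoc (A B E : C) :
    (F.mT A B ⊠ₘ 𝟙 (F.F.obj E)) ≫ F.mT (A ⊠ B) E ≫ F.F.map (aT A B E).hom
      = (aT (F.F.obj A) (F.F.obj B) (F.F.obj E)).hom ≫ (𝟙 (F.F.obj A) ⊠ₘ F.mT B E) ≫
        F.mT A (B ⊠ E)
  mT_left_unit (A : C) :
    (F.mU ⊠ₘ 𝟙 (F.F.obj A)) ≫ F.mT (tUnit C) A ≫ F.F.map (lT A).hom = (lT (F.F.obj A)).hom
  mT_right_unit (A : C) :
    (𝟙 (F.F.obj A) ⊠ₘ F.mU) ≫ F.mT A (tUnit C) ≫ F.F.map (rT A).hom = (rT (F.F.obj A)).hom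
  nP_assoc (A B E : C) :
    F.nP (A ⅋ B) E ≫ (F.nP A B ⅋ₘ 𝟙 (F.F.obj E)) ≫
        (aP (F.F.obj A) (F.F.obj B) (F.F.obj E)).hom
      = F.F.map (aP A B E).hom ≫ F.nP A (B ⅋ E) ≫ (𝟙 (F.F.obj A) ⅋ₘ F.nP B E)
  nP_left_unit (A : C) :
    F.nP (pUnit C) A ≫ (F.nU ⅋ₘ 𝟙 (F.F.obj A)) ≫ (lP (F.F.obj A)).hom = F.F.map (lP A).hom
  nP_right_unit (A : C) :
    F.nP A (pUnit C) ≫ (𝟙 (F.F.obj A) ⅋ₘ F.nU) ≫ (rP (F.F.obj A)).hom = F.F.map (rP A).hom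
  δL (A B E : C) :
    (𝟙 (F.F.obj A) ⊠ₘ F.nP B E) ≫ LinDistCat.δL (F.F.obj A) (F.F.obj B) (F.F.obj E) ≫
        (F.mT A B ⅋ₘ 𝟙 (F.F.obj E))
      = F.mT A (B ⅋ E) ≫ F.F.map (LinDistCat.δL A B E) ≫ F.nP (A ⊠ B) E
  δR (A B E : C) :
    (F.nP B E ⊠ₘ 𝟙 (F.F.obj A)) ≫ LinDistCat.δR (F.F.obj B) (F.F.obj E) (F.F.obj A) ≫
        (𝟙 (F.F.obj B) ⅋ₘ F.mT E A)
      = F.mT (B ⅋ E) A ≫ F.F.map (LinDistCat.δR B E A) ≫ F.nP B (E ⊠ A)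

namespace IsFrobenius

section

variable {C : Type u} [Category.{v} C] [LinDistCat C] {D : Type u'} [Category.{v'} D] [LinDistCat D]
  {F : FrobeniusData C D}

/-- The inverted laws serve two purposes: the strength axioms use inverse unitors, and passing to
the opposite inverts the structure isomorphisms. -/
theorem mT_left_unit_inv (h : F.IsFrobenius) (A : C) :
    (lT (F.F.obj A)).inv ≫ (F.mU ⊠ₘ 𝟙 (F.F.obj A)) ≫ F.mT (tUnit C) A = F.F.map (lT A).inv := by
  rw [Iso.inv_comp_eq, ← h.mT_left_unit]
  simp only [Category.assoc]
  rw [← F.F.map_comp, Iso.hom_inv_id, F.F.map_id, Category.comp_id]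

theorem mT_right_unit_inv (h : F.IsFrobenius) (A : C) :
    (rT (F.F.obj A)).inv ≫ (𝟙 (F.F.obj A) ⊠ₘ F.mU) ≫ F.mT A (tUnit C) = F.F.map (rT A).inv := by
  rw [Iso.inv_comp_eq, ← h.mT_right_unit]
  simp only [Category.assoc]
  rw [← F.F.map_comp, Iso.hom_inv_id, F.F.map_id, Category.comp_id]

theorem nP_left_unit_inv (h : F.IsFrobenius) (A : C) :
    (F.F.map (lP A).inv ≫ F.nP (pUnit C) A) ≫ (F.nU ⅋ₘ 𝟙 (F.F.obj A)) = (lP (F.F.obj A)).inv := by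
  rw [← Iso.comp_hom_eq_id]
  simp only [Category.assoc]
  rw [h.nP_left_unit, ← F.F.map_comp, Iso.inv_hom_id, F.F.map_id]

theorem nP_right_unit_inv (h : F.IsFrobenius) (A : C) :
    (F.F.map (rP A).inv ≫ F.nP A (pUnit C)) ≫ (𝟙 (F.F.obj A) ⅋ₘ F.nU) = (rP (F.F.obj A)).inv := by
  rw [← Iso.comp_hom_eq_id]
  simp only [Category.assoc]
  rw [h.nP_right_unit, ← F.F.map_comp, Iso.inv_hom_id, F.F.map_id]

theorem mT_assoc_inv (h : F.IsFrobenius) (A B E : C) :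
    (aT (F.F.obj A) (F.F.obj B) (F.F.obj E)).inv ≫ (F.mT A B ⊠ₘ 𝟙 (F.F.obj E)) ≫ F.mT (A ⊠ B) E
      = ((𝟙 (F.F.obj A) ⊠ₘ F.mT B E) ≫ F.mT A (B ⊠ E)) ≫ F.F.map (aT A B E).inv := by
  rw [Iso.inv_comp_eq, ← Category.assoc, ← h.mT_assoc]
  simp only [Category.assoc]
  rw [← F.F.map_comp, Iso.hom_inv_id, F.F.map_id, Category.comp_id]

theorem nP_assoc_inv (h : F.IsFrobenius) (A B E : C) :
    (F.F.map (aP A B E).inv ≫ F.nP (A ⅋ B) E) ≫ (F.nP A B ⅋ₘ 𝟙 (F.F.obj E))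
      = (F.nP A (B ⅋ E) ≫ (𝟙 (F.F.obj A) ⅋ₘ F.nP B E)) ≫
        (aP (F.F.obj A) (F.F.obj B) (F.F.obj E)).inv := by
  rw [Iso.eq_comp_inv]
  simp only [Category.assoc]
  rw [h.nP_assoc, ← F.F.map_comp_assoc, Iso.inv_hom_id, F.F.map_id, Category.id_comp]

/-- With equal components and the laxor and colaxor as strengths, the axioms of a linear functor
collapse to the ten of `IsFrobenius`. -/
theorem toLinear (h : F.IsFrobenius) : F.toLinear.IsLinear where
  mT_natural := h.mT_natural
  nP_natural := h.nP_natural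
  νtR_natural := h.nP_natural
  νtL_natural := h.nP_natural
  νpR_natural := h.mT_natural
  νpL_natural := h.mT_natural
  mT_assoc := h.mT_assoc
  mT_left_unit := h.mT_left_unit
  mT_right_unit := h.mT_right_unit
  nP_assoc := h.nP_assoc
  nP_left_unit := h.nP_left_unit
  nP_right_unit := h.nP_right_unit
  νtR_unit := h.nP_left_unit
  νtL_unit := h.nP_right_unit
  νpR_unit := h.mT_left_unit_inv
  νpL_unit := h.mT_right_unit_inv
  νtR_assoc A B E := (h.nP_assoc A B E).symm
  νtL_assoc A B E := (h.nP_assoc A B E).symm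
  νpR_assoc := h.mT_assoc
  νpL_assoc := h.mT_assoc
  νtR_νtL A B E := (h.nP_assoc A B E).symm
  νpR_νpL := h.mT_assoc
  δL_νtR := h.δL
  δR_νtL := h.δR
  δL_νpL := h.δL
  δR_νpR := h.δR
  δL_νtL := h.δL
  δR_νtR := h.δR
  δL_νpR := h.δL
  δR_νpL := h.δR

end

variable {C : Type u} [Category.{v} C] [LinDistCat C] {D : Type u'} [Category.{v'} D] [LinDistCat D]
  {F : FrobeniusData Cᵒᵖ D}

/-- The opposite of a contravariant Frobenius linear functor. -/
def _root_.FrobeniusData.rightOp (F : FrobeniusData Cᵒᵖ D) : FrobeniusData C Dᵒᵖ where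
  F := F.F.rightOp
  mT A B := (F.nP (op A) (op B)).op
  mU := F.nU.op
  nP A B := (F.mT (op A) (op B)).op
  nU := F.mU.op

/-- Taking opposites exchanges the laws of the laxor with those of the colaxor, and the two
Frobenius laws with each other. -/
theorem rightOp (h : F.IsFrobenius) : F.rightOp.IsFrobenius where
  mT_natural f g := Quiver.Hom.unop_inj (h.nP_natural f.op g.op).symm
  nP_natural f g := Quiver.Hom.unop_inj (h.mT_natural f.op g.op).symm
  mT_assoc A B E := Quiver.Hom.unop_inj (h.nP_assoc_inv (op A) (op B) (op E))
  mT_left_unit A := Quiver.Hom.unop_inj (h.nP_left_unit_inv (op A))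
  mT_right_unit A := Quiver.Hom.unop_inj (h.nP_right_unit_inv (op A))
  nP_assoc A B E := Quiver.Hom.unop_inj
    ((Category.assoc _ _ _).trans (h.mT_assoc_inv (op A) (op B) (op E)))
  nP_left_unit A := Quiver.Hom.unop_inj
    ((Category.assoc _ _ _).trans (h.mT_left_unit_inv (op A)))
  nP_right_unit A := Quiver.Hom.unop_inj
    ((Category.assoc _ _ _).trans (h.mT_right_unit_inv (op A)))
  δL A B E := Quiver.Hom.unop_inj ((Category.assoc _ _ _).trans
    ((h.δR (op E) (op A) (op B)).trans (Category.assoc _ _ _).symm))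
  δR A B E := Quiver.Hom.unop_inj ((Category.assoc _ _ _).trans
    ((h.δL (op B) (op E) (op A)).trans (Category.assoc _ _ _).symm))

theorem toLinear_rightOp (h : F.IsFrobenius) : F.toLinear.rightOp.IsLinear :=
  h.rightOp.toLinear

end IsFrobenius

end FrobeniusData

/-! ### The dagger functor -/

namespace Conjugation

variable {C : Type u} [Category.{v} C] [LinDistCat C] [StarAutonomous C] (J : Conjugation C)

/-- Each axiom combines the corresponding law of `K` with the image under `K` of a law of the left
dual. -/
theorem isFrobenius_daggerData : J.daggerData.IsFrobenius where
  mT_natural {A A' B B'} f g := by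
    change (J.K.map (ldMap f.unop) ⊠ₘ J.K.map (ldMap g.unop)) ≫
        (J.χT (ld A'.unop) (ld B'.unop)).hom ≫ J.K.map (ldTens B'.unop A'.unop)
      = ((J.χT (ld A.unop) (ld B.unop)).hom ≫ J.K.map (ldTens B.unop A.unop)) ≫
        J.K.map (ldMap (f.unop ⅋ₘ g.unop))
    rw [reassoc_of% J.χT_natural, ← J.K.map_comp, ldTens_natural, J.K.map_comp, Category.assoc]
  nP_natural {A A' B B'} f g := by
    change J.K.map (ldMap (f.unop ⊠ₘ g.unop)) ≫ J.K.map (ldPar A'.unop B'.unop) ≫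
        (J.χP (ld B'.unop) (ld A'.unop)).hom
      = (J.K.map (ldPar A.unop B.unop) ≫ (J.χP (ld B.unop) (ld A.unop)).hom) ≫
        (J.K.map (ldMap f.unop) ⅋ₘ J.K.map (ldMap g.unop))
    rw [Category.assoc, ← J.χP_natural, ← J.K.map_comp_assoc, ldPar_natural, J.K.map_comp_assoc]
  mT_assoc := by
    rintro ⟨A⟩ ⟨B⟩ ⟨E⟩
    -- The tensor associator of `Cᵒᵖ` is the inverse par associator of `C`.
    change (((J.χT (ld A) (ld B)).hom ≫ J.K.map (ldTens B A)) ⊠ₘ 𝟙 (J.K.obj (ld E))) ≫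
        ((J.χT (ld (A ⅋ B)) (ld E)).hom ≫ J.K.map (ldTens E (A ⅋ B))) ≫
          J.K.map (ldMap (aP A B E).inv)
      = (aT (J.K.obj (ld A)) (J.K.obj (ld B)) (J.K.obj (ld E))).hom ≫
        (𝟙 (J.K.obj (ld A)) ⊠ₘ ((J.χT (ld B) (ld E)).hom ≫ J.K.map (ldTens E B))) ≫
          (J.χT (ld A) (ld (B ⅋ E))).hom ≫ J.K.map (ldTens (B ⅋ E) A)
    simp only [tHom_comp_id, id_tHom_comp, Category.assoc]
    rw [reassoc_of% J.χT_natural_left, reassoc_of% J.χT_natural_right,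
      reassoc_of% J.χT_assoc, ← J.K.map_comp (ldTens E B ⊠ₘ _), ldTens_assoc E B A]
    simp only [J.K.map_comp]
    rw [← J.K.map_comp_assoc (aT _ _ _).inv, Iso.inv_hom_id, J.K.map_id, Category.id_comp]
  mT_left_unit := by
    rintro ⟨A⟩
    change ((J.unitT.hom ≫ J.K.map (ldTop C)) ⊠ₘ 𝟙 (J.K.obj (ld A))) ≫
        ((J.χT (ld (pUnit C)) (ld A)).hom ≫ J.K.map (ldTens A (pUnit C))) ≫
          J.K.map (ldMap (lP A).inv) = (lT (J.K.obj (ld A))).hom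
    simp only [tHom_comp_id, Category.assoc]
    rw [reassoc_of% J.χT_natural_left, ← J.K.map_comp, ← J.K.map_comp, ldTens_pUnit_right,
      J.unitT_left]
  mT_right_unit := by
    rintro ⟨A⟩
    change (𝟙 (J.K.obj (ld A)) ⊠ₘ (J.unitT.hom ≫ J.K.map (ldTop C))) ≫
        ((J.χT (ld A) (ld (pUnit C))).hom ≫ J.K.map (ldTens (pUnit C) A)) ≫
          J.K.map (ldMap (rP A).inv) = (rT (J.K.obj (ld A))).hom
    simp only [id_tHom_comp, Category.assoc]
    rw [reassoc_of% J.χT_natural_right, ← J.K.map_comp, ← J.K.map_comp, ldTens_pUnit_left,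
      J.unitT_right]
  nP_assoc := by
    rintro ⟨A⟩ ⟨B⟩ ⟨E⟩
    change (J.K.map (ldPar (A ⊠ B) E) ≫ (J.χP (ld E) (ld (A ⊠ B))).hom) ≫
        ((J.K.map (ldPar A B) ≫ (J.χP (ld B) (ld A)).hom) ⅋ₘ 𝟙 (J.K.obj (ld E))) ≫
          (aP (J.K.obj (ld A)) (J.K.obj (ld B)) (J.K.obj (ld E))).hom
      = J.K.map (ldMap (aT A B E).inv) ≫
        (J.K.map (ldPar A (B ⊠ E)) ≫ (J.χP (ld (B ⊠ E)) (ld A)).hom) ≫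
          (𝟙 (J.K.obj (ld A)) ⅋ₘ (J.K.map (ldPar B E) ≫ (J.χP (ld E) (ld B)).hom))
    simp only [pHom_comp_id, id_pHom_comp, Category.assoc]
    rw [← reassoc_of% J.χP_natural_right, ← reassoc_of% J.χP_natural_left,
      J.χP_assoc, ← J.K.map_comp_assoc (ldPar (A ⊠ B) E), ldPar_assoc]
    simp only [J.K.map_comp, Category.assoc]
    rw [← J.K.map_comp_assoc (aP _ _ _).hom, Iso.hom_inv_id, J.K.map_id, Category.id_comp]
  nP_left_unit := by
    rintro ⟨A⟩
    change (J.K.map (ldPar (tUnit C) A) ≫ (J.χP (ld A) (ld (tUnit C))).hom) ≫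
        ((J.K.map (ldBot C) ≫ J.unitP.inv) ⅋ₘ 𝟙 (J.K.obj (ld A))) ≫ (lP (J.K.obj (ld A))).hom
      = J.K.map (ldMap (lT A).inv)
    simp only [pHom_comp_id, Category.assoc]
    rw [← reassoc_of% J.χP_natural_right, J.unitP_left, ← J.K.map_comp, ← J.K.map_comp,
      ldPar_tUnit_left]
  nP_right_unit := by
    rintro ⟨A⟩
    change (J.K.map (ldPar A (tUnit C)) ≫ (J.χP (ld (tUnit C)) (ld A)).hom) ≫
        (𝟙 (J.K.obj (ld A)) ⅋ₘ (J.K.map (ldBot C) ≫ J.unitP.inv)) ≫ (rP (J.K.obj (ld A))).hom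
      = J.K.map (ldMap (rT A).inv)
    simp only [id_pHom_comp, Category.assoc]
    rw [← reassoc_of% J.χP_natural_left, J.unitP_right, ← J.K.map_comp, ← J.K.map_comp,
      ldPar_tUnit_right]
  δL := by
    rintro ⟨A⟩ ⟨B⟩ ⟨E⟩
    -- The `δL` of `Cᵒᵖ` is `δR` in `C`. The left dual keeps it a `δR`, and `K` turns it into the
    -- `δL` of the target.
    change (𝟙 (J.K.obj (ld A)) ⊠ₘ (J.K.map (ldPar B E) ≫ (J.χP (ld E) (ld B)).hom)) ≫
        δL (J.K.obj (ld A)) (J.K.obj (ld B)) (J.K.obj (ld E)) ≫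
          (((J.χT (ld A) (ld B)).hom ≫ J.K.map (ldTens B A)) ⅋ₘ 𝟙 (J.K.obj (ld E)))
      = ((J.χT (ld A) (ld (B ⊠ E))).hom ≫ J.K.map (ldTens (B ⊠ E) A)) ≫
        J.K.map (ldMap (δR A B E)) ≫ J.K.map (ldPar (A ⅋ B) E) ≫
          (J.χP (ld E) (ld (A ⅋ B))).hom
    simp only [pHom_comp_id, id_tHom_comp, Category.assoc]
    rw [reassoc_of% (J.χ_δR (ld A) (ld B) (ld E)), ← J.χP_natural_right,
      reassoc_of% J.χT_natural_right]
    simp only [← J.K.map_comp_assoc]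
    rw [ldPar_δR_ldTens]
  δR := by
    rintro ⟨A⟩ ⟨B⟩ ⟨E⟩
    change ((J.K.map (ldPar B E) ≫ (J.χP (ld E) (ld B)).hom) ⊠ₘ 𝟙 (J.K.obj (ld A))) ≫
        δR (J.K.obj (ld B)) (J.K.obj (ld E)) (J.K.obj (ld A)) ≫
          (𝟙 (J.K.obj (ld B)) ⅋ₘ ((J.χT (ld E) (ld A)).hom ≫ J.K.map (ldTens A E)))
      = ((J.χT (ld (B ⊠ E)) (ld A)).hom ≫ J.K.map (ldTens A (B ⊠ E))) ≫
        J.K.map (ldMap (δL B E A)) ≫ J.K.map (ldPar B (E ⅋ A)) ≫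
          (J.χP (ld (E ⅋ A)) (ld B)).hom
    simp only [tHom_comp_id, id_pHom_comp, Category.assoc]
    rw [reassoc_of% (J.χ_δL (ld A) (ld E) (ld B)), ← J.χP_natural_left,
      reassoc_of% J.χT_natural_left]
    simp only [← J.K.map_comp_assoc]
    rw [ldPar_δL_ldTens]

end Conjugation

/-! ### The involutor -/

namespace Conjugation

section Involutor

variable {C : Type u} [Category.{v} C] [LinDistCat C] [StarAutonomous C] (J : Conjugation C)

/-- `(K (A^*))^* ≅ K A`: both are left duals of `K (A^*)`. -/
def ldConj (A : C) : ld (J.K.obj (ld A)) ≅ J.K.obj A :=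
  (isLinearDual_left (J.K.obj (ld A))).isoLeft ((isLinearDual_left A).conj J)

theorem conj_hom_ext {A Y : C} {f g : Y ⟶ J.K.obj A}
    (w : (𝟙 _ ⊠ₘ f) ≫ J.conjε (εl A) = (𝟙 _ ⊠ₘ g) ≫ J.conjε (εl A)) : f = g :=
  ((isLinearDual_left A).conj J).hom_ext_left w

theorem ldConj_pairing (A : C) :
    (𝟙 _ ⊠ₘ (J.ldConj A).hom) ≫ J.conjε (εl A) = εl (J.K.obj (ld A)) :=
  ((isLinearDual_left A).conj J).bendL_comp _

theorem ldConj_natural {A B : C} (f : A ⟶ B) :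
    ldMap (J.K.map (ldMap f)) ≫ (J.ldConj B).hom = (J.ldConj A).hom ≫ J.K.map f := by
  apply J.conj_hom_ext
  have h₁ := J.conjε_natural f (𝟙 (ld B)) (εl B)
  have h₂ := J.conjε_natural (𝟙 A) (ldMap f) (εl A)
  rw [J.K.map_id, ← ldMap_pairing] at h₁
  rw [J.K.map_id] at h₂
  simp only [id_tHom_comp, Category.assoc]
  rw [J.ldConj_pairing, ldMap_pairing, h₁, ← h₂, reassoc_of% (tHom_swap (J.K.map (ldMap f))
    (J.ldConj A).hom), J.ldConj_pairing]

/-- Paired with `K` of `(A ⊠ B)^*`, both sides become the pairing induced by the conjugate counits;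
`pairP_conjε` is what matches them. -/
theorem ldConj_tens (A B : C) :
    ldTens (J.K.obj (ld B)) (J.K.obj (ld A)) ≫
        ldMap (J.K.map (ldPar A B) ≫ (J.χP (ld B) (ld A)).hom) ≫ (J.ldConj (A ⊠ B)).hom
      = ((J.ldConj B).hom ⊠ₘ (J.ldConj A).hom) ≫ (J.χT B A).hom := by
  apply J.conj_hom_ext
  have h := J.conjε_natural (𝟙 (A ⊠ B)) (ldPar A B) (pairQ (εl A) (εl B))
  rw [J.K.map_id, ldPar_pairing] at h
  simp only [id_tHom_comp, Category.assoc]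
  rw [J.ldConj_pairing, ldMap_pairing,
    reassoc_of% (tHom_swap (J.K.map (ldPar A B) ≫ _) (ldTens _ _)),
    ldTens_pairing, ← h, reassoc_of% (tHom_swap (J.K.map (ldPar A B)) (J.χT B A).hom),
    ← pairP_conjε, ← reassoc_of% tHom_comp_id,
    reassoc_of% (tHom_swap (J.K.map (ldPar A B) ≫ (J.χP (ld B) (ld A)).hom)
      ((J.ldConj B).hom ⊠ₘ (J.ldConj A).hom)), pairP_right, J.ldConj_pairing, J.ldConj_pairing]

theorem ldConj_par (A B : C) :
    ldMap ((J.χT (ld A) (ld B)).hom ≫ J.K.map (ldTens B A)) ≫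
        ldPar (J.K.obj (ld A)) (J.K.obj (ld B)) ≫ ((J.ldConj B).hom ⅋ₘ (J.ldConj A).hom)
      = (J.ldConj (A ⅋ B)).hom ≫ (J.χP A B).hom := by
  apply ((isLinearDual_left A).conj J).isSeparating.pairQ ((isLinearDual_left B).conj J)
  have h := J.conjε_natural (𝟙 (A ⅋ B)) (ldTens B A) (εl (A ⅋ B))
  rw [J.K.map_id, ldTens_pairing] at h
  simp only [id_tHom_comp, Category.assoc]
  rw [pairQ_right, J.ldConj_pairing, J.ldConj_pairing, ldPar_pairing, ldMap_pairing,
    J.pairQ_conjε, ← h, ← reassoc_of% tHom_comp_id,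
    reassoc_of% (tHom_swap ((J.χT (ld A) (ld B)).hom ≫ J.K.map (ldTens B A))
      (J.ldConj (A ⅋ B)).hom), J.ldConj_pairing]

theorem ldConj_tUnit :
    ldTop C ≫ ldMap (J.K.map (ldBot C) ≫ J.unitP.inv) ≫ (J.ldConj (tUnit C)).hom
      = J.unitT.hom := by
  apply J.conj_hom_ext
  have h := J.conjε_natural (𝟙 (tUnit C)) (ldBot C) (lT (pUnit C)).hom
  rw [J.K.map_id, ldBot_pairing] at h
  have h' : (𝟙 (J.K.obj (pUnit C)) ⊠ₘ J.unitT.hom) ≫ J.conjε (lT (pUnit C)).hom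
      = (rT (J.K.obj (pUnit C))).hom ≫ J.unitP.inv := by
    rw [conjε, ← J.unitT_right]
    simp only [Category.assoc]
  simp only [id_tHom_comp, Category.assoc]
  rw [J.ldConj_pairing, ldMap_pairing, reassoc_of% (tHom_swap _ (ldTop C)), ldTop_pairing, ← h,
    reassoc_of% (tHom_swap (J.K.map (ldBot C)) J.unitT.hom), h', rT_natural,
    reassoc_of% rT_natural]

theorem ldConj_pUnit :
    ldMap (J.unitT.hom ≫ J.K.map (ldTop C)) ≫ ldBot C
      = (J.ldConj (pUnit C)).hom ≫ J.unitP.inv := by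
  -- Maps into `⊥` are tested against `⊤`, with the unitor in the role of the pairing.
  have inj {X : C} {f g : X ⟶ pUnit C} (w : (𝟙 (tUnit C) ⊠ₘ f) ≫ (lT (pUnit C)).hom
      = (𝟙 (tUnit C) ⊠ₘ g) ≫ (lT (pUnit C)).hom) : f = g := by
    rw [lT_natural, lT_natural, cancel_epi] at w
    exact w
  apply inj
  have h := J.conjε_natural (𝟙 (pUnit C)) (ldTop C) (εl (pUnit C))
  rw [J.K.map_id, ldTop_pairing] at h
  have h' : (J.unitT.hom ⊠ₘ 𝟙 (J.K.obj (pUnit C))) ≫ J.conjε (rT (pUnit C)).hom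
      = (lT (J.K.obj (pUnit C))).hom ≫ J.unitP.inv := by
    rw [conjε, ← J.unitT_left]
    simp only [Category.assoc]
  simp only [id_tHom_comp, Category.assoc]
  rw [ldBot_pairing, ldMap_pairing, ← J.ldConj_pairing, ← reassoc_of% (tHom_swap
    (J.unitT.hom ≫ J.K.map (ldTop C)) (J.ldConj (pUnit C)).hom), tHom_comp_id, Category.assoc, h,
    h', lT_natural]

/-- The canonical isomorphism from the double dagger of `A` to `A`. -/
def κ (A : C) : J.K.obj (ld (J.K.obj (ld A))) ≅ A := J.K.mapIso (J.ldConj A) ≪≫ J.ε.app A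

theorem κ_hom (A : C) : (J.κ A).hom = J.K.map (J.ldConj A).hom ≫ J.ε.hom.app A := rfl

theorem κ_natural {A B : C} (f : A ⟶ B) :
    J.K.map (ldMap (J.K.map (ldMap f))) ≫ (J.κ B).hom = (J.κ A).hom ≫ f := by
  rw [κ_hom, κ_hom, ← J.K.map_comp_assoc, ldConj_natural, J.K.map_comp_assoc, J.ε_natural,
    Category.assoc]

/-- The conjugate of `ldConj_pairing`, simplified by `conjε_conjε`. It determines `κ` through a
pairing. -/
theorem κ_pairing (A : C) :
    ((J.κ A).hom ⊠ₘ J.ε.hom.app (ld A)) ≫ εl A = J.conjε (εl (J.K.obj (ld A))) := by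
  have h := J.conjε_natural (𝟙 (J.K.obj (ld A))) (J.ldConj A).hom (J.conjε (εl A))
  rw [J.ldConj_pairing, J.K.map_id, conjε_conjε] at h
  rw [← h, ← Category.assoc, tHom_comp]
  exact congrArg (fun k => ((J.κ A).hom ⊠ₘ k) ≫ εl A) (Category.id_comp _).symm

theorem κ_triangle (A : C) :
    J.K.map (ldMap (J.κ A).hom) ≫ (J.κ (J.K.obj (ld A))).hom = 𝟙 _ := by
  have key : ldMap (J.κ A).hom ≫ (J.ldConj (J.K.obj (ld A))).hom ≫ J.ε.hom.app (ld A) = 𝟙 _ := by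
    apply ld_hom_ext
    -- Precomposing with the invertible `κ` makes the pairing start at the double dagger, where
    -- `κ_pairing` applies.
    rw [← cancel_epi (tIso (J.κ A) (Iso.refl (ld A))).hom]
    change ((J.κ A).hom ⊠ₘ 𝟙 _) ≫ _ = ((J.κ A).hom ⊠ₘ 𝟙 _) ≫ _
    rw [← reassoc_of% (tHom_swap (J.κ A).hom), tHom_id, Category.id_comp]
    simp only [id_tHom_comp, Category.assoc]
    rw [reassoc_of% (tHom_right_left (J.κ A).hom (J.ε.hom.app (ld A))), κ_pairing,
      J.ldConj_pairing, ldMap_pairing]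
  -- Since `ε K = K ε`, the whole composite is `K` applied to `key`.
  rw [J.κ_hom (J.K.obj (ld A)), ← J.map_ε, ← J.K.map_comp, ← J.K.map_comp, key, J.K.map_id]

theorem κ_tens (A B : C) :
    ((J.χT _ _).hom ≫ J.K.map (ldTens (J.K.obj (ld B)) (J.K.obj (ld A)))) ≫
        J.K.map (ldMap (J.K.map (ldPar A B) ≫ (J.χP (ld B) (ld A)).hom)) ≫ (J.κ (A ⊠ B)).hom
      = (J.κ A).hom ⊠ₘ (J.κ B).hom := by
  rw [κ_hom, Category.assoc, ← J.K.map_comp_assoc, ← J.K.map_comp_assoc, Category.assoc,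
    ldConj_tens,
    J.K.map_comp_assoc, ← reassoc_of% J.χT_natural, J.χT_ε, tHom_comp]
  rfl

theorem κ_par (A B : C) :
    J.K.map (ldMap ((J.χT (ld A) (ld B)).hom ≫ J.K.map (ldTens B A))) ≫
        (J.K.map (ldPar (J.K.obj (ld A)) (J.K.obj (ld B))) ≫ (J.χP _ _).hom) ≫
          ((J.κ A).hom ⅋ₘ (J.κ B).hom)
      = (J.κ (A ⅋ B)).hom := by
  rw [κ_hom, κ_hom, κ_hom, ← pHom_comp, Category.assoc, ← reassoc_of% J.χP_natural,
    ← J.χP_ε, ← J.K.map_comp_assoc, ← J.K.map_comp_assoc, Category.assoc, ldConj_par,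
    J.K.map_comp_assoc]

theorem κ_tUnit :
    (J.unitT.hom ≫ J.K.map (ldTop C)) ≫ J.K.map (ldMap (J.K.map (ldBot C) ≫ J.unitP.inv)) ≫
        (J.κ (tUnit C)).hom = 𝟙 (tUnit C) := by
  rw [κ_hom, Category.assoc, ← J.K.map_comp_assoc, ← J.K.map_comp_assoc, Category.assoc,
    ldConj_tUnit,
    J.unitT_comp_map]

theorem κ_pUnit :
    J.K.map (ldMap (J.unitT.hom ≫ J.K.map (ldTop C))) ≫ J.K.map (ldBot C) ≫ J.unitP.inv
      = (J.κ (pUnit C)).hom := by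
  have h := J.unitP_comp_map
  have h' : J.ε.hom.app (pUnit C) = J.K.map J.unitP.inv ≫ J.unitP.inv := by
    rw [← Iso.eq_inv_comp, Category.comp_id] at h
    have e : J.K.map J.unitP.inv ≫ J.K.map J.unitP.hom = 𝟙 _ := by
      rw [← J.K.map_comp, Iso.inv_hom_id, J.K.map_id]
    exact ((Category.id_comp _).symm.trans (congrArg (· ≫ J.ε.hom.app (pUnit C)) e.symm)).trans
      ((Category.assoc _ _ _).trans (congrArg (J.K.map J.unitP.inv ≫ ·) h))
  rw [κ_hom, h', ← J.K.map_comp_assoc, ldConj_pUnit, J.K.map_comp_assoc]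

end Involutor

/-! ### The linear adjunction given by the involutor -/

section DaggerStructure

variable {C : Type u} [Category.{v} C] [LinDistCat C] [StarAutonomous C] (J : Conjugation C)

/-- The colaxor of the double dagger. -/
def doubleDaggerP (A B : C) :
    J.daggerData.F.obj (op (J.daggerData.F.obj (op (A ⅋ B)))) ⟶
      J.daggerData.F.obj (op (J.daggerData.F.obj (op A))) ⅋
        J.daggerData.F.obj (op (J.daggerData.F.obj (op B))) :=
  J.daggerData.F.map (J.daggerData.mT (op A) (op B)).op ≫ J.daggerData.nP (op _) (op _)

/-- The laxor of the double dagger. -/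
def doubleDaggerT (A B : C) :
    J.daggerData.F.obj (op (J.daggerData.F.obj (op A))) ⊠
        J.daggerData.F.obj (op (J.daggerData.F.obj (op B))) ⟶
      J.daggerData.F.obj (op (J.daggerData.F.obj (op (A ⊠ B)))) :=
  J.daggerData.mT (op _) (op _) ≫ J.daggerData.F.map (J.daggerData.nP (op A) (op B)).op

/-- `κ`, with the double dagger as its domain. -/
def involutorIso (A : C) : J.daggerData.F.obj (op (J.daggerData.F.obj (op A))) ≅ A := J.κ A

/-- From this and `doubleDaggerT_comp`, the tensor, par and strength conditions of both linear
transformations follow by inverting `κ` on one or both factors. -/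
theorem doubleDaggerP_comp (A B : C) :
    J.doubleDaggerP A B ≫ ((J.involutorIso A).hom ⅋ₘ (J.involutorIso B).hom)
      = (J.involutorIso (A ⅋ B)).hom :=
  (Category.assoc _ _ _).trans (J.κ_par A B)

theorem doubleDaggerP_left (A B : C) :
    (J.involutorIso (A ⅋ B)).hom ≫ ((J.involutorIso A).inv ⅋ₘ 𝟙 B)
      = J.doubleDaggerP A B ≫ (𝟙 _ ⅋ₘ (J.involutorIso B).hom) := by
  rw [← doubleDaggerP_comp, Category.assoc, pHom_comp, Iso.hom_inv_id, Category.comp_id]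

theorem doubleDaggerP_right (A B : C) :
    (J.involutorIso (A ⅋ B)).hom ≫ (𝟙 A ⅋ₘ (J.involutorIso B).inv)
      = J.doubleDaggerP A B ≫ ((J.involutorIso A).hom ⅋ₘ 𝟙 _) := by
  rw [← doubleDaggerP_comp, Category.assoc, pHom_comp, Iso.hom_inv_id, Category.comp_id]

theorem inv_comp_doubleDaggerP (A B : C) :
    (J.involutorIso (A ⅋ B)).inv ≫ J.doubleDaggerP A B
      = (J.involutorIso A).inv ⅋ₘ (J.involutorIso B).inv := by
  rw [Iso.inv_comp_eq, ← doubleDaggerP_comp, Category.assoc, pHom_comp, Iso.hom_inv_id,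
    Iso.hom_inv_id, pHom_id, Category.comp_id]

theorem doubleDaggerT_comp (A B : C) :
    J.doubleDaggerT A B ≫ (J.involutorIso (A ⊠ B)).hom
      = (J.involutorIso A).hom ⊠ₘ (J.involutorIso B).hom :=
  (Category.assoc _ _ _).trans ((Category.assoc _ _ _).symm.trans
    ((Category.assoc _ _ _).trans (J.κ_tens A B)))

theorem doubleDaggerT_left (A B : C) :
    (𝟙 A ⊠ₘ (J.involutorIso B).hom) ≫ (J.involutorIso (A ⊠ B)).inv
      = ((J.involutorIso A).inv ⊠ₘ 𝟙 _) ≫ J.doubleDaggerT A B := by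
  rw [Iso.comp_inv_eq, Category.assoc, doubleDaggerT_comp, tHom_comp, Iso.inv_hom_id,
    Category.id_comp]

theorem doubleDaggerT_right (A B : C) :
    ((J.involutorIso A).hom ⊠ₘ 𝟙 B) ≫ (J.involutorIso (A ⊠ B)).inv
      = (𝟙 _ ⊠ₘ (J.involutorIso B).inv) ≫ J.doubleDaggerT A B := by
  rw [Iso.comp_inv_eq, Category.assoc, doubleDaggerT_comp, tHom_comp, Iso.inv_hom_id,
    Category.id_comp]

theorem doubleDaggerT_inv (A B : C) :
    ((J.involutorIso A).inv ⊠ₘ (J.involutorIso B).inv) ≫ J.doubleDaggerT A B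
      = (J.involutorIso (A ⊠ B)).inv := by
  rw [← Iso.comp_hom_eq_id, Category.assoc, doubleDaggerT_comp, tHom_comp, Iso.inv_hom_id,
    Iso.inv_hom_id, tHom_id]

theorem doubleDagger_tUnit :
    (J.daggerData.mU ≫ J.daggerData.F.map J.daggerData.nU.op) ≫ (J.involutorIso (tUnit C)).hom
      = 𝟙 (tUnit C) :=
  (Category.assoc _ _ _).trans J.κ_tUnit

theorem doubleDagger_pUnit :
    J.daggerData.F.map J.daggerData.mU.op ≫ J.daggerData.nU = (J.involutorIso (pUnit C)).hom :=
  J.κ_pUnit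

theorem involutorIso_natural {A B : C} (f : A ⟶ B) :
    J.daggerData.F.map (J.daggerData.F.map f.op).op ≫ (J.involutorIso B).hom
      = (J.involutorIso A).hom ≫ f := J.κ_natural f

theorem involutorIso_inv_natural {A B : C} (f : A ⟶ B) :
    f ≫ (J.involutorIso B).inv
      = (J.involutorIso A).inv ≫ J.daggerData.F.map (J.daggerData.F.map f.op).op := by
  rw [Iso.eq_inv_comp, ← Category.assoc, Iso.comp_inv_eq, involutorIso_natural]

theorem involutorIso_triangle (A : C) :
    J.daggerData.F.map (J.involutorIso A).hom.op ≫
      (J.involutorIso (J.daggerData.F.obj (op A))).hom = 𝟙 _ := J.κ_triangle A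

theorem involutorIso_inv_triangle (A : C) :
    (J.involutorIso (J.daggerData.F.obj (op A))).inv ≫
      J.daggerData.F.map (J.involutorIso A).inv.op = 𝟙 _ := by
  rw [Iso.inv_comp_eq, Category.comp_id]
  have h := J.involutorIso_triangle A
  have h' : J.daggerData.F.map (J.involutorIso A).inv.op ≫
      J.daggerData.F.map (J.involutorIso A).hom.op = 𝟙 _ := by
    rw [← Functor.map_comp, ← op_comp, Iso.hom_inv_id, op_id, CategoryTheory.Functor.map_id]
  rw [← Category.comp_id (J.daggerData.F.map (J.involutorIso A).inv.op), ← h,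
    reassoc_of% h']

/-- The adjunction of the tensor components of the dagger. -/
def daggerAdjT : J.daggerData.F ⊣ J.daggerData.F.rightOp where
  unit :=
    { app A := (J.involutorIso A.unop).hom.op
      naturality _ _ f := Quiver.Hom.unop_inj (J.involutorIso_natural f.unop).symm }
  counit :=
    { app A := (J.involutorIso A).hom
      naturality _ _ f := J.involutorIso_natural f }
  left_triangle_components A := J.involutorIso_triangle A.unop
  right_triangle_components A := Quiver.Hom.unop_inj (J.involutorIso_triangle A)

/-- The adjunction of the par components of the dagger. -/
def daggerAdjP : J.daggerData.F.rightOp ⊣ J.daggerData.F where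
  unit :=
    { app A := (J.involutorIso A).inv
      naturality _ _ f := J.involutorIso_inv_natural f }
  counit :=
    { app A := (J.involutorIso A.unop).inv.op
      naturality _ _ f := Quiver.Hom.unop_inj (J.involutorIso_inv_natural f.unop).symm }
  left_triangle_components A := Quiver.Hom.unop_inj (J.involutorIso_inv_triangle A)
  right_triangle_components A := J.involutorIso_inv_triangle A.unop

/-- The unit lives in `Cᵒᵖ`, so its tensor conditions are par conditions of `κ` in `C`, and
conversely. -/
theorem daggerUnit_linear :
    (LinearData.id Cᵒᵖ).IsLinearTrans (J.daggerData.toLinear.comp J.daggerData.toLinear.rightOp)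
      J.daggerAdjT.unit J.daggerAdjP.counit where
  tens A B := Quiver.Hom.unop_inj
    ((Category.comp_id _).trans (J.doubleDaggerP_comp A.unop B.unop).symm)
  tens_unit := Quiver.Hom.unop_inj ((Category.comp_id _).trans J.doubleDagger_pUnit.symm)
  par A B := Quiver.Hom.unop_inj
    ((Category.id_comp _).trans (J.doubleDaggerT_inv A.unop B.unop).symm)
  par_unit := Quiver.Hom.unop_inj ((Category.id_comp _).trans
    ((Iso.comp_hom_eq_id _).1 J.doubleDagger_tUnit).symm)
  νtR A B := Quiver.Hom.unop_inj (((Iso.comp_inv_eq _).1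
    (J.doubleDaggerT_left A.unop B.unop)).symm.trans (Category.comp_id _).symm)
  νtL A B := Quiver.Hom.unop_inj (((Iso.comp_inv_eq _).1
    (J.doubleDaggerT_right A.unop B.unop)).symm.trans (Category.comp_id _).symm)
  νpL A B := Quiver.Hom.unop_inj ((Category.assoc _ _ _).trans (((Iso.inv_comp_eq _).2
    (J.doubleDaggerP_left A.unop B.unop).symm).trans (Category.id_comp _).symm))
  νpR A B := Quiver.Hom.unop_inj ((Category.assoc _ _ _).trans (((Iso.inv_comp_eq _).2
    (J.doubleDaggerP_right A.unop B.unop).symm).trans (Category.id_comp _).symm))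

theorem daggerCounit_linear :
    (J.daggerData.toLinear.rightOp.comp J.daggerData.toLinear).IsLinearTrans (LinearData.id C)
      J.daggerAdjT.counit J.daggerAdjP.unit where
  tens A B := (J.doubleDaggerT_comp A B).trans (Category.comp_id _).symm
  tens_unit := J.doubleDagger_tUnit
  par A B := (J.inv_comp_doubleDaggerP A B).trans (Category.id_comp _).symm
  par_unit := (Iso.inv_comp_eq _).2 (J.doubleDagger_pUnit.trans (Category.comp_id _).symm)
  νtR A B := (congrArg (_ ≫ ·) (Category.id_comp _)).trans (J.doubleDaggerP_left A B)
  νtL A B := (congrArg (_ ≫ ·) (Category.id_comp _)).trans (J.doubleDaggerP_right A B)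
  νpL A B := (congrArg (_ ≫ ·) (Category.id_comp _)).trans (J.doubleDaggerT_left A B)
  νpR A B := (congrArg (_ ≫ ·) (Category.id_comp _)).trans (J.doubleDaggerT_right A B)

/-- The dagger `A ↦ K (A^*)`. -/
def dagger : Dagger J.daggerData where
  adj :=
    { left_linear := J.isFrobenius_daggerData.toLinear
      right_linear := J.isFrobenius_daggerData.toLinear_rightOp
      adjT := J.daggerAdjT
      adjP := J.daggerAdjP
      unit_linear := J.daggerUnit_linear
      counit_linear := J.daggerCounit_linear }
  isEquivalence :=
    { unit_tens :=
        (NatTrans.isIso_iff_isIso_app _).2 fun A => (J.involutorIso A.unop).op.isIso_hom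
      unit_par :=
        (NatTrans.isIso_iff_isIso_app _).2 fun A => (J.involutorIso A.unop).op.isIso_inv
      counit_tens := (NatTrans.isIso_iff_isIso_app _).2 fun A => (J.involutorIso A).isIso_hom
      counit_par := (NatTrans.isIso_iff_isIso_app _).2 fun A => (J.involutorIso A).isIso_inv }
  -- Unit and counit are both built from the same `κ`, so involutivity holds by definition.
  unit_eq_counit_tens _ := rfl
  unit_eq_counit_par _ := rfl

end DaggerStructure

/-! ### The maps between conjugates of duals and duals of conjugates -/

section Sigma

variable {C : Type u} [Category.{v} C] [LinDistCat C] [StarAutonomous C] (J : Conjugation C)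

/-- `^*(K A) ≅ K (A^*)`: both are right duals of `K A`. -/
def rdConj (A : C) : rd (J.K.obj A) ≅ J.K.obj (ld A) :=
  (isLinearDual_right (J.K.obj A)).isoRight ((isLinearDual_left A).conj J)

theorem rdConj_pairing (A : C) :
    ((J.rdConj A).hom ⊠ₘ 𝟙 _) ≫ J.conjε (εl A) = εr (J.K.obj A) :=
  ((isLinearDual_left A).conj J).bendR_comp _

theorem rdConj_natural {A B : C} (f : A ⟶ B) :
    rdMap (J.K.map f) ≫ (J.rdConj A).hom = (J.rdConj B).hom ≫ J.K.map (ldMap f) := by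
  apply ((isLinearDual_left A).conj J).hom_ext_right
  have h₁ := J.conjε_natural f (𝟙 (ld B)) (εl B)
  have h₂ := J.conjε_natural (𝟙 A) (ldMap f) (εl A)
  rw [J.K.map_id, ← ldMap_pairing] at h₁
  rw [J.K.map_id] at h₂
  simp only [tHom_comp_id, Category.assoc]
  rw [J.rdConj_pairing, rdMap_pairing, h₂, ← h₁, ← reassoc_of% (tHom_swap (J.rdConj B).hom
    (J.K.map f)), J.rdConj_pairing]

/-- Both sides pair with `^*(K A)` to its counit. This brings in `toLdRd`, where the double
dualization axiom of the cyclor starts. -/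
theorem ldMap_rdConj (A : C) :
    ldMap (J.rdConj A).hom = (J.ldConj A).hom ≫ toLdRd (J.K.obj A) := by
  apply ld_hom_ext
  simp only [id_tHom_comp, Category.assoc]
  rw [ldMap_pairing, toLdRd_pairing, ← J.rdConj_pairing,
    reassoc_of% (tHom_swap (J.rdConj A).hom (J.ldConj A).hom), J.ldConj_pairing]

/-- By `κ_pairing`, both sides have the same pairing with `A^*`. The remaining ingredient of the
unit formula is naturality of the cyclor. -/
theorem rdConj_comp_κ (A : C) :
    (J.rdConj (J.K.obj (ld A))).hom ≫ (J.κ A).hom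
      = rdMap (J.ε.inv.app (ld A)) ≫ fromRdLd A := by
  apply (isLinearDual_left A).hom_ext_right
  have e : J.ε.inv.app (ld A) ≫ J.ε.hom.app (ld A) = 𝟙 _ := Iso.inv_hom_id_app _ _
  have h : ((J.κ A).hom ⊠ₘ 𝟙 (ld A)) ≫ εl A
      = (𝟙 _ ⊠ₘ J.ε.inv.app (ld A)) ≫ J.conjε (εl (J.K.obj (ld A))) := by
    rw [← κ_pairing, ← Category.assoc, tHom_comp, e, Category.id_comp]
    rfl
  simp only [tHom_comp_id, Category.assoc]
  rw [h, fromRdLd_pairing, rdMap_pairing]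
  have s := tHom_swap (J.rdConj (J.K.obj (ld A))).hom (J.ε.inv.app (ld A))
  have := J.rdConj_pairing (J.K.obj (ld A))
  erw [← reassoc_of% s, this]
  rfl

variable (c : Cyclor C)

/-- The natural isomorphism with components `σ`. -/
def σIso : J.K.op ⋙ ldFunctor C ≅ ldFunctor C ⋙ J.K :=
  NatIso.ofComponents (fun A => c.ψ (J.K.obj A.unop) ≪≫ J.rdConj A.unop) (by
    rintro ⟨A⟩ ⟨B⟩ f
    change ldMap (J.K.map f.unop) ≫ (c.ψ (J.K.obj B)).hom ≫ (J.rdConj B).hom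
      = ((c.ψ (J.K.obj A)).hom ≫ (J.rdConj A).hom) ≫ J.K.map (ldMap f.unop)
    rw [Category.assoc, ← rdConj_natural, ← reassoc_of% (c.natural (J.K.map f.unop))])

theorem σIso_hom_app (A : C) : (J.σIso c).hom.app (op A) = J.σ c A := rfl

theorem toRdLd_fromRdLd (A : C) : toRdLd A ≫ fromRdLd A = 𝟙 A := by
  apply (isLinearDual_left A).hom_ext_right
  rw [tHom_comp_id, Category.assoc, fromRdLd_pairing, toRdLd_pairing, tHom_id, Category.id_comp]

/-- After cancelling `σ`, naturality of `ψ` at `ε⁻¹` turns the claim into `rdConj_comp_κ`. -/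
theorem κ_eq_unitMap (A : C) :
    (J.κ A).hom = (J.σIso c).inv.app (op (J.K.obj (ld A))) ≫ ldMap (J.ε.inv.app (ld A)) ≫
      (c.ψ (ld A)).hom ≫ fromRdLd A := by
  have h : (J.σIso c).hom.app (op (J.K.obj (ld A))) ≫ (J.κ A).hom
      = ldMap (J.ε.inv.app (ld A)) ≫ (c.ψ (ld A)).hom ≫ fromRdLd A := by
    have n := c.natural (J.ε.inv.app (ld A))
    change ((c.ψ (J.K.obj (J.K.obj (ld A)))).hom ≫ (J.rdConj (J.K.obj (ld A))).hom) ≫ _ = _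
    rw [Category.assoc, rdConj_comp_κ, reassoc_of% n]
  exact (Iso.inv_hom_id_app_assoc (J.σIso c) _ _).symm.trans
    (congrArg ((J.σIso c).inv.app (op (J.K.obj (ld A))) ≫ ·) h)

/-- Dualizing the two factors of `σ` yields `ldConj`, then `toLdRd`, then the dual of `ψ`. The
double dualization axiom turns the tail into `toRdLd`, which `fromRdLd` cancels, so that only
`ldConj` is left. -/
theorem κ_eq_counitMap (A : C) :
    (J.κ A).hom = J.K.map (ldMap (J.σ c A) ≫ (c.ψ (ld (J.K.obj A))).hom ≫
      fromRdLd (J.K.obj A)) ≫ J.ε.hom.app A := by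
  have h : J.σ c A = (c.ψ (J.K.obj A)).hom ≫ (J.rdConj A).hom := rfl
  rw [h, ldMap_comp, ldMap_rdConj]
  simp only [Category.assoc]
  rw [reassoc_of% (c.double_dual (J.K.obj A)), toRdLd_fromRdLd, Category.comp_id, κ_hom]

end Sigma

end Conjugation

theorem mainTheorem1 {C : Type u} [Category.{v} C] [LinDistCat C] [StarAutonomous C]
    (c : Cyclor C) (J : Conjugation C) (hJ : J.IsCyclic c) :
    ∃ S : J.K.op ⋙ ldFunctor C ≅ ldFunctor C ⋙ J.K,
      (∀ A : C, S.hom.app (op A) = J.σ c A) ∧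
      ∃ d : Dagger J.daggerData,
        (∀ A : C, d.unitMap A =
          S.inv.app (op (J.K.obj (ld A))) ≫ ldMap (J.ε.inv.app (ld A)) ≫
            (c.ψ (ld A)).hom ≫ fromRdLd A) ∧
        (∀ A : C, d.counitMap A =
          J.K.map (ldMap (J.σ c A) ≫ (c.ψ (ld (J.K.obj A))).hom ≫ fromRdLd (J.K.obj A)) ≫
            J.ε.hom.app A) ∧
        (∀ A : C, d.ι A ≫ d.counitMap A = 𝟙 A ∧
          d.counitMap A ≫ d.ι A =
            𝟙 (J.daggerData.F.obj (op (J.daggerData.F.obj (op A))))) :=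
  -- The tensor components of unit and counit are `κ` by definition, so both formulas are statements
  -- about `κ`.
  ⟨J.σIso c, J.σIso_hom_app c, J.dagger, J.κ_eq_unitMap c, J.κ_eq_counitMap c,
    fun A => ⟨(J.involutorIso A).inv_hom_id, (J.involutorIso A).hom_inv_id⟩⟩
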